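/- **Setting.** Let $d\ge 0$ be an integer, $\gamma>0$, and let $V:\mathbb R^d\to\mathbb R$ be a smooth function all of whose derivatives of order $\ge 2$ are bounded and such that $e^{-V}\in L^1(\mathbb R^d)$. Put $$\mu_\infty(v)=\frac{e^{-|v|^2/2}}{(2\pi)^{d/2}},\qquad \rho_\infty(x)=\frac{e^{-V(x)}}{\int e^{-V}\,dx},\qquad \mathcal M(x,v)=\rho_\infty(x)\mu_\infty(v),$$ and let $B^2$ be the Hilbert space of complex measurable functions $f$ on $\mathbb R^{2d}$ with $\|f\|_{B^2}^2=\iint |f|^2\mathcal M^{-1}\,dx\,dv<\infty$. The linear relaxation Boltzmann equation is $$\partial_t f+v\cdot\partial_x f-\partial_xV(x)\cdot\partial_v f=\gamma(\rho\,\mu_\infty-f),\qquad \rho(t,x)=\int f(t,x,v)\,dv,\qquad f|_{t=0}=f_0. \tag{1}$$ A solution of (1) is a function $f\in C([0,\infty);B^2)$ with $f(0)=f_0$ that satisfies the equation in the sense of distributions. Let $\Lambda^2-1$ be the closure in $B^2$ of the operator $-\gamma\,\partial_v\cdot(\partial_v+v)-\gamma\,\partial_x\cdot(\partial_x+\partial_xV)$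 with domain $C_0^\infty(\mathbb R^{2d})$. It has spectral gap $\alpha>0$ if $\alpha$ is the infimum of its spectrum deprived of the lowest eigenvalue, which is $0$. **Theorem 1.1.** For all $d$, all $\gamma>0$ and all constants $C_2,C_3$ there is a constant $A>0$, depending only on $d,\gamma,C_2,C_3$, with the following property. Let $V$ be as above, with second and third derivatives satisfying $\sup_x\|D^2V(x)\|\le C_2$ and $\sup_x\|D^3V(x)\|\le C_3$, and suppose that $\Lambda^2-1$ has a spectral gap $\alpha>0$ in $B^2$. Then for every $f_0\in B^2$ with $\iint f_0\,dx\,dv=1$ equation (1) has a unique solution $f$, and for all $t\ge 0$ $$\|f(t)-\mathcal M\|_{B^2}\le 3\,\|f_0-\mathcal M\|_{B^2}\,e^{-\alpha^2t/A}.$$ -/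

import Mathlib

open MeasureTheory
open scoped ContDiff Gradient NNReal

noncomputable section

namespace RelaxationBoltzmann

/-- The space `ℝ^d` with its Euclidean norm (positions, or velocities). -/
abbrev Pos (d : ℕ) : Type := EuclideanSpace ℝ (Fin d)

/-- The phase space `ℝ^d × ℝ^d` of pairs `(x, v)`, with the Lebesgue measure `dx dv`. -/
abbrev Phase (d : ℕ) : Type := Pos d × Pos d

variable {d : ℕ}

/-! ### The potential and the Maxwellians -/

/-- `V` is a confining potential: it is smooth, each of its derivatives of order at least two is
bounded on `ℝ^d`, and `e^{-V}` is integrable. -/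
structure IsConfining (V : Pos d → ℝ) : Prop where
  smooth : ContDiff ℝ ∞ V
  bounded : ∀ n : ℕ, 2 ≤ n → ∃ C : ℝ, ∀ x, ‖iteratedFDeriv ℝ n V x‖ ≤ C
  integrable : Integrable (fun x => Real.exp (-V x))

/-- The Maxwellian in velocity, `μ_∞(v) = (2π)^{-d/2} e^{-|v|²/2}`. -/
def velocityMaxwellian (v : Pos d) : ℝ :=
  Real.exp (-‖v‖ ^ 2 / 2) / (2 * Real.pi) ^ ((d : ℝ) / 2)

/-- The Maxwellian in position, `ρ_∞(x) = e^{-V(x)} / ∫ e^{-V}`. -/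
def spatialMaxwellian (V : Pos d → ℝ) (x : Pos d) : ℝ :=
  Real.exp (-V x) / ∫ y, Real.exp (-V y)

/-- The global Maxwellian `𝓜(x, v) = ρ_∞(x) μ_∞(v)`. -/
def maxwellian (V : Pos d → ℝ) (z : Phase d) : ℝ :=
  spatialMaxwellian V z.1 * velocityMaxwellian z.2

/-! ### The weighted space `B²` -/

/-- The measure `𝓜⁻¹ dx dv`. -/
def weight (V : Pos d → ℝ) : Measure (Phase d) :=
  (volume : Measure (Phase d)).withDensity fun z => ENNReal.ofReal (maxwellian V z)⁻¹

/-- The complex Hilbert space `B² = {f : f / 𝓜^{1/2} ∈ L²(dx dv)}`, with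
`‖f‖² = ∫ |f|² 𝓜⁻¹ dx dv`. -/
abbrev B2 (V : Pos d → ℝ) : Type := Lp ℂ 2 (weight V)

theorem measurable_maxwellian {V : Pos d → ℝ} (hV : IsConfining V) :
    Measurable (maxwellian V) := by
  have h : Measurable V := hV.smooth.continuous.measurable
  unfold maxwellian spatialMaxwellian velocityMaxwellian
  fun_prop

theorem maxwellian_nonneg (V : Pos d → ℝ) (z : Phase d) : 0 ≤ maxwellian V z := by
  unfold maxwellian spatialMaxwellian velocityMaxwellian
  have : 0 ≤ ∫ y, Real.exp (-V y) := integral_nonneg fun y => (Real.exp_pos _).le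
  positivity

theorem integrable_maxwellian {V : Pos d → ℝ} (hV : IsConfining V) :
    Integrable (maxwellian V) := by
  have h1 : Integrable (spatialMaxwellian V) := hV.integrable.div_const _
  have h2 : Integrable (velocityMaxwellian : Pos d → ℝ) := by
    have h := (GaussianFourier.integrable_cexp_neg_mul_sq_norm_add (V := Pos d)
      (b := (1 / 2 : ℂ)) (by norm_num) 0 0).norm
    refine Integrable.div_const (h.congr (Filter.Eventually.of_forall fun v => ?_)) _
    simp only [Complex.norm_exp]
    congr 1
    have : (-(1 / 2 : ℂ) * (‖v‖ : ℂ) ^ 2 + 0 * (inner ℝ (0 : Pos d) v : ℂ))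
        = ((-‖v‖ ^ 2 / 2 : ℝ) : ℂ) := by push_cast; ring
    rw [this, Complex.ofReal_re]
  exact h1.mul_prod h2

theorem memLp_maxwellian {V : Pos d → ℝ} (hV : IsConfining V) :
    MemLp (fun z => (maxwellian V z : ℂ)) 2 (weight V) := by
  have hm := measurable_maxwellian hV
  rw [memLp_two_iff_integrable_sq_norm (by fun_prop)]
  unfold weight
  rw [integrable_withDensity_iff (by fun_prop) (by simp)]
  refine (integrable_maxwellian hV).congr (Filter.Eventually.of_forall fun z => ?_)
  have h0 := maxwellian_nonneg V z
  simp only [Complex.norm_real, Real.norm_eq_abs, sq_abs]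
  rw [ENNReal.toReal_ofReal (inv_nonneg.2 h0)]
  by_cases h : maxwellian V z = 0
  · simp [h]
  · field_simp

/-- The global Maxwellian `𝓜` as an element of `B²`. -/
def maxwellianB2 {V : Pos d → ℝ} (hV : IsConfining V) : B2 V :=
  (memLp_maxwellian hV).toLp _

/-! ### The operator `Λ² - 1` and its spectral gap -/

/-- `∂f/∂x_j`. -/
def dx (j : Fin d) (f : Phase d → ℂ) (z : Phase d) : ℂ :=
  fderiv ℝ f z (EuclideanSpace.single j 1, 0)

/-- `∂f/∂v_j`. -/
def dv (j : Fin d) (f : Phase d → ℂ) (z : Phase d) : ℂ :=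
  fderiv ℝ f z (0, EuclideanSpace.single j 1)

/-- The differential expression
`(Λ² - 1) f = -γ ∂_v·(∂_v f + v f) - γ ∂_x·(∂_x f + (∂_x V) f)`. -/
def lambdaSqSubOne (γ : ℝ) (V : Pos d → ℝ) (f : Phase d → ℂ) (z : Phase d) : ℂ :=
  -γ * ∑ j, dv j (fun w => dv j f w + (w.2 j : ℂ) * f w) z
    - γ * ∑ j, dx j (fun w => dx j f w + ((∇ V w.1) j : ℂ) * f w) z

/-- The graph, in `B² × B²`, of the closure of the operator `Λ² - 1` with domain `C_0^∞`: the
closure of the set of pairs `(f, (Λ² - 1) f)` with `f` smooth and compactly supported. -/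
def closedGraph (γ : ℝ) (V : Pos d → ℝ) : Set (B2 V × B2 V) :=
  closure {p | ∃ φ : Phase d → ℂ, ContDiff ℝ ∞ φ ∧ HasCompactSupport φ ∧
    p.1 =ᵐ[weight V] φ ∧ p.2 =ᵐ[weight V] lambdaSqSubOne γ V φ}

/-- `c` is in the resolvent set of the (unbounded) operator `T` with graph `G`: the operator
`T - c` has a bounded everywhere defined two-sided inverse `R`. -/
def IsResolventPoint {H : Type*} [NormedAddCommGroup H] [NormedSpace ℂ H]
    (G : Set (H × H)) (c : ℂ) : Prop :=
  ∃ R : H →L[ℂ] H, (∀ h, (R h, h + c • R h) ∈ G) ∧ ∀ p ∈ G, R (p.2 - c • p.1) = p.1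

/-- The spectrum of the (unbounded) operator with graph `G`. -/
def graphSpectrum {H : Type*} [NormedAddCommGroup H] [NormedSpace ℂ H]
    (G : Set (H × H)) : Set ℂ :=
  {c | ¬ IsResolventPoint G c}

/-- `Λ² - 1` has the spectral gap `α > 0` in `B²`: the infimum of its spectrum deprived of the
lowest eigenvalue, which is `0`, is `α`. (The closure of `Λ² - 1` is self-adjoint, so its
spectrum is real.) -/
def HasSpectralGap (γ : ℝ) (V : Pos d → ℝ) (α : ℝ) : Prop :=
  0 < α ∧ IsGLB {r : ℝ | (r : ℂ) ∈ graphSpectrum (closedGraph γ V) ∧ r ≠ 0} α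

/-! ### The linear relaxation Boltzmann equation -/

/-- The collision operator `Q(f) = γ (ρ μ_∞ - f)`, where `ρ(x) = ∫ f(x, v) dv`. -/
def collision (γ : ℝ) (f : Phase d → ℂ) (z : Phase d) : ℂ :=
  γ * ((∫ v, f (z.1, v)) * velocityMaxwellian z.2 - f z)

/-- The function `f : [0, ∞) → B²` is a solution of
`∂_t f + v·∂_x f - ∂_x V(x)·∂_v f = Q(f)`, `f|_{t=0} = f₀`: it is continuous in time with values in
`B²`, it takes the initial value `f₀`, and it satisfies the equation in the sense of distributions,
in the form integrated in time. The function `φ` is the test function, and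
`(v, -∂_x V) ↦ v·∂_x φ - ∂_x V·∂_v φ` is the transport term after integration by parts. -/
structure IsSolution (γ : ℝ) (V : Pos d → ℝ) (f₀ : B2 V) (f : ℝ≥0 → B2 V) : Prop where
  continuous : Continuous f
  initial : f 0 = f₀
  equation : ∀ φ : Phase d → ℂ, ContDiff ℝ ∞ φ → HasCompactSupport φ → ∀ t : ℝ≥0,
    ∫ z, f t z * φ z = (∫ z, f₀ z * φ z) +
      ∫ s in (0 : ℝ)..t, ∫ z, (f s.toNNReal z * fderiv ℝ φ z (z.2, -∇ V z.1) +
        collision γ (f s.toNNReal) z * φ z)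

end RelaxationBoltzmann

end

open MeasureTheory Filter Topology
open scoped ContDiff Gradient NNReal

noncomputable section

namespace RelaxationBoltzmann

/-! ### Closed graphs in a Hilbert space -/

section Graph

theorem cauchySeq_of_dense {H : Type*} [NormedAddCommGroup H] {J : ℕ → H → H} (hJ : ∀ n x y, ‖J n x - J n y‖ ≤ ‖x - y‖) {D : Set H}
    (hD : Dense D) (h : ∀ x ∈ D, CauchySeq fun n => J n x) (x : H) : CauchySeq fun n => J n x := by
  rw [Metric.cauchySeq_iff']
  intro ε hε
  obtain ⟨y, hy, hxy⟩ := Metric.dense_iff.1 hD x (ε / 3) (by positivity)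
  obtain ⟨N, hN⟩ := Metric.cauchySeq_iff'.1 (h y hxy) (ε / 3) (by positivity)
  refine ⟨N, fun n hn => ?_⟩
  have h1 := hN n hn
  rw [Metric.mem_ball, dist_eq_norm] at hy
  rw [dist_eq_norm] at h1 ⊢
  have h2 := hJ n x y
  have h3 := hJ N y x
  rw [norm_sub_rev x y] at h2
  have : J n x - J N x = (J n x - J n y) + (J n y - J N y) + (J N y - J N x) := by abel
  rw [this]
  have := norm_add₃_le (a := J n x - J n y) (b := J n y - J N y) (c := J N y - J N x)
  linarith

theorem exists_inverse_of_dense_image {Y H : Type*} [NormedAddCommGroup Y] [NormedSpace ℂ Y]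
    [CompleteSpace Y] [NormedAddCommGroup H] [NormedSpace ℂ H] {G : Submodule ℂ Y} (hG : IsClosed (G : Set Y))
    (σ : Y →L[ℂ] H) (S : Submodule ℂ H) {C : ℝ} (hC0 : 0 ≤ C)
    (hC : ∀ y ∈ G, ‖y‖ ≤ C * ‖σ y‖)
    (hd : ∀ h ∈ S, h ∈ closure (σ '' G)) :
    ∃ ψ : S →L[ℂ] Y, ∀ h : S, ψ h ∈ G ∧ σ (ψ h) = h := by
  let T : G →L[ℂ] H := σ.comp G.subtypeL
  have hT : AntilipschitzWith ⟨C, hC0⟩ T :=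
    AddMonoidHomClass.antilipschitz_of_bound T fun y => hC y y.2
  have : CompleteSpace G := hG.completeSpace_coe
  have hr : IsClosed (Set.range T) := hT.isClosed_range T.uniformContinuous
  have hr' : Set.range T = σ '' G := by
    ext h; simp [T]
  have hex : ∀ h : S, ∃ y : Y, y ∈ G ∧ σ y = h := by
    intro h
    have := hd h h.2
    rw [← hr', hr.closure_eq, hr'] at this
    exact this
  choose ψ hψ using hex
  have hu : ∀ y ∈ G, ∀ y' ∈ G, σ y = σ y' → y = y' := by
    intro y hy y' hy' h
    have := hC (y - y') (G.sub_mem hy hy')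
    rw [map_sub, h, sub_self, norm_zero, mul_zero] at this
    exact sub_eq_zero.1 (norm_le_zero_iff.1 this)
  let ψl : S →ₗ[ℂ] Y :=
    { toFun := ψ
      map_add' := fun a b => hu _ (hψ _).1 _ (G.add_mem (hψ a).1 (hψ b).1) (by
        rw [map_add, (hψ _).2, (hψ _).2, (hψ _).2]; rfl)
      map_smul' := fun c a => hu _ (hψ _).1 _ (G.smul_mem c (hψ a).1) (by
        rw [RingHom.id_apply, map_smul, (hψ _).2, (hψ _).2]; rfl) }
  refine ⟨ψl.mkContinuous C fun h => ?_, hψ⟩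
  have := hC _ (hψ h).1
  rw [(hψ h).2] at this
  exact this

variable {H : Type*} [NormedAddCommGroup H] [InnerProductSpace ℂ H]

/-- `R` is the resolvent `(lam - B)⁻¹` of the operator with graph `G`, and it has the norm bound
of a dissipative operator. -/
structure IsDissipativeResolvent (G : Submodule ℂ (H × H)) (lam : ℝ) (R : H →L[ℂ] H) : Prop where
  mem : ∀ h, (R h, (lam : ℂ) • R h - h) ∈ G
  apply : ∀ p ∈ G, R ((lam : ℂ) • p.1 - p.2) = p.1
  norm_le : ∀ h, lam * ‖R h‖ ≤ ‖h‖

theorem exists_dissipativeResolvent [CompleteSpace H] {G : Submodule ℂ (H × H)} (hG : IsClosed (G : Set (H × H)))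
    (hdis : ∀ p ∈ G, (inner ℂ p.1 p.2).re ≤ 0) {lam : ℝ} (hl : 0 < lam)
    (hd : ∀ h, h ∈ closure {y | ∃ p ∈ G, (lam : ℂ) • p.1 - p.2 = y}) :
    ∃ R : H →L[ℂ] H, IsDissipativeResolvent G lam R := by
  have key : ∀ p ∈ G, lam * ‖p.1‖ ≤ ‖(lam : ℂ) • p.1 - p.2‖ := by
    intro p hp
    have h1 : (inner ℂ p.1 ((lam : ℂ) • p.1 - p.2)).re ≤ ‖p.1‖ * ‖(lam : ℂ) • p.1 - p.2‖ :=
      re_inner_le_norm (𝕜 := ℂ) _ _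
    have h2 : (inner ℂ p.1 ((lam : ℂ) • p.1 - p.2)).re
        = lam * ‖p.1‖ ^ 2 - (inner ℂ p.1 p.2).re := by
      rw [inner_sub_right, inner_smul_right, inner_self_eq_norm_sq_to_K]
      simp [← Complex.ofReal_pow]
    have h3 := hdis p hp
    rcases (norm_nonneg p.1).eq_or_lt with h0 | h0
    · rw [← h0]; simp
    · have : ‖p.1‖ * (lam * ‖p.1‖) ≤ ‖p.1‖ * ‖(lam : ℂ) • p.1 - p.2‖ := by nlinarith
      exact le_of_mul_le_mul_left this h0
  let σ : H × H →L[ℂ] H :=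
    (lam : ℂ) • ContinuousLinearMap.fst ℂ H H - ContinuousLinearMap.snd ℂ H H
  have hσ : ∀ p, σ p = (lam : ℂ) • p.1 - p.2 := fun p => rfl
  have hl' : 0 ≤ 1 / lam := by positivity
  obtain ⟨ψ, hψ⟩ := exists_inverse_of_dense_image hG σ ⊤ (C := 1 / lam + 2) (by positivity)
    (by
      intro p hp
      have h1 := key p hp
      rw [hσ]
      set N := ‖(lam : ℂ) • p.1 - p.2‖ with hN
      have h1' : ‖p.1‖ ≤ 1 / lam * N := by
        rw [one_div, inv_mul_eq_div, le_div_iff₀ hl]; linarith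
      have hN0 : 0 ≤ N := norm_nonneg _
      have h2 : ‖p.2‖ ≤ 2 * N := by
        have : p.2 = (lam : ℂ) • p.1 - ((lam : ℂ) • p.1 - p.2) := by abel
        calc ‖p.2‖ ≤ ‖(lam : ℂ) • p.1‖ + N := by
              conv_lhs => rw [this]
              exact norm_sub_le _ _
          _ = lam * ‖p.1‖ + N := by rw [norm_smul]; simp [abs_of_pos hl]
          _ ≤ 2 * N := by linarith
      rw [Prod.norm_def, add_mul]
      have : 0 ≤ 1 / lam * N := by positivity
      exact max_le (by linarith) (by linarith))
    (by
      intro h _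
      convert hd h using 2
      ext y; simp [hσ])
  have hm : ∀ h : H, h ∈ (⊤ : Submodule ℂ H) := fun _ => trivial
  let R : H →L[ℂ] H := (ContinuousLinearMap.fst ℂ H H).comp
    (ψ.comp ((ContinuousLinearMap.id ℂ H).codRestrict ⊤ hm))
  have hR : ∀ h, (R h, (lam : ℂ) • R h - h) ∈ G := by
    intro h
    obtain ⟨h1, h2⟩ := hψ ⟨h, hm h⟩
    rw [hσ] at h2
    have : (R h, (lam : ℂ) • R h - h) = ψ ⟨h, hm h⟩ := by
      refine Prod.ext rfl ?_
      change (lam : ℂ) • (ψ ⟨h, hm h⟩).1 - h = _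
      simp only at h2
      linear_combination (norm := module) h2
    rw [this]; exact h1
  refine ⟨R, hR, ?_, ?_⟩
  · intro p hp
    have h1 := G.sub_mem (hR ((lam : ℂ) • p.1 - p.2)) hp
    have h2 := key _ h1
    simp only [Prod.fst_sub, Prod.snd_sub] at h2
    have h3 : (lam : ℂ) • (R ((lam : ℂ) • p.1 - p.2) - p.1) -
        ((lam : ℂ) • R ((lam : ℂ) • p.1 - p.2) - ((lam : ℂ) • p.1 - p.2) - p.2) = 0 := by
      rw [smul_sub]; abel
    rw [h3, norm_zero] at h2
    have : ‖R ((lam : ℂ) • p.1 - p.2) - p.1‖ ≤ 0 := by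
      by_contra! h
      have := mul_pos hl h
      linarith
    exact sub_eq_zero.1 (norm_le_zero_iff.1 this)
  · intro h
    have := key _ (hR h)
    simpa using this

theorem IsDissipativeResolvent.commute {G : Submodule ℂ (H × H)} {l m : ℝ} {R S : H →L[ℂ] H}
    (hR : IsDissipativeResolvent G l R) (hS : IsDissipativeResolvent G m S) :
    Commute R S := by
  by_cases h : l = m
  · subst h
    have : R = S := by
      ext u
      have := hR.apply _ (hS.mem u)
      simpa using this
    rw [this]
  · ext u
    have h1 := hR.apply _ (hS.mem u)
    have h2 := hS.apply _ (hR.mem u)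
    simp only [map_sub, map_smul] at h1 h2
    have h3 : ((l : ℂ) - m) • (R (S u) - S (R u)) = 0 := by
      have h1' : (l : ℂ) • R (S u) - (m : ℂ) • R (S u) = S u - R u := by
        linear_combination (norm := module) h1
      have h2' : (l : ℂ) • S (R u) - (m : ℂ) • S (R u) = S u - R u := by
        linear_combination (norm := module) -h2
      rw [smul_sub, sub_smul, sub_smul, h1', h2', sub_self]
    have h4 : (l : ℂ) - m ≠ 0 := sub_ne_zero.2 (by exact_mod_cast h)
    have := (smul_eq_zero.1 h3).resolve_left h4
    exact sub_eq_zero.1 this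

theorem IsDissipativeResolvent.smul_tendsto {G : Submodule ℂ (H × H)} {l : ℕ → ℝ}
    {R : ℕ → H →L[ℂ] H} (hl0 : ∀ n, 0 < l n) (hl : Tendsto l atTop atTop)
    (hR : ∀ n, IsDissipativeResolvent G (l n) (R n)) (hD : Dense {x | ∃ p ∈ G, p.1 = x}) (x : H) :
    Tendsto (fun n => (l n : ℂ) • R n x) atTop (𝓝 x) := by
  have hb : ∀ n y, ‖(l n : ℂ) • R n y‖ ≤ ‖y‖ := fun n y => by
    rw [norm_smul]; simpa [abs_of_pos (hl0 n)] using (hR n).norm_le y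
  have h1 : ∀ p ∈ G, Tendsto (fun n => (l n : ℂ) • R n p.1) atTop (𝓝 p.1) := by
    intro p hp
    rw [tendsto_iff_norm_sub_tendsto_zero]
    have h2 : ∀ n, ‖(l n : ℂ) • R n p.1 - p.1‖ ≤ ‖p.2‖ * (l n)⁻¹ := by
      intro n
      have h3 := (hR n).apply p hp
      rw [map_sub, map_smul] at h3
      have h4 : (l n : ℂ) • R n p.1 - p.1 = R n p.2 := by
        linear_combination (norm := module) h3
      rw [h4, ← div_eq_mul_inv, le_div_iff₀ (hl0 n), mul_comm]
      exact (hR n).norm_le _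
    refine squeeze_zero (fun _ => norm_nonneg _) h2 ?_
    simpa using (hl.inv_tendsto_atTop).const_mul ‖p.2‖
  rw [Metric.tendsto_atTop]
  intro ε hε
  obtain ⟨y, hy, p, hp, rfl⟩ := Metric.dense_iff.1 hD x (ε / 3) (by positivity)
  obtain ⟨N, hN⟩ := Metric.tendsto_atTop.1 (h1 p hp) (ε / 3) (by positivity)
  refine ⟨N, fun n hn => ?_⟩
  have h2 := hN n hn
  rw [Metric.mem_ball, dist_eq_norm] at hy
  rw [dist_eq_norm] at h2 ⊢
  have h3 := hb n (x - p.1)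
  rw [norm_sub_rev x, map_sub, smul_sub] at h3
  have : (l n : ℂ) • R n x - x = ((l n : ℂ) • R n x - (l n : ℂ) • R n p.1)
      + ((l n : ℂ) • R n p.1 - p.1) + (p.1 - x) := by abel
  rw [this]
  have := norm_add₃_le (a := (l n : ℂ) • R n x - (l n : ℂ) • R n p.1)
    (b := (l n : ℂ) • R n p.1 - p.1) (c := p.1 - x)
  linarith

end Graph

end RelaxationBoltzmann

end

open MeasureTheory Filter Topology
open scoped ContDiff Gradient NNReal

noncomputable section

namespace RelaxationBoltzmann

/-! ### The semigroup of a maximal dissipative operator -/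

section Semigroup

variable {H : Type*} [NormedAddCommGroup H] [InnerProductSpace ℂ H] [CompleteSpace H]

open NormedSpace in
theorem hasDerivAt_exp_smul_apply (A : H →L[ℂ] H) (t : ℝ) (x : H) :
    HasDerivAt (fun s : ℝ => exp (s • A) x) (exp (t • A) (A x)) t := by
  have h := (hasDerivAt_exp_smul_const (𝕂 := ℝ) A t)
  exact ((ContinuousLinearMap.apply ℂ H x).restrictScalars ℝ).hasFDerivAt.comp_hasDerivAt t h

open NormedSpace in
theorem hasDerivAt_exp_smul_apply' (A : H →L[ℂ] H) (t : ℝ) (x : H) :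
    HasDerivAt (fun s : ℝ => exp (s • A) x) (A (exp (t • A) x)) t := by
  have h := (hasDerivAt_exp_smul_const' (𝕂 := ℝ) A t)
  exact ((ContinuousLinearMap.apply ℂ H x).restrictScalars ℝ).hasFDerivAt.comp_hasDerivAt t h

omit [CompleteSpace H] in
theorem _root_.HasDerivAt.re_inner {f g : ℝ → H} {f' g' : H} {t : ℝ} (hf : HasDerivAt f f' t)
    (hg : HasDerivAt g g' t) : HasDerivAt (fun s => (inner ℂ (f s) (g s)).re)
      ((inner ℂ f' (g t)).re + (inner ℂ (f t) g').re) t := by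
  have h := Complex.reCLM.hasFDerivAt.comp_hasDerivAt t (hf.inner ℂ hg)
  exact h.congr_deriv (by simp [add_comm])

open NormedSpace in
theorem norm_exp_smul_apply_le {A : H →L[ℂ] H} (hA : ∀ x, (inner ℂ (A x) x).re ≤ 0) {t : ℝ}
    (ht : 0 ≤ t) (x : H) : ‖exp (t • A) x‖ ≤ ‖x‖ := by
  have hd : ∀ s : ℝ, HasDerivAt (fun s : ℝ => (inner ℂ (exp (s • A) x) (exp (s • A) x)).re)
      (2 * (inner ℂ (A (exp (s • A) x)) (exp (s • A) x)).re) s := by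
    intro s
    have h := hasDerivAt_exp_smul_apply' A s x
    convert h.re_inner h using 1
    rw [← inner_conj_symm (exp (s • A) x) (A _), Complex.conj_re]; ring
  have hanti : Antitone (fun s : ℝ => (inner ℂ (exp (s • A) x) (exp (s • A) x)).re) :=
    antitone_of_hasDerivAt_nonpos hd fun s => by
      have := hA (exp (s • A) x)
      simp only [Pi.zero_apply]; linarith
  have := hanti ht
  simp only [zero_smul, exp_zero, inner_self_eq_norm_sq_to_K] at this
  have h2 : ‖exp (t • A) x‖ ^ 2 ≤ ‖x‖ ^ 2 := by
    simpa [← Complex.ofReal_pow] using this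
  exact (pow_le_pow_iff_left₀ (norm_nonneg _) (norm_nonneg _) two_ne_zero).1 h2

open NormedSpace in
theorem norm_exp_sub_exp_le {A B : H →L[ℂ] H} (hA : ∀ x, (inner ℂ (A x) x).re ≤ 0)
    (hB : ∀ x, (inner ℂ (B x) x).re ≤ 0) (hAB : Commute A B) {t : ℝ} (ht : 0 ≤ t) (x : H) :
    ‖exp (t • A) x - exp (t • B) x‖ ≤ ‖A x - B x‖ * t := by
  have hd : ∀ s : ℝ, HasDerivAt (fun s : ℝ => exp (s • A) (exp ((t - s) • B) x))
      (exp (s • A) (exp ((t - s) • B) (A x - B x))) s := by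
    intro s
    have h1 := hasDerivAt_exp_smul_const (𝕂 := ℝ) A s
    have h2 : HasDerivAt (fun s : ℝ => exp ((t - s) • B)) (-(exp ((t - s) • B) * B)) s := by
      have h := hasDerivAt_exp_smul_const (𝕂 := ℝ) B (t - s)
      have := h.scomp s ((hasDerivAt_id s).const_sub t)
      simpa [Function.comp_def] using this
    have h3 := (h1.mul h2)
    have h4 := ((ContinuousLinearMap.apply ℂ H x).restrictScalars ℝ).hasFDerivAt.comp_hasDerivAt s h3
    have hc : A * exp ((t - s) • B) = exp ((t - s) • B) * A :=
      ((hAB.smul_right (t - s)).exp_right).eq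
    refine h4.congr_deriv ?_
    have e : exp (s • A) * A * exp ((t - s) • B) + exp (s • A) * -(exp ((t - s) • B) * B)
        = exp (s • A) * (exp ((t - s) • B) * (A - B)) := by
      rw [mul_assoc, hc]; noncomm_ring
    rw [e]; rfl
  have := norm_image_sub_le_of_norm_deriv_le_segment' (a := 0) (b := t) (C := ‖A x - B x‖)
    (fun s _ => (hd s).hasDerivWithinAt)
    (fun s hs => (norm_exp_smul_apply_le hA hs.1 _).trans
      (norm_exp_smul_apply_le hB (by linarith [hs.2]) _)) t (Set.right_mem_Icc.2 ht)
  simpa using this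

/-- Hille–Yosida: the evolution equation `f' = B f` with `B` maximal dissipative has weak solutions
for all initial values. -/
theorem exists_evolution {G : Submodule ℂ (H × H)}
    (hD : Dense {x | ∃ p ∈ G, p.1 = x})
    {l : ℕ → ℝ} (hl0 : ∀ n, 0 < l n) (hl : Tendsto l atTop atTop)
    {R : ℕ → H →L[ℂ] H} (hR : ∀ n, IsDissipativeResolvent G (l n) (R n)) (f₀ : H) :
    ∃ f : ℝ≥0 → H, Continuous f ∧ f 0 = f₀ ∧
      ∀ e e' : H, (∀ p ∈ G, inner ℂ e p.2 = inner ℂ e' p.1) → ∀ t : ℝ≥0,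
        inner ℂ e (f t - f₀) = inner ℂ e' (∫ s in (0 : ℝ)..t, f s.toNNReal) := by
  set J : ℕ → H →L[ℂ] H := fun n => (l n : ℂ) • R n with hJ
  set B : ℕ → H →L[ℂ] H := fun n => (l n : ℂ) • (J n - 1) with hB
  have hJn : ∀ n x, ‖J n x‖ ≤ ‖x‖ := fun n y => by
    simp only [hJ, smul_apply]
    rw [norm_smul]; simpa [abs_of_pos (hl0 n)] using (hR n).norm_le y
  have hJ1 : ∀ x, Tendsto (fun n => J n x) atTop (𝓝 x) :=
    IsDissipativeResolvent.smul_tendsto hl0 hl hR hD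
  have hJB : ∀ n x, (J n x, B n x) ∈ G := by
    intro n x
    have := G.smul_mem (l n : ℂ) ((hR n).mem x)
    simpa [hJ, hB] using this
  have hBG : ∀ n, ∀ p ∈ G, B n p.1 = J n p.2 := by
    intro n p hp
    have h3 := (hR n).apply p hp
    rw [map_sub, map_smul] at h3
    simp only [hB, hJ, smul_apply, sub_apply,
      one_apply_eq_self]
    linear_combination (norm := module) (l n : ℂ) • h3
  have hBd : ∀ n x, (inner ℂ (B n x) x).re ≤ 0 := by
    intro n x
    have h1 : (inner ℂ (J n x) x).re ≤ ‖J n x‖ * ‖x‖ := re_inner_le_norm (𝕜 := ℂ) _ _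
    have h2 := hJn n x
    have h3 : (inner ℂ (B n x) x).re = l n * ((inner ℂ (J n x) x).re - ‖x‖ ^ 2) := by
      simp only [hB, smul_apply, sub_apply,
        one_apply_eq_self]
      rw [inner_smul_left, inner_sub_left, inner_self_eq_norm_sq_to_K]
      simp [← Complex.ofReal_pow]
    rw [h3]
    refine mul_nonpos_of_nonneg_of_nonpos (hl0 n).le ?_
    nlinarith [norm_nonneg x]
  have hcomm : ∀ n m, Commute (B n) (B m) := by
    intro n m
    have : Commute (J n) (J m) := (((hR n).commute (hR m)).smul_left _).smul_right _
    exact (((this.sub_left (Commute.one_left _)).sub_right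
      ((Commute.one_right _).sub_left (Commute.one_left _))).smul_left _).smul_right _
  set S : ℕ → ℝ≥0 → H → H := fun n t x => NormedSpace.exp ((t : ℝ) • B n) x with hS
  have hSsub : ∀ n t x y, ‖S n t x - S n t y‖ ≤ ‖x - y‖ := fun n t x y => by
    simp only [hS]
    rw [← map_sub]
    exact norm_exp_smul_apply_le (hBd n) t.2 _
  have hcau : ∀ t x, CauchySeq fun n => S n t x := by
    intro t
    refine cauchySeq_of_dense (fun n x y => hSsub n t x y) hD ?_
    rintro x ⟨p, hp, rfl⟩
    have hc : CauchySeq fun n => B n p.1 := by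
      simp_rw [hBG _ p hp]
      exact (hJ1 p.2).cauchySeq
    rw [Metric.cauchySeq_iff'] at hc ⊢
    intro ε hε
    have ht : (0 : ℝ) < t + 1 := by positivity
    obtain ⟨N, hN⟩ := hc (ε / (t + 1)) (by positivity)
    refine ⟨N, fun n hn => ?_⟩
    have h1 := hN n hn
    rw [dist_eq_norm] at h1 ⊢
    refine (norm_exp_sub_exp_le (hBd n) (hBd N) (hcomm n N) t.2 p.1).trans_lt ?_
    rw [lt_div_iff₀ ht] at h1
    have h0 : 0 ≤ ‖B n p.1 - B N p.1‖ := norm_nonneg _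
    change ‖B n p.1 - B N p.1‖ * (t : ℝ) < ε
    nlinarith
  choose T hT using fun x t => cauchySeq_tendsto_of_complete (hcau t x)
  have hTsub : ∀ t x y, ‖T x t - T y t‖ ≤ ‖x - y‖ := fun t x y =>
    le_of_tendsto ((hT x t).sub (hT y t)).norm (Eventually.of_forall fun n => hSsub n t x y)
  have hTD : ∀ p ∈ G, LipschitzWith ‖p.2‖₊ (T p.1) := by
    intro p hp
    refine LipschitzWith.of_dist_le_mul fun t s => ?_
    rw [dist_eq_norm]
    refine le_of_tendsto ((hT p.1 t).sub (hT p.1 s)).norm (Eventually.of_forall fun n => ?_)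
    have key : ∀ s t : ℝ≥0, s ≤ t → ‖S n t p.1 - S n s p.1‖ ≤ ‖p.2‖ * (t - s) := by
      intro s t hst
      refine norm_image_sub_le_of_norm_deriv_le_segment' (a := (s : ℝ)) (b := t)
        (f := fun r : ℝ => NormedSpace.exp (r • B n) p.1)
        (fun r _ => (hasDerivAt_exp_smul_apply (B n) r p.1).hasDerivWithinAt)
        (fun r hr => ?_) t (Set.right_mem_Icc.2 (by exact_mod_cast hst))
      refine (norm_exp_smul_apply_le (hBd n) (s.2.trans hr.1) _).trans ?_
      rw [hBG n p hp]
      exact hJn n _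
    rcases le_total s t with h | h
    · refine (key s t h).trans (le_of_eq ?_)
      rw [NNReal.dist_eq, abs_of_nonneg (sub_nonneg.2 (by exact_mod_cast h))]; rfl
    · rw [norm_sub_rev]
      refine (key t s h).trans (le_of_eq ?_)
      rw [dist_comm, NNReal.dist_eq, abs_of_nonneg (sub_nonneg.2 (by exact_mod_cast h))]; rfl
  have hTc : ∀ x, Continuous (T x) := by
    intro x
    obtain ⟨u, hu, hux⟩ := mem_closure_iff_seq_limit.1 (hD x)
    have hlim : TendstoUniformly (fun k => T (u k)) (T x) atTop := by
      rw [Metric.tendstoUniformly_iff]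
      intro ε hε
      filter_upwards [(Metric.tendsto_atTop.1 hux ε hε).choose_spec |> fun h =>
        eventually_atTop.2 ⟨_, h⟩] with k hk t
      rw [dist_comm, dist_eq_norm] at *
      refine (hTsub t _ _).trans_lt ?_
      rwa [norm_sub_rev]
    refine hlim.continuous (Frequently.of_forall fun k => ?_)
    obtain ⟨p, hp, hpk⟩ := hu k
    rw [← hpk]
    exact (hTD p hp).continuous
  refine ⟨T f₀, hTc f₀, ?_, ?_⟩
  · refine tendsto_nhds_unique (hT f₀ 0) ?_
    simp [hS]
  · intro e e' hee t
    have hSc : ∀ n, Continuous fun s : ℝ => NormedSpace.exp (s • B n) f₀ := fun n =>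
      continuous_iff_continuousAt.2 fun s => (hasDerivAt_exp_smul_apply (B n) s f₀).continuousAt
    have h1 : ∀ n, S n t f₀ - f₀ = ∫ s in (0 : ℝ)..t, B n (NormedSpace.exp (s • B n) f₀) := by
      intro n
      rw [intervalIntegral.integral_eq_sub_of_hasDerivAt
        (fun s _ => hasDerivAt_exp_smul_apply' (B n) s f₀)
        (((B n).continuous.comp (hSc n)).intervalIntegrable _ _)]
      simp [hS]
    have h2 : ∀ n, inner ℂ e (S n t f₀ - f₀)
        = ∫ s in (0 : ℝ)..t, inner ℂ e' (J n (NormedSpace.exp (s • B n) f₀)) := by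
      intro n
      rw [h1]
      have := (innerSL ℂ e).intervalIntegral_comp_comm
        (((B n).continuous.comp (hSc n)).intervalIntegrable (μ := volume) 0 (t : ℝ))
      simp only [innerSL_apply_apply, Function.comp_apply] at this
      rw [← this]
      refine intervalIntegral.integral_congr fun s _ => ?_
      exact hee _ (hJB n _)
    have h3 : Tendsto (fun n => inner ℂ e (S n t f₀ - f₀)) atTop (𝓝 (inner ℂ e (T f₀ t - f₀))) :=
      tendsto_const_nhds.inner ((hT f₀ t).sub_const _)
    have hTi : IntervalIntegrable (fun s : ℝ => T f₀ s.toNNReal) volume 0 t :=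
      ((hTc f₀).comp continuous_real_toNNReal).intervalIntegrable _ _
    have h4 := (innerSL ℂ e').intervalIntegral_comp_comm hTi
    simp only [innerSL_apply_apply] at h4
    rw [← h4]
    refine tendsto_nhds_unique h3 ?_
    simp_rw [h2]
    refine intervalIntegral.tendsto_integral_filter_of_dominated_convergence
      (fun _ => ‖e'‖ * ‖f₀‖) (Eventually.of_forall fun n => ?_) (Eventually.of_forall fun n => ?_)
      (by simp) (Eventually.of_forall fun s hs => ?_)
    · exact (continuous_const.inner ((J n).continuous.comp (hSc n))).aestronglyMeasurable
    · refine Eventually.of_forall fun s hs => ?_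
      rw [Set.uIoc_of_le t.coe_nonneg] at hs
      exact (norm_inner_le_norm _ _).trans (mul_le_mul_of_nonneg_left
        ((hJn n _).trans (norm_exp_smul_apply_le (hBd n) hs.1.le _)) (norm_nonneg _))
    · rw [Set.uIoc_of_le t.coe_nonneg] at hs
      refine tendsto_const_nhds.inner ?_
      have h5 := hT f₀ s.toNNReal
      have h6 : Tendsto (fun n => J n (S n s.toNNReal f₀ - T f₀ s.toNNReal)
          + J n (T f₀ s.toNNReal)) atTop (𝓝 (0 + T f₀ s.toNNReal)) := by
        refine Tendsto.add ?_ (hJ1 _)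
        rw [tendsto_iff_norm_sub_tendsto_zero] at h5
        exact squeeze_zero_norm (fun n => hJn n _) h5
      rw [zero_add] at h6
      refine h6.congr fun n => ?_
      rw [← map_add, sub_add_cancel]
      simp [hS, hs.1.le]

end Semigroup

end RelaxationBoltzmann

end

open MeasureTheory Filter Topology
open scoped ContDiff Gradient NNReal

noncomputable section

namespace RelaxationBoltzmann

/-! ### Bounded perturbations of skew-adjoint operators -/

section Skew

variable {H : Type*} [NormedAddCommGroup H] [InnerProductSpace ℂ H]

/-- The submodule `X` is the graph of a skew-adjoint operator. -/
structure IsSkewAdjointGraph (X : Submodule ℂ (H × H)) : Prop where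
  closed : IsClosed (X : Set (H × H))
  skew : ∀ p ∈ X, ∀ q ∈ X, inner ℂ p.1 q.2 = -inner ℂ p.2 q.1
  dense_add : ∃ l₀ : ℝ, ∀ l : ℝ, l₀ ≤ l → ∀ h, h ∈ closure {y | ∃ p ∈ X, (l : ℂ) • p.1 + p.2 = y}
  dense_sub : ∃ l₀ : ℝ, ∀ l : ℝ, l₀ ≤ l → ∀ h, h ∈ closure {y | ∃ p ∈ X, (l : ℂ) • p.1 - p.2 = y}
  dense_domain : Dense {x | ∃ p ∈ X, p.1 = x}

/-- The graph of `Q - X`. -/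
def perturbedGraph (X : Submodule ℂ (H × H)) (Q : H →L[ℂ] H) : Submodule ℂ (H × H) :=
  X.comap ((ContinuousLinearMap.fst ℂ H H).prod
    (Q.comp (ContinuousLinearMap.fst ℂ H H) - ContinuousLinearMap.snd ℂ H H)).toLinearMap

theorem mem_perturbedGraph {X : Submodule ℂ (H × H)} {Q : H →L[ℂ] H} {p : H × H} :
    p ∈ perturbedGraph X Q ↔ (p.1, Q p.1 - p.2) ∈ X := Iff.rfl

theorem IsSkewAdjointGraph.re_inner_eq_zero {X : Submodule ℂ (H × H)} (hX : IsSkewAdjointGraph X)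
    {p : H × H} (hp : p ∈ X) : (inner ℂ p.1 p.2).re = 0 := by
  have h := congrArg Complex.re (hX.skew p hp p hp)
  rw [Complex.neg_re, ← inner_conj_symm p.2 p.1, Complex.conj_re] at h
  linarith

theorem IsSkewAdjointGraph.isClosed_perturbedGraph {X : Submodule ℂ (H × H)}
    (hX : IsSkewAdjointGraph X) (Q : H →L[ℂ] H) :
    IsClosed (perturbedGraph X Q : Set (H × H)) :=
  hX.closed.preimage (ContinuousLinearMap.continuous _)

variable [CompleteSpace H]

theorem IsSkewAdjointGraph.exists_resolvent_neg {X : Submodule ℂ (H × H)}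
    (hX : IsSkewAdjointGraph X) : ∃ l₀ : ℝ, ∀ l : ℝ, l₀ ≤ l →
      ∃ R, IsDissipativeResolvent (perturbedGraph X 0) l R := by
  obtain ⟨l₀, h⟩ := hX.dense_add
  refine ⟨max l₀ 1, fun l hl => exists_dissipativeResolvent (hX.isClosed_perturbedGraph 0) ?_
    (zero_lt_one.trans_le ((le_max_right _ _).trans hl)) fun y => ?_⟩
  · intro p hp
    have := hX.re_inner_eq_zero (mem_perturbedGraph.1 hp)
    simp only [zero_apply, zero_sub, inner_neg_right, Complex.neg_re] at this
    linarith
  · refine closure_mono ?_ (h l ((le_max_left _ _).trans hl) y)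
    rintro _ ⟨p, hp, rfl⟩
    refine ⟨(p.1, -p.2), by simpa [mem_perturbedGraph] using hp, by simp⟩

theorem IsSkewAdjointGraph.exists_resolvent {X : Submodule ℂ (H × H)}
    (hX : IsSkewAdjointGraph X) : ∃ l₀ : ℝ, ∀ l : ℝ, l₀ ≤ l →
      ∃ R, IsDissipativeResolvent X l R := by
  obtain ⟨l₀, h⟩ := hX.dense_sub
  exact ⟨max l₀ 1, fun l hl => exists_dissipativeResolvent hX.closed
    (fun p hp => (hX.re_inner_eq_zero hp).le)
    (zero_lt_one.trans_le ((le_max_right _ _).trans hl)) (h l ((le_max_left _ _).trans hl))⟩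

theorem IsSkewAdjointGraph.exists_resolvent_perturbed {X : Submodule ℂ (H × H)}
    (hX : IsSkewAdjointGraph X) {Q : H →L[ℂ] H} (hQ : ∀ x, (inner ℂ x (Q x)).re ≤ 0) :
    ∃ l₀ : ℝ, ∀ l : ℝ, l₀ ≤ l → ∃ R, IsDissipativeResolvent (perturbedGraph X Q) l R := by
  obtain ⟨l₀, h⟩ := hX.exists_resolvent_neg
  refine ⟨max l₀ (‖Q‖ + 1), fun l hl => ?_⟩
  have hlQ : ‖Q‖ < l := by linarith [(le_max_right l₀ (‖Q‖ + 1)).trans hl]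
  have hl0 : 0 < l := (norm_nonneg _).trans_lt hlQ
  obtain ⟨R, hR⟩ := h l ((le_max_left _ _).trans hl)
  refine exists_dissipativeResolvent (hX.isClosed_perturbedGraph Q) ?_ hl0 fun y => ?_
  · intro p hp
    have h1 := hX.re_inner_eq_zero (mem_perturbedGraph.1 hp)
    have h2 := hQ p.1
    simp only [inner_sub_right, Complex.sub_re] at h1
    linarith
  · have hn : ‖Q.comp R‖ < 1 := by
      have h1 : ‖R‖ ≤ l⁻¹ := ContinuousLinearMap.opNorm_le_bound _ (by positivity) fun x => by
        rw [inv_mul_eq_div, le_div_iff₀ hl0, mul_comm]; exact hR.norm_le x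
      calc ‖Q.comp R‖ ≤ ‖Q‖ * ‖R‖ := ContinuousLinearMap.opNorm_comp_le _ _
        _ ≤ ‖Q‖ * l⁻¹ := by gcongr
        _ < 1 := by rw [← div_eq_mul_inv, div_lt_one hl0]; exact hlQ
    obtain ⟨u, hu⟩ := isUnit_one_sub_of_norm_lt_one hn
    refine subset_closure ⟨(R (u⁻¹.1 y), l • R (u⁻¹.1 y) - y), ?_, by simp⟩
    have h1 := mem_perturbedGraph.1 (hR.mem (u⁻¹.1 y))
    rw [mem_perturbedGraph]
    convert h1 using 2
    have h2 : (1 - Q.comp R) (u⁻¹.1 y) = y := by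
      rw [← hu]
      change (u.1 * u⁻¹.1) y = y
      rw [Units.mul_inv]; rfl
    simp only [sub_apply, one_apply_eq_self, ContinuousLinearMap.comp_apply] at h2
    simp only [zero_apply]
    rw [Complex.coe_smul]
    linear_combination (norm := module) -h2

/-- `f` is a weak solution of `f' = (Q - X) f` with `f 0 = f₀`. -/
structure IsMildSolution (X : Submodule ℂ (H × H)) (Q : H →L[ℂ] H) (f₀ : H) (f : ℝ≥0 → H) :
    Prop where
  continuous : Continuous f
  initial : f 0 = f₀
  equation : ∀ p ∈ X, ∀ t : ℝ≥0, inner ℂ p.1 (f t - f₀ - Q (∫ s in (0 : ℝ)..t, f s.toNNReal))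
    = inner ℂ p.2 (∫ s in (0 : ℝ)..t, f s.toNNReal)

omit [CompleteSpace H] in
theorem tendsto_natCast_add_const (l₀ : ℝ) : Tendsto (fun n : ℕ => (n : ℝ) + l₀) atTop atTop :=
  tendsto_atTop_add_const_right _ _ tendsto_natCast_atTop_atTop

theorem IsSkewAdjointGraph.exists_isMildSolution {X : Submodule ℂ (H × H)}
    (hX : IsSkewAdjointGraph X) {Q : H →L[ℂ] H} (hQ : ∀ x, (inner ℂ x (Q x)).re ≤ 0) (f₀ : H) :
    ∃ f, IsMildSolution X Q f₀ f := by
  obtain ⟨l₀, h⟩ := hX.exists_resolvent_perturbed hQ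
  have hl : ∀ n : ℕ, l₀ ≤ n + (|l₀| + 1) := fun n => by
    have := le_abs_self l₀
    have : (0 : ℝ) ≤ n := n.cast_nonneg
    linarith
  choose R hR using fun n : ℕ => h _ (hl n)
  obtain ⟨f, hf, hf0, hfe⟩ := exists_evolution (G := perturbedGraph X Q) (by
      convert hX.dense_domain using 3 with x
      constructor
      · rintro ⟨p, hp, rfl⟩; exact ⟨_, hp, rfl⟩
      · rintro ⟨p, hp, rfl⟩
        exact ⟨(p.1, Q p.1 - p.2), by simpa [mem_perturbedGraph] using hp, rfl⟩)
    (fun n => by positivity) (tendsto_natCast_add_const _) hR f₀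
  refine ⟨f, hf, hf0, fun p hp t => ?_⟩
  have := hfe p.1 (p.2 + Q.adjoint p.1) (fun q hq => ?_) t
  · rw [inner_sub_right, this, inner_add_left, ContinuousLinearMap.adjoint_inner_left]
    ring
  · have h1 := hX.skew p hp _ (mem_perturbedGraph.1 hq)
    rw [inner_add_left, ContinuousLinearMap.adjoint_inner_left]
    simp only [inner_sub_right] at h1
    linear_combination -h1

theorem IsMildSolution.lyapunov {X : Submodule ℂ (H × H)} (hX : IsSkewAdjointGraph X)
    {Q : H →L[ℂ] H} {f₀ : H} {f : ℝ≥0 → H} (hf : IsMildSolution X Q f₀ f) (K : H →L[ℂ] H)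
    (r c : ℝ) (hc : 0 ≤ c) (e₀ : H)
    (h : ∀ p ∈ X, (inner ℂ (K (Q p.1 - p.2)) p.1).re + (inner ℂ (K p.1) (Q p.1 - p.2)).re
      ≤ -(r * (inner ℂ (K p.1) p.1).re) + c * ‖(inner ℂ e₀ p.1 : ℂ)‖ ^ 2)
    (he : ∀ t, inner ℂ e₀ (f t) = 0) (t : ℝ≥0) :
    (inner ℂ (K (f t)) (f t)).re ≤ Real.exp (-(r * t)) * (inner ℂ (K f₀) f₀).re := by
  obtain ⟨l₁, hl₁⟩ := hX.exists_resolvent_neg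
  obtain ⟨l₂, hl₂⟩ := hX.exists_resolvent
  set l : ℕ → ℝ := fun n => n + (|l₁| + |l₂| + 1) with hl
  have hl0 : ∀ n, 0 < l n := fun n => by positivity
  have hle : ∀ n, l₁ ≤ l n ∧ l₂ ≤ l n := fun n => by
    have h1 := le_abs_self l₁
    have h2 := le_abs_self l₂
    have h3 := abs_nonneg l₁
    have h4 := abs_nonneg l₂
    have : (0 : ℝ) ≤ n := n.cast_nonneg
    constructor <;> simp only [hl] <;> linarith
  have hlt : Tendsto l atTop atTop := tendsto_natCast_add_const _
  choose R hR using fun n => hl₁ _ (hle n).1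
  choose S hS using fun n => hl₂ _ (hle n).2
  set J : ℕ → H →L[ℂ] H := fun n => (l n : ℂ) • R n with hJ
  have hJn : ∀ n x, ‖J n x‖ ≤ ‖x‖ := fun n y => by
    simp only [hJ, smul_apply]
    rw [norm_smul]; simpa [abs_of_pos (hl0 n)] using (hR n).norm_le y
  have hJ1 : ∀ x, Tendsto (fun n => J n x) atTop (𝓝 x) := by
    refine IsDissipativeResolvent.smul_tendsto hl0 hlt hR ?_
    convert hX.dense_domain using 3 with x
    constructor
    · rintro ⟨p, hp, rfl⟩; exact ⟨_, hp, rfl⟩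
    · rintro ⟨p, hp, rfl⟩
      exact ⟨(p.1, -p.2), by simpa [mem_perturbedGraph] using hp, rfl⟩
  have hRX : ∀ n y, (R n y, y - (l n : ℂ) • R n y) ∈ X := fun n y => by
    have := mem_perturbedGraph.1 ((hR n).mem y)
    simpa using this
  have hadj : ∀ n x y, inner ℂ (S n x) y = inner ℂ x (R n y) := by
    intro n x y
    have := hX.skew _ ((hS n).mem x) _ (hRX n y)
    simp only [inner_sub_left, inner_sub_right, inner_smul_left, inner_smul_right,
      Complex.conj_ofReal] at this
    linear_combination this
  -- the extension of `f` to the whole line, and its primitive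
  set φ : ℝ → H := fun s => f s.toNNReal with hφ
  have hφc : Continuous φ := hf.continuous.comp continuous_real_toNNReal
  set F : ℝ → H := fun t => ∫ s in (0 : ℝ)..t, φ s with hF
  have hFd : ∀ t, HasDerivAt F (φ t) t := fun t =>
    intervalIntegral.integral_hasDerivAt_right (hφc.intervalIntegrable _ _)
      (hφc.stronglyMeasurableAtFilter _ _) hφc.continuousAt
  have hform : ∀ n, ∀ t : ℝ, 0 ≤ t → J n (φ t)
      = J n f₀ + J n (Q (F t)) + (l n : ℂ) • (J n (F t) - F t) := by
    intro n t ht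
    refine ext_inner_left ℂ fun x => ?_
    have h1 := hf.equation _ ((hS n).mem x) ⟨t, ht⟩
    have hft : f ⟨t, ht⟩ = φ t := by
      simp only [hφ]; congr 1; exact (Real.toNNReal_of_nonneg ht).symm
    change inner ℂ _ (_ - f₀ - Q (F t)) = inner ℂ _ (F t) at h1
    rw [hft] at h1
    simp only [hJ, smul_apply, smul_sub, map_sub, inner_sub_left, inner_sub_right, inner_smul_left,
      inner_add_right, inner_smul_right, Complex.conj_ofReal, hadj] at h1 ⊢
    linear_combination (l n : ℂ) * h1
  set g : ℕ → ℝ → H := fun n t => J n f₀ + J n (Q (F t)) + (l n : ℂ) • (J n (F t) - F t) with hg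
  have hgd : ∀ n t, HasDerivAt (g n) (J n (Q (φ t)) + (l n : ℂ) • (J n (φ t) - φ t)) t := by
    intro n t
    have h1 : HasDerivAt (fun t => J n (Q (F t))) (J n (Q (φ t))) t :=
      (((J n).comp Q).restrictScalars ℝ).hasFDerivAt.comp_hasDerivAt t (hFd t)
    have h2 : HasDerivAt (fun t => J n (F t)) (J n (φ t)) t :=
      ((J n).restrictScalars ℝ).hasFDerivAt.comp_hasDerivAt t (hFd t)
    exact (h1.const_add _).add ((h2.sub (hFd t)).const_smul (l n : ℂ))
  set err : ℕ → ℝ → ℝ := fun n s => Real.exp (r * s) *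
    (2 * ‖K‖ * ‖J n (φ s)‖ * ‖J n (Q (φ s)) - Q (J n (φ s))‖
      + c * ‖(inner ℂ e₀ (J n (φ s)) : ℂ)‖ ^ 2) with herr
  have hKd : ∀ n t, HasDerivAt (fun s => Real.exp (r * s) * (inner ℂ (K (g n s)) (g n s)).re)
      (Real.exp (r * t) * r * (inner ℂ (K (g n t)) (g n t)).re + Real.exp (r * t) *
        ((inner ℂ (K (J n (Q (φ t)) + (l n : ℂ) • (J n (φ t) - φ t))) (g n t)).re +
        (inner ℂ (K (g n t)) (J n (Q (φ t)) + (l n : ℂ) • (J n (φ t) - φ t))).re)) t := by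
    intro n t
    have h1 : HasDerivAt (fun s => Real.exp (r * s)) (Real.exp (r * t) * r) t := by
      simpa using ((hasDerivAt_id t).const_mul r).exp
    have h2 := (K.restrictScalars ℝ).hasFDerivAt.comp_hasDerivAt t (hgd n t)
    exact h1.mul (h2.re_inner (hgd n t))
  have hineq : ∀ n, ∀ t : ℝ, 0 ≤ t → Real.exp (r * t) * r * (inner ℂ (K (g n t)) (g n t)).re +
      Real.exp (r * t) *
        ((inner ℂ (K (J n (Q (φ t)) + (l n : ℂ) • (J n (φ t) - φ t))) (g n t)).re +
        (inner ℂ (K (g n t)) (J n (Q (φ t)) + (l n : ℂ) • (J n (φ t) - φ t))).re) ≤ err n t := by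
    intro n t ht
    have hgJ : g n t = J n (φ t) := (hform n t ht).symm
    rw [hgJ]
    have h1 := h _ (X.smul_mem (l n : ℂ) (hRX n (φ t)))
    set u := J n (φ t) with hu
    have hp : ((l n : ℂ) • (R n (φ t), φ t - (l n : ℂ) • R n (φ t)) : H × H)
        = (u, (l n : ℂ) • (φ t - u)) := rfl
    rw [hp] at h1
    simp only at h1
    set w := J n (Q (φ t)) - Q u with hw
    have e1 : J n (Q (φ t)) + (l n : ℂ) • (u - φ t) = (Q u - (l n : ℂ) • (φ t - u)) + w := by
      rw [hw]; module
    rw [e1, map_add, inner_add_left, inner_add_right, Complex.add_re, Complex.add_re]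
    have h2 : (inner ℂ (K w) u).re ≤ ‖K‖ * ‖u‖ * ‖w‖ := by
      refine (re_inner_le_norm (𝕜 := ℂ) _ _).trans ?_
      calc ‖K w‖ * ‖u‖ ≤ (‖K‖ * ‖w‖) * ‖u‖ := by gcongr; exact K.le_opNorm w
        _ = _ := by ring
    have h3 : (inner ℂ (K u) w).re ≤ ‖K‖ * ‖u‖ * ‖w‖ := by
      refine (re_inner_le_norm (𝕜 := ℂ) _ _).trans ?_
      gcongr; exact K.le_opNorm u
    simp only [herr]
    rw [mul_assoc, ← mul_add]
    refine mul_le_mul_of_nonneg_left ?_ (Real.exp_pos _).le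
    linarith
  have herrc : ∀ n, Continuous (err n) := by
    intro n
    simp only [herr]
    fun_prop
  have hmain : ∀ n, Real.exp (r * t) * (inner ℂ (K (J n (φ t))) (J n (φ t))).re
      - (inner ℂ (K (J n f₀)) (J n f₀)).re ≤ ∫ s in (0 : ℝ)..t, err n s := by
    intro n
    have h1 := intervalIntegral.sub_le_integral_of_hasDeriv_right_of_le t.coe_nonneg
      (HasDerivAt.continuousOn fun s _ => hKd n s)
      (fun s _ => (hKd n s).hasDerivWithinAt) (herrc n).integrableOn_Icc
      (fun s hs => hineq n s hs.1.le)
    have hg0 : g n 0 = J n f₀ := by simp [hg, hF]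
    have hgt : g n t = J n (φ t) := (hform n t t.2).symm
    rw [hgt, hg0] at h1
    simpa using h1
  obtain ⟨M, hM⟩ := (isCompact_Icc (a := (0 : ℝ)) (b := t)).exists_bound_of_continuousOn
    hφc.continuousOn
  have herr0 : Tendsto (fun n => ∫ s in (0 : ℝ)..t, err n s) atTop
      (𝓝 (∫ _ in (0 : ℝ)..t, (0 : ℝ))) := by
    refine intervalIntegral.tendsto_integral_filter_of_dominated_convergence
      (fun s => Real.exp (r * s) * (2 * ‖K‖ * M * (2 * ‖Q‖ * M) + c * (‖e₀‖ * M) ^ 2))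
      (Eventually.of_forall fun n => (herrc n).aestronglyMeasurable)
      (Eventually.of_forall fun n => Eventually.of_forall fun s hs => ?_)
      (Continuous.intervalIntegrable (by fun_prop) _ _)
      (Eventually.of_forall fun s hs => ?_)
    · rw [Set.uIoc_of_le t.coe_nonneg] at hs
      have hMs := hM s ⟨hs.1.le, hs.2⟩
      have h1 := (hJn n (φ s)).trans hMs
      have hM0 : 0 ≤ M := (norm_nonneg _).trans hMs
      have h2 : ‖J n (Q (φ s)) - Q (J n (φ s))‖ ≤ 2 * ‖Q‖ * M := by
        refine (norm_sub_le _ _).trans ?_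
        have h3 := (hJn n (Q (φ s))).trans (Q.le_opNorm _)
        have h4 := Q.le_opNorm (J n (φ s))
        have h5 : ‖Q‖ * ‖φ s‖ ≤ ‖Q‖ * M := by gcongr
        have h6 : ‖Q‖ * ‖J n (φ s)‖ ≤ ‖Q‖ * M := by gcongr
        linarith
      have h3 : ‖(inner ℂ e₀ (J n (φ s)) : ℂ)‖ ≤ ‖e₀‖ * M :=
        (norm_inner_le_norm _ _).trans (by gcongr)
      simp only [herr]
      rw [Real.norm_of_nonneg (by positivity)]
      gcongr
    · have hJs := hJ1 (φ s)
      have h0 : Tendsto (fun n => err n s) atTop (𝓝 (Real.exp (r * s) *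
          (2 * ‖K‖ * ‖φ s‖ * ‖Q (φ s) - Q (φ s)‖ + c * ‖(inner ℂ e₀ (φ s) : ℂ)‖ ^ 2))) := by
        refine Tendsto.const_mul _ (Tendsto.add (Tendsto.mul (hJs.norm.const_mul _) ?_) ?_)
        · exact ((hJ1 (Q (φ s))).sub ((Q.continuous.tendsto _).comp hJs)).norm
        · exact ((tendsto_const_nhds.inner hJs).norm.pow 2).const_mul c
      simpa [hφ, he] using h0
  have hlim : Tendsto (fun n => Real.exp (r * t) * (inner ℂ (K (J n (φ t))) (J n (φ t))).re
      - (inner ℂ (K (J n f₀)) (J n f₀)).re) atTop (𝓝 (Real.exp (r * t) *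
        (inner ℂ (K (φ t)) (φ t)).re - (inner ℂ (K f₀) f₀).re)) := by
    have hE : ∀ x, Tendsto (fun n => (inner ℂ (K (J n x)) (J n x)).re) atTop
        (𝓝 (inner ℂ (K x) x).re) := fun x =>
      (Complex.continuous_re.tendsto _).comp
        (((K.continuous.tendsto _).comp (hJ1 x)).inner (hJ1 x))
    exact ((hE _).const_mul _).sub (hE _)
  have hfin := le_of_tendsto_of_tendsto' hlim herr0 hmain
  have hft : φ t = f t := by simp [hφ]
  rw [hft] at hfin
  simp only [intervalIntegral.integral_zero, sub_nonpos] at hfin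
  rw [Real.exp_neg, inv_mul_eq_div, le_div_iff₀ (Real.exp_pos _), mul_comm]
  exact hfin

omit [CompleteSpace H] in
theorem IsMildSolution.sub {X : Submodule ℂ (H × H)} {Q : H →L[ℂ] H} {f₀ g₀ : H}
    {f g : ℝ≥0 → H} (hf : IsMildSolution X Q f₀ f) (hg : IsMildSolution X Q g₀ g) :
    IsMildSolution X Q (f₀ - g₀) (fun t => f t - g t) := by
  refine ⟨hf.continuous.sub hg.continuous, by rw [hf.initial, hg.initial], fun p hp t => ?_⟩
  have h1 := hf.equation p hp t
  have h2 := hg.equation p hp t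
  have hfi : IntervalIntegrable (fun s : ℝ => f s.toNNReal) volume 0 t :=
    (hf.continuous.comp continuous_real_toNNReal).intervalIntegrable _ _
  have hgi : IntervalIntegrable (fun s : ℝ => g s.toNNReal) volume 0 t :=
    (hg.continuous.comp continuous_real_toNNReal).intervalIntegrable _ _
  rw [intervalIntegral.integral_sub hfi hgi]
  simp only [inner_sub_right, map_sub] at h1 h2 ⊢
  linear_combination h1 - h2

theorem IsMildSolution.unique {X : Submodule ℂ (H × H)} (hX : IsSkewAdjointGraph X)
    {Q : H →L[ℂ] H} (hQ : ∀ x, (inner ℂ x (Q x)).re ≤ 0) {f₀ : H} {f g : ℝ≥0 → H}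
    (hf : IsMildSolution X Q f₀ f) (hg : IsMildSolution X Q f₀ g) : f = g := by
  funext t
  have h := (hf.sub hg).lyapunov hX 1 0 0 le_rfl 0 (fun p hp => ?_) (by simp) t
  · simp only [one_apply_eq_self, sub_self, inner_zero_left, Complex.zero_re, mul_zero] at h
    have h1 : (inner ℂ (f t - g t) (f t - g t)).re = ‖f t - g t‖ ^ 2 := by
      rw [inner_self_eq_norm_sq_to_K]; simp [← Complex.ofReal_pow]
    rw [h1] at h
    have : ‖f t - g t‖ = 0 := by nlinarith [norm_nonneg (f t - g t)]
    exact sub_eq_zero.1 (norm_eq_zero.1 this)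
  · have h1 := hX.re_inner_eq_zero hp
    have h2 := hQ p.1
    rw [one_apply_eq_self, one_apply_eq_self, ← inner_conj_symm (Q p.1 - p.2) p.1, Complex.conj_re]
    simp only [inner_sub_right, Complex.sub_re]
    simp
    linarith

end Skew

end RelaxationBoltzmann

end

open MeasureTheory Filter Topology
open scoped ContDiff Gradient NNReal

noncomputable section

namespace RelaxationBoltzmann

/-! ### Abstract hypocoercivity -/

section Hypocoercive

variable {H : Type*} [NormedAddCommGroup H] [InnerProductSpace ℂ H]

theorem re_inner_self_eq (x : H) : (inner ℂ x x).re = ‖x‖ ^ 2 := by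
  rw [inner_self_eq_norm_sq_to_K]; simp [← Complex.ofReal_pow]

/-- `y = (u, X u, L u, X² u)` with `u` in the range `S` of the velocity average, `X u` orthogonal to
`S`, `L u = -Π X² u`, an elliptic estimate for `X² u` and the Poincaré inequality for `u`. -/
structure IsMacroscopic (X : Submodule ℂ (H × H)) (S : Submodule ℂ H) [S.HasOrthogonalProjection]
    (e₀ : H) (C κ : ℝ) (y : H × H × H × H) : Prop where
  fst_mem : (y.1, y.2.1) ∈ X
  snd_mem : (y.2.1, y.2.2.2) ∈ X
  mem : y.1 ∈ S
  mem' : y.2.2.1 ∈ S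
  proj_fst : S.starProjection y.2.1 = 0
  proj_snd : S.starProjection y.2.2.2 = -y.2.2.1
  norm_le : ‖y.2.2.2‖ ≤ C * ‖y.1 + y.2.2.1‖
  inner_eq : inner ℂ e₀ y.2.2.1 = 0
  poincare : κ * (‖y.1‖ ^ 2 - ‖(inner ℂ e₀ y.1 : ℂ)‖ ^ 2) ≤ ‖y.2.1‖ ^ 2

variable {X : Submodule ℂ (H × H)} {S : Submodule ℂ H} [S.HasOrthogonalProjection] {e₀ : H}
  {C κ : ℝ} {y : H × H × H × H}

theorem inner_starProjection_left_eq {u : H} (hu : u ∈ S) (w : H) :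
    inner ℂ u (S.starProjection w) = inner ℂ u w := by
  rw [← Submodule.inner_starProjection_left_eq_right, Submodule.starProjection_eq_self_iff.2 hu]

theorem IsMacroscopic.inner_fst (hX : IsSkewAdjointGraph X) (hy : IsMacroscopic X S e₀ C κ y) :
    inner ℂ y.1 y.2.2.1 = inner ℂ y.2.1 y.2.1 := by
  have h1 := hX.skew _ hy.fst_mem _ hy.snd_mem
  rw [← inner_starProjection_left_eq hy.mem, hy.proj_snd, inner_neg_right] at h1
  exact neg_injective h1

theorem IsMacroscopic.norm_sq (hX : IsSkewAdjointGraph X) (hy : IsMacroscopic X S e₀ C κ y) :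
    ‖y.1 + y.2.2.1‖ ^ 2 = ‖y.1‖ ^ 2 + 2 * ‖y.2.1‖ ^ 2 + ‖y.2.2.1‖ ^ 2 := by
  have h := @norm_add_sq ℂ H _ _ _ y.1 y.2.2.1
  rw [hy.inner_fst hX] at h
  rw [h]
  congr 3
  exact re_inner_self_eq _

theorem IsMacroscopic.of_mem_closure {G : Submodule ℂ (H × H × H × H)} (hX : IsClosed (X : Set (H × H)))
    [CompleteSpace S] (hG : ∀ y ∈ G, IsMacroscopic X S e₀ C κ y) (hy : y ∈ G.topologicalClosure) :
    IsMacroscopic X S e₀ C κ y := by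
  have hS : IsClosed (S : Set H) := by
    have : IsComplete (S : Set H) := completeSpace_coe_iff_isComplete.1 inferInstance
    exact this.isClosed
  have key : ∀ s : Set (H × H × H × H), IsClosed s → (∀ y ∈ G, y ∈ s) → y ∈ s :=
    fun s hs h => closure_minimal h hs hy
  constructor
  · exact key {y | (y.1, y.2.1) ∈ X} (hX.preimage (by fun_prop)) fun y hy => (hG y hy).fst_mem
  · exact key {y | (y.2.1, y.2.2.2) ∈ X} (hX.preimage (by fun_prop)) fun y hy => (hG y hy).snd_mem
  · exact key {y | y.1 ∈ S} (hS.preimage (by fun_prop)) fun y hy => (hG y hy).mem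
  · exact key {y | y.2.2.1 ∈ S} (hS.preimage (f := fun y : H × H × H × H => y.2.2.1) (by fun_prop))
      fun y hy => (hG y hy).mem'
  · exact key {y | S.starProjection y.2.1 = 0} (isClosed_eq (by fun_prop) (by fun_prop))
      fun y hy => (hG y hy).proj_fst
  · exact key {y | S.starProjection y.2.2.2 = -y.2.2.1} (isClosed_eq (by fun_prop) (by fun_prop))
      fun y hy => (hG y hy).proj_snd
  · exact key {y | ‖y.2.2.2‖ ≤ C * ‖y.1 + y.2.2.1‖} (isClosed_le (by fun_prop) (by fun_prop))
      fun y hy => (hG y hy).norm_le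
  · exact key {y | inner ℂ e₀ y.2.2.1 = 0} (isClosed_eq (by fun_prop) (by fun_prop))
      fun y hy => (hG y hy).inner_eq
  · exact key {y : H × H × H × H | κ * (‖y.1‖ ^ 2 - ‖(inner ℂ e₀ y.1 : ℂ)‖ ^ 2) ≤ ‖y.2.1‖ ^ 2}
      (isClosed_le (by fun_prop) (by fun_prop)) fun y hy => by
        rw [Set.mem_ofPred_eq]; exact (hG y hy).poincare

theorem IsMacroscopic.norm_snd_le (hX : IsSkewAdjointGraph X) (hy : IsMacroscopic X S e₀ C κ y)
    {p : H × H} (hp : p ∈ X) (h : y.1 + y.2.2.1 = S.starProjection p.2) : ‖y.2.1‖ ≤ ‖p.1‖ := by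
  have h1 : inner ℂ y.1 (y.1 + y.2.2.1) = -inner ℂ y.2.1 p.1 := by
    rw [h, inner_starProjection_left_eq hy.mem]
    exact hX.skew _ hy.fst_mem _ hp
  rw [inner_add_right, hy.inner_fst hX] at h1
  have h2 := congrArg Complex.re h1
  rw [Complex.add_re, re_inner_self_eq, re_inner_self_eq, Complex.neg_re] at h2
  have h3 : -(inner ℂ y.2.1 p.1).re ≤ ‖y.2.1‖ * ‖p.1‖ := by
    have := re_inner_le_norm (𝕜 := ℂ) (-y.2.1) p.1
    rw [inner_neg_left, norm_neg] at this
    simpa using this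
  rcases (norm_nonneg y.2.1).eq_or_lt with h0 | h0
  · rw [← h0]; exact norm_nonneg _
  · refine le_of_mul_le_mul_left ?_ h0
    nlinarith [sq_nonneg ‖y.1‖]

theorem hypocoercive_real_estimate {γ δ₀ C κ a b x L U θ : ℝ} (hδ₀ : 0 < δ₀)
    (hδ : δ₀ * (1 + 3 / 2 * (C + γ) ^ 2) ≤ γ) (hγ : 0 < γ) (hκ : 0 < κ) (hκ1 : κ ≤ 1)
    (hb : 0 ≤ b)
    (h1 : a ^ 2 = U ^ 2 + 2 * x ^ 2 + L ^ 2) (h2 : κ * (U ^ 2 - θ ^ 2) ≤ x ^ 2) (h3 : x ≤ a) :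
    -2 * γ * b ^ 2 + κ * δ₀ * (b * b + γ * (x * b) - x ^ 2 - L ^ 2 + C * a * b)
      ≤ -(δ₀ * κ ^ 2 / 6 * (a ^ 2 + b ^ 2)) + δ₀ * κ ^ 2 * θ ^ 2 := by
  have e1 : κ * (a ^ 2 - θ ^ 2) ≤ 3 * (x ^ 2 + L ^ 2) := by
    nlinarith [sq_nonneg x, sq_nonneg L]
  have e2 : κ * δ₀ * (κ * (a ^ 2 - θ ^ 2)) ≤ κ * δ₀ * (3 * (x ^ 2 + L ^ 2)) :=
    mul_le_mul_of_nonneg_left e1 (by positivity)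
  have e3 : γ * (x * b) ≤ γ * (a * b) := by gcongr
  have e4 : κ * δ₀ * (γ * (x * b)) ≤ κ * δ₀ * (γ * (a * b)) :=
    mul_le_mul_of_nonneg_left e3 (by positivity)
  have e5 : δ₀ * ((κ * a) * ((C + γ) * b)) ≤
      δ₀ * ((κ * a) ^ 2 / 6 + 3 / 2 * ((C + γ) * b) ^ 2) := by
    refine mul_le_mul_of_nonneg_left ?_ hδ₀.le
    nlinarith [sq_nonneg (κ * a - 3 * ((C + γ) * b))]
  have e6 : δ₀ * (1 + 3 / 2 * (C + γ) ^ 2) * b ^ 2 ≤ γ * b ^ 2 := by gcongr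
  have e7 : κ * (δ₀ * b ^ 2) ≤ 1 * (δ₀ * b ^ 2) := by gcongr
  have hδγ : δ₀ ≤ γ := by nlinarith [mul_nonneg hδ₀.le (sq_nonneg (C + γ))]
  have e8 : δ₀ * κ ^ 2 ≤ γ := by
    have : κ ^ 2 ≤ 1 := pow_le_one₀ hκ.le hκ1
    nlinarith
  have e9 : δ₀ * κ ^ 2 * b ^ 2 ≤ γ * b ^ 2 := by gcongr
  have e10 : 0 ≤ δ₀ * κ ^ 2 * θ ^ 2 := by positivity
  have e11 : 0 ≤ γ * b ^ 2 := by positivity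
  nlinarith

theorem hypocoercive_decay [CompleteSpace H] [CompleteSpace S] (hX : IsSkewAdjointGraph X)
    {G : Submodule ℂ (H × H × H × H)} (hG : ∀ y ∈ G, IsMacroscopic X S e₀ C κ y)
    (hd₁ : ∀ h ∈ S, h ∈ closure {u | ∃ y ∈ G, y.1 = u})
    (hd₂ : ∀ h ∈ S, h ∈ closure {u | ∃ y ∈ G, y.1 + y.2.2.1 = u})
    (he₀ : e₀ ∈ S) {γ δ₀ : ℝ} (hC : 0 ≤ C) (hγ : 0 < γ) (hκ : 0 < κ) (hκ1 : κ ≤ 1)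
    (hδ₀ : 0 < δ₀) (hδ₀' : δ₀ ≤ 1 / 2) (hδ : δ₀ * (1 + 3 / 2 * (C + γ) ^ 2) ≤ γ) {f₀ : H}
    {f : ℝ≥0 → H} (hf : IsMildSolution X ((γ : ℂ) • (S.starProjection - 1)) f₀ f)
    (hfe : ∀ t, inner ℂ e₀ (f t) = 0) (t : ℝ≥0) :
    ‖f t‖ ≤ 3 * ‖f₀‖ * Real.exp (-(δ₀ * κ ^ 2 / 18 * t)) := by
  have hG' : ∀ y ∈ G.topologicalClosure, IsMacroscopic X S e₀ C κ y := fun y hy =>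
    IsMacroscopic.of_mem_closure hX.closed hG hy
  let σ : H × H × H × H →L[ℂ] H := ContinuousLinearMap.fst ℂ H (H × H × H) +
    (ContinuousLinearMap.fst ℂ H H).comp ((ContinuousLinearMap.snd ℂ H (H × H)).comp
      (ContinuousLinearMap.snd ℂ H (H × H × H)))
  have hσ : ∀ y, σ y = y.1 + y.2.2.1 := fun y => rfl
  have hle : ∀ y, IsMacroscopic X S e₀ C κ y → ‖y.1‖ ≤ ‖y.1 + y.2.2.1‖ ∧
      ‖y.2.1‖ ≤ ‖y.1 + y.2.2.1‖ ∧ ‖y.2.2.1‖ ≤ ‖y.1 + y.2.2.1‖ := by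
    intro y hy
    have h := hy.norm_sq hX
    refine ⟨?_, ?_, ?_⟩ <;> refine abs_le_of_sq_le_sq' ?_ (norm_nonneg _) |>.2 <;>
      nlinarith [sq_nonneg ‖y.1‖, sq_nonneg ‖y.2.1‖, sq_nonneg ‖y.2.2.1‖]
  obtain ⟨ψ, hψ⟩ := exists_inverse_of_dense_image (G := G.topologicalClosure)
    G.isClosed_topologicalClosure σ S (C := 1 + C) (by positivity)
    (fun y hy => by
      have hm := hG' y hy
      obtain ⟨h1, h2, h3⟩ := hle y hm
      have h4 := hm.norm_le
      rw [hσ]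
      have h5 : 0 ≤ C * ‖y.1 + y.2.2.1‖ := by positivity
      have h6 := norm_nonneg (y.1 + y.2.2.1)
      simp only [Prod.norm_def]
      refine max_le ?_ (max_le ?_ (max_le ?_ ?_)) <;> linarith)
    (fun h hh => by
      refine closure_mono ?_ (hd₂ h hh)
      rintro _ ⟨y, hy, rfl⟩
      exact ⟨y, subset_closure hy, rfl⟩)
  set Pr := S.starProjection with hPr
  let y : H → H × H × H × H := fun h => ψ (S.orthogonalProjectionOnto h)
  have hy : ∀ h, IsMacroscopic X S e₀ C κ (y h) := fun h => hG' _ (hψ _).1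
  have hyσ : ∀ h, (y h).1 + (y h).2.2.1 = Pr h := fun h => (hψ _).2
  let K : H →L[ℂ] H := (ContinuousLinearMap.fst ℂ H (H × H)).comp
    ((ContinuousLinearMap.snd ℂ H (H × H × H)).comp (ψ.comp S.orthogonalProjectionOnto))
  have hK : ∀ h, K h = (y h).2.1 := fun h => rfl
  have hKle : ∀ h, ‖K h‖ ≤ ‖Pr h‖ := fun h => by
    rw [hK, ← hyσ]; exact (hle _ (hy h)).2.1
  have hKX : ∀ p ∈ X, ‖K p.2‖ ≤ ‖p.1 - Pr p.1‖ := by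
    intro p hp
    have hcl : IsClosed {w : H | ‖K p.2‖ ≤ ‖p.1 - w‖} := isClosed_le (by fun_prop) (by fun_prop)
    refine closure_minimal ?_ hcl (hd₁ (Pr p.1) (Submodule.starProjection_apply_mem _ _))
    rintro _ ⟨w, hw, rfl⟩
    have hw' := hG w hw
    refine (hy p.2).norm_snd_le hX (X.sub_mem hp hw'.fst_mem) ?_
    rw [hyσ]
    simp only [Prod.snd_sub, map_sub, hw'.proj_fst, sub_zero, hPr]
  have hPr2 : ∀ h, Pr (Pr h) = Pr h := fun h =>
    Submodule.starProjection_eq_self_iff.2 (Submodule.starProjection_apply_mem _ _)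
  have hKPr : ∀ h, inner ℂ (K h) (Pr h) = 0 := fun h => by
    rw [hPr, ← Submodule.inner_starProjection_left_eq_right, hK, (hy h).proj_fst, inner_zero_left]
  have hperp : ∀ g w, Pr w = 0 → inner ℂ w g = inner ℂ w (g - Pr g) := fun g w hw => by
    have : inner ℂ w (Pr g) = 0 := by
      rw [hPr, ← Submodule.inner_starProjection_left_eq_right]
      change inner ℂ (Pr w) g = 0
      rw [hw, inner_zero_left]
    rw [inner_sub_right, this, sub_zero]
  have hpyth : ∀ g, ‖g‖ ^ 2 = ‖Pr g‖ ^ 2 + ‖g - Pr g‖ ^ 2 := fun g => by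
    have h0 : inner ℂ (Pr g) (g - Pr g) = 0 := by
      rw [hPr, Submodule.inner_starProjection_left_eq_right, map_sub]
      change inner ℂ g (Pr g - Pr (Pr g)) = 0
      rw [hPr2, sub_self, inner_zero_right]
    have h := norm_add_sq_eq_norm_sq_add_norm_sq_of_inner_eq_zero (𝕜 := ℂ) _ _ h0
    rw [add_sub_cancel] at h
    simpa [sq] using h
  have hbd : ∀ g, |(inner ℂ (K g) g).re| ≤ ‖g‖ ^ 2 := fun g => by
    have h1 : |(inner ℂ (K g) g).re| ≤ ‖K g‖ * ‖g‖ :=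
      (Complex.abs_re_le_norm _).trans (norm_inner_le_norm _ _)
    have h2 : ‖K g‖ ≤ ‖g‖ := (hKle g).trans (Submodule.norm_starProjection_apply_le S g)
    nlinarith [norm_nonneg g]
  set δ := κ * δ₀ with hδdef
  have hδpos : 0 < δ := by positivity
  have hδle : δ ≤ 1 / 2 := by nlinarith
  set 𝒦 : H →L[ℂ] H := 1 + (δ : ℂ) • K with h𝒦
  have h𝒦r : ∀ g w, (inner ℂ (𝒦 g) w).re = (inner ℂ g w).re + δ * (inner ℂ (K g) w).re := by
    intro g w
    simp [h𝒦]
  have hE : ∀ g, (inner ℂ (𝒦 g) g).re = ‖g‖ ^ 2 + δ * (inner ℂ (K g) g).re := fun g => by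
    rw [h𝒦r, re_inner_self_eq]
  have hEle : ∀ g, (inner ℂ (𝒦 g) g).re ≤ 3 / 2 * ‖g‖ ^ 2 := fun g => by
    rw [hE]
    have := (abs_le.1 (hbd g)).2
    nlinarith [sq_nonneg ‖g‖]
  have hEge : ∀ g, 1 / 2 * ‖g‖ ^ 2 ≤ (inner ℂ (𝒦 g) g).re := fun g => by
    rw [hE]
    have := (abs_le.1 (hbd g)).1
    nlinarith [sq_nonneg ‖g‖]
  set Q : H →L[ℂ] H := (γ : ℂ) • (Pr - 1) with hQ
  have hQa : ∀ g, Q g = (γ : ℂ) • (Pr g - g) := fun g => rfl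
  have hKQ : ∀ g, K (Q g) = 0 := fun g => by
    have h1 := hKle (Q g)
    have h2 : Pr (Q g) = 0 := by rw [hQa, map_smul, map_sub, hPr2, sub_self, smul_zero]
    rw [h2, norm_zero] at h1
    exact norm_le_zero_iff.1 h1
  have hly := hf.lyapunov hX 𝒦 (δ₀ * κ ^ 2 / 9) (δ₀ * κ ^ 2) (by positivity) e₀ ?_ hfe t
  · have h1 := hEge (f t)
    have h2 := hEle f₀
    have hexp : Real.exp (-(δ₀ * κ ^ 2 / 9 * t)) = Real.exp (-(δ₀ * κ ^ 2 / 18 * t)) ^ 2 := by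
      rw [← Real.exp_nat_mul]; congr 1; push_cast; ring
    rw [hexp] at hly
    set E := Real.exp (-(δ₀ * κ ^ 2 / 18 * t)) with hEdef
    have hE0 : 0 < E := Real.exp_pos _
    have h3 : ‖f t‖ ^ 2 ≤ (3 * ‖f₀‖ * E) ^ 2 := by
      have : E ^ 2 * (inner ℂ (𝒦 f₀) f₀).re ≤ E ^ 2 * (3 / 2 * ‖f₀‖ ^ 2) := by gcongr
      nlinarith [sq_nonneg (‖f₀‖ * E)]
    exact (abs_le_of_sq_le_sq' h3 (by positivity)).2
  · intro p hp
    set g := p.1 with hg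
    set ζ := p.2 with hζ
    have hgζ : (inner ℂ g ζ).re = 0 := hX.re_inner_eq_zero hp
    set a := ‖Pr g‖ with ha
    set b := ‖g - Pr g‖ with hb
    have hyg := hy g
    set x := ‖(y g).2.1‖ with hx
    have hQre : (inner ℂ g (Q g)).re = -γ * b ^ 2 := by
      have h1 : inner ℂ g (g - Pr g) = inner ℂ (g - Pr g) (g - Pr g) := by
        have h0 : inner ℂ (Pr g) (g - Pr g) = 0 := by
          rw [hPr, Submodule.inner_starProjection_left_eq_right, map_sub]
          change inner ℂ g (Pr g - Pr (Pr g)) = 0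
          rw [hPr2, sub_self, inner_zero_right]
        rw [inner_sub_left, h0, sub_zero]
      rw [hQa, ← neg_sub, smul_neg, inner_neg_right, inner_smul_right, h1, Complex.neg_re,
        Complex.re_ofReal_mul, re_inner_self_eq]
      ring
    have hv1 : (inner ℂ (Q g - ζ) g).re = -γ * b ^ 2 := by
      rw [← inner_conj_symm, Complex.conj_re, inner_sub_right, Complex.sub_re, hQre, hgζ, sub_zero]
    have hv2 : (inner ℂ g (Q g - ζ)).re = -γ * b ^ 2 := by
      rw [inner_sub_right, Complex.sub_re, hQre, hgζ, sub_zero]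
    have hv3 : (inner ℂ (K (Q g - ζ)) g).re ≤ b * b := by
      rw [map_sub, hKQ, zero_sub, ← map_neg,
        hperp g _ (by rw [hK]; exact (hy _).proj_fst)]
      refine (re_inner_le_norm (𝕜 := ℂ) _ _).trans ?_
      rw [map_neg, norm_neg]
      gcongr
      exact hKX p hp
    have hv4 : (inner ℂ (K g) (Q g - ζ)).re ≤ γ * (x * b) - x ^ 2 - ‖(y g).2.2.1‖ ^ 2 + C * a * b := by
      have h1 : (inner ℂ (K g) (Q g)).re ≤ γ * (x * b) := by
        rw [hQa, inner_smul_right, Complex.re_ofReal_mul]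
        refine mul_le_mul_of_nonneg_left ?_ hγ.le
        refine (re_inner_le_norm (𝕜 := ℂ) _ _).trans ?_
        rw [norm_sub_rev]
        rfl
      have h2 : inner ℂ (K g) ζ = -inner ℂ (y g).2.2.2 g := hX.skew _ hyg.snd_mem _ hp
      have h3 : inner ℂ (y g).2.2.2 g
          = -inner ℂ (y g).2.2.1 (Pr g) + inner ℂ (y g).2.2.2 (g - Pr g) := by
        have h4 : inner ℂ (y g).2.2.2 (Pr g) = -inner ℂ (y g).2.2.1 (Pr g) := by
          rw [← hPr2 g]
          conv_lhs => rw [hPr, ← Submodule.inner_starProjection_left_eq_right]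
          rw [hyg.proj_snd, inner_neg_left]
          rw [hPr2]
        rw [inner_sub_right, h4]; ring
      have h4 : (inner ℂ (y g).2.2.1 (Pr g)).re = x ^ 2 + ‖(y g).2.2.1‖ ^ 2 := by
        rw [← hyσ, inner_add_right, Complex.add_re, re_inner_self_eq, ← inner_conj_symm,
          Complex.conj_re, hyg.inner_fst hX, re_inner_self_eq]
      have h5 : (inner ℂ (y g).2.2.2 (g - Pr g)).re ≤ C * a * b := by
        refine (re_inner_le_norm (𝕜 := ℂ) _ _).trans ?_
        gcongr
        rw [ha, ← hyσ]
        exact hyg.norm_le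
      rw [inner_sub_right, h2, h3, sub_neg_eq_add, Complex.add_re, Complex.add_re, Complex.neg_re,
        h4]
      linarith
    have hreal := hypocoercive_real_estimate (γ := γ) (a := a) (b := b) (x := x)
      (L := ‖(y g).2.2.1‖) (U := ‖(y g).1‖) (θ := ‖(inner ℂ e₀ g : ℂ)‖) hδ₀ hδ hγ hκ hκ1
      (norm_nonneg _) (by rw [ha, ← hyσ]; exact hyg.norm_sq hX) (by
        have h1 := hyg.poincare
        have h2 : inner ℂ e₀ (y g).1 = inner ℂ e₀ g := by
          rw [← inner_starProjection_left_eq he₀ g]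
          change _ = inner ℂ e₀ (Pr g)
          rw [← hyσ, inner_add_right, hyg.inner_eq, add_zero]
        rwa [h2] at h1) (hKle g)
    have hEg := hEle g
    rw [hpyth g] at hEg
    have hr : δ₀ * κ ^ 2 / 9 * (inner ℂ (𝒦 g) g).re
        ≤ δ₀ * κ ^ 2 / 9 * (3 / 2 * (a ^ 2 + b ^ 2)) :=
      mul_le_mul_of_nonneg_left hEg (by positivity)
    rw [h𝒦r, h𝒦r g, hv1, hv2]
    have h6 := mul_le_mul_of_nonneg_left (add_le_add hv3 hv4) hδpos.le
    simp only [hδdef] at h6 ⊢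
    nlinarith

end Hypocoercive

/-! ### The Poincaré inequality of a spectral gap -/

section Gap

variable {H : Type*} [NormedAddCommGroup H] [InnerProductSpace ℂ H] [CompleteSpace H]

open Polynomial in
theorem poincare_of_spectralGap {G : Set (H × H)}
    (hsym : ∀ p ∈ G, ∀ q ∈ G, inner ℂ p.2 q.1 = inner ℂ p.1 q.2) {α : ℝ} (hα : 0 < α)
    (hres : ∀ c : ℝ, c ≠ 0 → c < α → IsResolventPoint G c) {e₀ : H} (he₀ : (e₀, 0) ∈ G)
    (hker : ∀ k, (k, 0) ∈ G → ∃ c : ℂ, k = c • e₀) {p : H × H} (hp : p ∈ G)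
    (hpe : inner ℂ e₀ p.1 = 0) : α * ‖p.1‖ ^ 2 ≤ (inner ℂ p.1 p.2).re := by
  obtain ⟨R, hR1, hR2⟩ := hres (-1) (by norm_num) (by linarith)
  simp only [Complex.ofReal_neg, Complex.ofReal_one, neg_smul, one_smul, sub_neg_eq_add] at hR1 hR2
  have hadj : ∀ a b, inner ℂ (R a) b = inner ℂ a (R b) := by
    intro a b
    have h := hsym _ (hR1 a) _ (hR1 b)
    simp only [inner_add_left, inner_add_right, inner_neg_left, inner_neg_right] at h
    linear_combination -h
  have hsa : IsSelfAdjoint R := by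
    rw [ContinuousLinearMap.isSelfAdjoint_iff_isSymmetric]
    exact hadj
  have hspec : ∀ s ∈ spectrum ℝ R, s = 0 ∨ s = 1 ∨ (0 < s ∧ (1 + α) * s ≤ 1) := by
    intro s hs
    by_contra! hcon
    obtain ⟨h0, h1, h2⟩ := hcon
    set c := 1 / s - 1 with hc
    have hc0 : c ≠ 0 := by
      intro h
      have : 1 / s = 1 := by linarith
      exact h1 ((div_eq_one_iff_eq h0).1 this).symm
    have hcα : c < α := by
      rcases lt_or_gt_of_ne h0 with hneg | hpos
      · have : 1 / s < 0 := one_div_neg.2 hneg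
        linarith
      · have := h2 hpos
        rw [hc, sub_lt_iff_lt_add, div_lt_iff₀ hpos]
        linarith
    obtain ⟨T, hT1, hT2⟩ := hres c hc0 hcα
    have i1 : ∀ h, R h + (1 / s : ℂ) • R (T h) = T h := by
      intro h
      have := hR2 _ (hT1 h)
      simp only [map_add, map_smul] at this
      have hcs : (1 / s : ℂ) = (c : ℂ) + 1 := by rw [hc]; push_cast; ring
      rw [hcs]
      linear_combination (norm := module) this
    have i2 : ∀ h, T h - (1 / s : ℂ) • T (R h) = R h := by
      intro h
      have := hT2 _ (hR1 h)
      simp only [map_add, map_sub, map_neg, map_smul] at this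
      have hcs : (1 / s : ℂ) = (c : ℂ) + 1 := by rw [hc]; push_cast; ring
      rw [hcs]
      linear_combination (norm := module) this
    refine hs ?_
    have hs' : (s : ℂ) ≠ 0 := by exact_mod_cast h0
    refine ⟨⟨algebraMap ℝ (H →L[ℂ] H) s - R, (1 / s : ℂ) • (1 + (1 / s : ℂ) • T), ?_, ?_⟩, rfl⟩
    · ext h
      have e : (algebraMap ℝ (H →L[ℂ] H) s - R) (((1 / s : ℂ) • (1 + (1 / s : ℂ) • T)) h)
          = (s : ℂ) • ((1 / s : ℂ) • (h + (1 / s : ℂ) • T h))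
            - (1 / s : ℂ) • (R h + (1 / s : ℂ) • R (T h)) := by
        rw [sub_apply, Algebra.algebraMap_eq_smul_one]
        simp only [smul_apply, add_apply, one_apply_eq_self, map_smul, map_add]
        simp only [← Complex.coe_smul]
        module
      change (algebraMap ℝ (H →L[ℂ] H) s - R) (((1 / s : ℂ) • (1 + (1 / s : ℂ) • T)) h) = h
      rw [e, i1, smul_smul, mul_one_div_cancel hs']
      module
    · ext h
      have e : ((1 / s : ℂ) • (1 + (1 / s : ℂ) • T)) ((algebraMap ℝ (H →L[ℂ] H) s - R) h)
          = (1 / s : ℂ) • ((s : ℂ) • h - R h + ((1 / s : ℂ) * s) • T h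
            - (1 / s : ℂ) • T (R h)) := by
        rw [sub_apply, Algebra.algebraMap_eq_smul_one]
        simp only [smul_apply, add_apply, one_apply_eq_self, map_sub]
        rw [← Complex.coe_smul s h, map_smul]
        module
      change ((1 / s : ℂ) • (1 + (1 / s : ℂ) • T)) ((algebraMap ℝ (H →L[ℂ] H) s - R) h) = h
      rw [e, one_div_mul_cancel hs', one_smul, add_sub_assoc, i2, sub_add_cancel, smul_smul,
        one_div_mul_cancel hs', one_smul]
  -- a polynomial that is nonnegative on the spectrum
  let q : ℝ[X] := Polynomial.X * (1 - Polynomial.X) ^ 2 * (1 - Polynomial.C (1 + α) * Polynomial.X)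
  have hq : 0 ≤ aeval R q := by
    rw [← cfc_polynomial q R]
    refine cfc_nonneg fun s hs => ?_
    simp only [q, eval_mul, eval_X, eval_pow, eval_sub, eval_one, eval_C]
    rcases hspec s hs with h | h | ⟨h1, h2⟩
    · simp [h]
    · simp [h]
    · have : 0 ≤ 1 - (1 + α) * s := by linarith
      positivity
  have hB : ∀ h, (1 + α) * ‖R (h - R h)‖ ^ 2 ≤ (inner ℂ (R (h - R h)) (h - R h)).re := by
    intro h
    have h1 := ((ContinuousLinearMap.nonneg_iff_isPositive _).1 hq).re_inner_nonneg_left h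
    have h2 : aeval R q = (1 - R) * (R * (1 - (((1 + α : ℝ)) : ℂ) • R)) * (1 - R) := by
      simp only [q, map_mul, aeval_X, map_pow, map_sub, map_one, aeval_C]
      rw [Algebra.algebraMap_eq_smul_one, ← Complex.coe_smul]
      simp only [smul_mul_assoc, one_mul, mul_sub, sub_mul, mul_one, mul_smul_comm, smul_sub,
        pow_two, mul_assoc]
      abel
    rw [h2] at h1
    set y := h - R h with hy
    have h3 : ((1 - R) * (R * (1 - (((1 + α : ℝ)) : ℂ) • R)) * (1 - R)) h
        = (R y - (((1 + α : ℝ)) : ℂ) • R (R y)) - R (R y - (((1 + α : ℝ)) : ℂ) • R (R y)) := by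
      change R (y - (((1 + α : ℝ)) : ℂ) • R y) - R (R (y - (((1 + α : ℝ)) : ℂ) • R y)) = _
      simp only [map_sub, map_smul]
    rw [h3, inner_sub_left, hadj (R y - _), ← inner_sub_right, ← hy, inner_sub_left,
      inner_smul_left, hadj (R y)] at h1
    have h4 : RCLike.re (inner ℂ (R y) y - (starRingEnd ℂ) ((1 + α : ℝ) : ℂ) * inner ℂ (R y) (R y))
        = (inner ℂ (R y) y).re - (1 + α) * ‖R y‖ ^ 2 := by
      rw [Complex.conj_ofReal]
      rw [RCLike.re_to_complex, Complex.sub_re, Complex.re_ofReal_mul, re_inner_self_eq]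
    rw [h4] at h1
    linarith
  have hcl : ∀ y ∈ closure (Set.range fun h => h - R h),
      (1 + α) * ‖R y‖ ^ 2 ≤ (inner ℂ (R y) y).re := by
    intro y hy
    have hc : IsClosed {y : H | (1 + α) * ‖R y‖ ^ 2 ≤ (inner ℂ (R y) y).re} :=
      isClosed_le (by fun_prop) (by fun_prop)
    refine closure_minimal ?_ hc hy
    rintro _ ⟨h, rfl⟩
    exact hB h
  set h := p.2 + p.1 with hh
  have hRh : R h = p.1 := hR2 p hp
  have hmem : h ∈ closure (Set.range fun h => h - R h) := by
    let B : H →L[ℂ] H := 1 - R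
    have hr : (LinearMap.range (B : H →ₗ[ℂ] H) : Set H) = Set.range fun h => h - R h := by
      ext; simp [B]
    have h1 : h ∈ (LinearMap.range (B : H →ₗ[ℂ] H)).topologicalClosure := by
      rw [← Submodule.orthogonal_orthogonal_eq_closure, Submodule.mem_orthogonal]
      intro k hk
      rw [Submodule.mem_orthogonal] at hk
      have hk' : k - R k = 0 := by
        refine ext_inner_left ℂ fun z => ?_
        have := hk (B z) ⟨z, rfl⟩
        simp only [B, sub_apply, one_apply_eq_self, inner_sub_left, hadj] at this
        rw [inner_zero_right, inner_sub_right]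
        exact this
      have hk2 := hR1 k
      have hRk : k + -R k = 0 := by rw [← sub_eq_add_neg]; exact hk'
      rw [hRk] at hk2
      obtain ⟨c, hc⟩ := hker _ hk2
      have h3 := hsym _ he₀ _ hp
      rw [inner_zero_left] at h3
      have hkc : k = c • e₀ := by rw [← hc]; exact sub_eq_zero.1 hk'
      rw [hkc, inner_smul_left, hh, inner_add_right, ← h3, hpe, add_zero, mul_zero]
    have h2 : h ∈ closure (LinearMap.range (B : H →ₗ[ℂ] H) : Set H) := h1
    rwa [hr] at h2
  have hfin := hcl h hmem
  rw [hRh, hh, inner_add_right, Complex.add_re, re_inner_self_eq] at hfin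
  linarith

end Gap

end RelaxationBoltzmann

end

open MeasureTheory Filter Topology
open scoped ContDiff Gradient NNReal

noncomputable section

namespace RelaxationBoltzmann

variable {d : ℕ}

/-! ### The Maxwellian -/

theorem integral_exp_neg_pos {V : Pos d → ℝ} (hV : IsConfining V) :
    0 < ∫ y, Real.exp (-V y) := by
  refine (integral_pos_iff_support_of_nonneg (fun y => (Real.exp_pos _).le) hV.integrable).2 ?_
  have : Function.support (fun y => Real.exp (-V y)) = Set.univ := by
    ext y; simp [(Real.exp_pos _).ne']
  rw [this]
  exact Measure.measure_univ_pos.2 (NeZero.ne _)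

theorem spatialMaxwellian_pos {V : Pos d → ℝ} (hV : IsConfining V) (x : Pos d) :
    0 < spatialMaxwellian V x :=
  div_pos (Real.exp_pos _) (integral_exp_neg_pos hV)

theorem velocityMaxwellian_pos (v : Pos d) : 0 < velocityMaxwellian v := by
  unfold velocityMaxwellian; positivity

theorem maxwellian_pos {V : Pos d → ℝ} (hV : IsConfining V) (z : Phase d) : 0 < maxwellian V z :=
  mul_pos (spatialMaxwellian_pos hV _) (velocityMaxwellian_pos _)

theorem contDiff_spatialMaxwellian {V : Pos d → ℝ} (hV : IsConfining V) :
    ContDiff ℝ ∞ (spatialMaxwellian V) := (Real.contDiff_exp.comp hV.smooth.neg).div_const _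

theorem contDiff_velocityMaxwellian : ContDiff ℝ ∞ (velocityMaxwellian : Pos d → ℝ) :=
  (Real.contDiff_exp.comp ((contDiff_norm_sq ℝ).neg.div_const 2)).div_const _

theorem contDiff_maxwellian {V : Pos d → ℝ} (hV : IsConfining V) :
    ContDiff ℝ ∞ (maxwellian V) :=
  ((contDiff_spatialMaxwellian hV).comp contDiff_fst).mul
    (contDiff_velocityMaxwellian.comp contDiff_snd)

theorem integral_velocityMaxwellian : ∫ v : Pos d, velocityMaxwellian v = 1 := by
  unfold velocityMaxwellian
  rw [integral_div]
  have h := GaussianFourier.integral_rexp_neg_mul_sq_norm (V := Pos d) (b := 1 / 2) (by norm_num)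
  have e : ∀ v : Pos d, Real.exp (-‖v‖ ^ 2 / 2) = Real.exp (-(1 / 2) * ‖v‖ ^ 2) := fun v => by
    congr 1; ring
  simp_rw [e]
  rw [h]
  simp only [finrank_euclideanSpace, Fintype.card_fin]
  have : Real.pi / (1 / 2) = 2 * Real.pi := by ring
  rw [this]
  exact div_self (Real.rpow_pos_of_pos (by positivity) _).ne'

theorem integral_spatialMaxwellian {V : Pos d → ℝ} (hV : IsConfining V) :
    ∫ x, spatialMaxwellian V x = 1 := by
  unfold spatialMaxwellian
  rw [integral_div]
  exact div_self (integral_exp_neg_pos hV).ne'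

theorem integrable_spatialMaxwellian {V : Pos d → ℝ} (hV : IsConfining V) :
    Integrable (spatialMaxwellian V) := hV.integrable.div_const _

theorem integral_maxwellian {V : Pos d → ℝ} (hV : IsConfining V) : ∫ z, maxwellian V z = 1 := by
  unfold maxwellian
  rw [Measure.volume_eq_prod, integral_prod_mul (μ := volume) (ν := volume) (spatialMaxwellian V) velocityMaxwellian,
    integral_spatialMaxwellian hV, integral_velocityMaxwellian, one_mul]

theorem integrable_exp_neg_mul_norm_sq {b : ℝ} (hb : 0 < b) :
    Integrable fun v : Pos d => Real.exp (-b * ‖v‖ ^ 2) := by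
  have h := (GaussianFourier.integrable_cexp_neg_mul_sq_norm_add (V := Pos d)
    (b := (b : ℂ)) (by simpa using hb) 0 0).norm
  refine h.congr (Eventually.of_forall fun v => ?_)
  simp only [Complex.norm_exp]
  congr 1
  have : (-(b : ℂ) * (‖v‖ : ℂ) ^ 2 + 0 * (inner ℝ (0 : Pos d) v : ℂ))
      = ((-b * ‖v‖ ^ 2 : ℝ) : ℂ) := by push_cast; ring
  rw [this, Complex.ofReal_re]

theorem integrable_one_add_norm_pow_mul_velocityMaxwellian (k : ℕ) :
    Integrable fun v : Pos d => (1 + ‖v‖) ^ k * velocityMaxwellian v := by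
  have hb : ∀ r : ℝ, 0 ≤ r → (1 + r) ^ k * Real.exp (-r ^ 2 / 2)
      ≤ (k.factorial * Real.exp (1 + 1)) * Real.exp (-(1 / 4) * r ^ 2) := by
    intro r hr
    have h1 := Real.pow_div_factorial_le_exp (1 + r) (by positivity) k
    rw [div_le_iff₀ (by positivity)] at h1
    have h2 : Real.exp (1 + r) * Real.exp (-r ^ 2 / 2)
        ≤ Real.exp (1 + 1) * Real.exp (-(1 / 4) * r ^ 2) := by
      rw [← Real.exp_add, ← Real.exp_add]
      exact Real.exp_le_exp.2 (by nlinarith [sq_nonneg (r - 2)])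
    calc (1 + r) ^ k * Real.exp (-r ^ 2 / 2)
        ≤ (Real.exp (1 + r) * k.factorial) * Real.exp (-r ^ 2 / 2) := by gcongr
      _ = k.factorial * (Real.exp (1 + r) * Real.exp (-r ^ 2 / 2)) := by ring
      _ ≤ k.factorial * (Real.exp (1 + 1) * Real.exp (-(1 / 4) * r ^ 2)) := by gcongr
      _ = _ := by ring
  unfold velocityMaxwellian
  have hi : Integrable fun v : Pos d => (1 + ‖v‖) ^ k * Real.exp (-‖v‖ ^ 2 / 2) := by
    refine ((integrable_exp_neg_mul_norm_sq (d := d) (b := 1 / 4) (by norm_num)).const_mul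
      (k.factorial * Real.exp (1 + 1))).mono' (by fun_prop) (Eventually.of_forall fun v => ?_)
    rw [Real.norm_of_nonneg (by positivity)]
    exact hb _ (norm_nonneg v)
  refine (hi.div_const ((2 * Real.pi) ^ ((d : ℝ) / 2))).congr (Eventually.of_forall fun v => ?_)
  simp only; ring

theorem integrable_one_add_norm_pow_mul_maxwellian {V : Pos d → ℝ} (hV : IsConfining V) (k : ℕ) :
    Integrable fun z : Phase d => (1 + ‖z.2‖) ^ k * maxwellian V z := by
  have := (integrable_spatialMaxwellian hV).mul_prod
    (integrable_one_add_norm_pow_mul_velocityMaxwellian (d := d) k)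
  refine this.congr (Eventually.of_forall fun z => ?_)
  simp only [maxwellian]; ring

/-! ### Functions of polynomial growth in the velocity -/

/-- `a` is continuous and grows at most polynomially in the velocity, uniformly in the position. -/
structure IsTempered (a : Phase d → ℂ) : Prop where
  continuous : Continuous a
  bound : ∃ (C : ℝ) (k : ℕ), ∀ z, ‖a z‖ ≤ C * (1 + ‖z.2‖) ^ k

theorem IsTempered.mul {a b : Phase d → ℂ} (ha : IsTempered a) (hb : IsTempered b) :
    IsTempered fun z => a z * b z := by
  obtain ⟨C, k, hC⟩ := ha.bound
  obtain ⟨C', k', hC'⟩ := hb.bound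
  refine ⟨ha.continuous.mul hb.continuous, C * C', k + k', fun z => ?_⟩
  rw [norm_mul, pow_add]
  calc ‖a z‖ * ‖b z‖ ≤ (C * (1 + ‖z.2‖) ^ k) * (C' * (1 + ‖z.2‖) ^ k') :=
        mul_le_mul (hC z) (hC' z) (norm_nonneg _) ((norm_nonneg _).trans (hC z))
    _ = _ := by ring

theorem IsTempered.add {a b : Phase d → ℂ} (ha : IsTempered a) (hb : IsTempered b) :
    IsTempered fun z => a z + b z := by
  obtain ⟨C, k, hC⟩ := ha.bound
  obtain ⟨C', k', hC'⟩ := hb.bound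
  refine ⟨ha.continuous.add hb.continuous, |C| + |C'|, k + k', fun z => ?_⟩
  have h1 : (1 : ℝ) ≤ 1 + ‖z.2‖ := by linarith [norm_nonneg z.2]
  have h2 : (1 + ‖z.2‖) ^ k ≤ (1 + ‖z.2‖) ^ (k + k') := pow_le_pow_right₀ h1 (by omega)
  have h3 : (1 + ‖z.2‖) ^ k' ≤ (1 + ‖z.2‖) ^ (k + k') := pow_le_pow_right₀ h1 (by omega)
  calc ‖a z + b z‖ ≤ ‖a z‖ + ‖b z‖ := norm_add_le _ _
    _ ≤ C * (1 + ‖z.2‖) ^ k + C' * (1 + ‖z.2‖) ^ k' := add_le_add (hC z) (hC' z)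
    _ ≤ |C| * (1 + ‖z.2‖) ^ k + |C'| * (1 + ‖z.2‖) ^ k' := by
        gcongr <;> exact le_abs_self _
    _ ≤ |C| * (1 + ‖z.2‖) ^ (k + k') + |C'| * (1 + ‖z.2‖) ^ (k + k') := by gcongr
    _ = _ := by ring

theorem IsTempered.of_bounded {a : Phase d → ℂ} (ha : Continuous a) {C : ℝ}
    (h : ∀ z, ‖a z‖ ≤ C) : IsTempered a := ⟨ha, C, 0, by simpa using h⟩

theorem IsTempered.const (c : ℂ) : IsTempered fun _ : Phase d => c :=
  .of_bounded continuous_const fun _ => le_rfl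

theorem IsTempered.neg {a : Phase d → ℂ} (ha : IsTempered a) : IsTempered fun z => -a z := by
  simpa using (IsTempered.const (-1)).mul ha

theorem IsTempered.sub {a b : Phase d → ℂ} (ha : IsTempered a) (hb : IsTempered b) :
    IsTempered fun z => a z - b z := by
  simpa [sub_eq_add_neg] using ha.add hb.neg

theorem IsTempered.conj {a : Phase d → ℂ} (ha : IsTempered a) :
    IsTempered fun z => starRingEnd ℂ (a z) :=
  ⟨Complex.continuous_conj.comp ha.continuous, by simpa using ha.bound⟩

theorem IsTempered.sum {ι : Type*} (s : Finset ι) {a : ι → Phase d → ℂ}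
    (ha : ∀ i ∈ s, IsTempered (a i)) : IsTempered fun z => ∑ i ∈ s, a i z := by
  classical
  induction s using Finset.induction_on with
  | empty => simpa using IsTempered.const 0
  | insert i s hi ih =>
    simp_rw [Finset.sum_insert hi]
    exact (ha i (Finset.mem_insert_self _ _)).add
      (ih fun j hj => ha j (Finset.mem_insert_of_mem hj))

theorem IsTempered.of_hasCompactSupport {a : Phase d → ℂ} (ha : Continuous a)
    (h : HasCompactSupport a) : IsTempered a := by
  obtain ⟨C, hC⟩ := ha.bounded_above_of_compact_support h
  exact .of_bounded ha hC

theorem IsTempered.comp_fst {u : Pos d → ℂ} (hu : Continuous u) (h : HasCompactSupport u) :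
    IsTempered fun z : Phase d => u z.1 := by
  obtain ⟨C, hC⟩ := hu.bounded_above_of_compact_support h
  exact .of_bounded (hu.comp continuous_fst) fun z => hC z.1

theorem IsTempered.velocity (j : Fin d) : IsTempered fun z : Phase d => (z.2 j : ℂ) := by
  refine ⟨by fun_prop, 1, 1, fun z => ?_⟩
  have := PiLp.norm_apply_le z.2 j
  rw [Complex.norm_real]
  linarith

theorem IsTempered.integrable {V : Pos d → ℝ} (hV : IsConfining V) {a : Phase d → ℂ}
    (ha : IsTempered a) : Integrable fun z => (maxwellian V z : ℂ) * a z := by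
  obtain ⟨C, k, hC⟩ := ha.bound
  have hM := (contDiff_maxwellian hV).continuous
  have hac := ha.continuous
  refine ((integrable_one_add_norm_pow_mul_maxwellian hV k).const_mul C).mono'
    (Continuous.aestronglyMeasurable (by fun_prop)) (Eventually.of_forall fun z => ?_)
  rw [norm_mul, Complex.norm_real, Real.norm_of_nonneg (maxwellian_nonneg V z)]
  calc maxwellian V z * ‖a z‖ ≤ maxwellian V z * (C * (1 + ‖z.2‖) ^ k) :=
        mul_le_mul_of_nonneg_left (hC z) (maxwellian_nonneg V z)
    _ = _ := by ring

theorem IsTempered.integrable_normSq {V : Pos d → ℝ} (hV : IsConfining V) {a : Phase d → ℂ}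
    (ha : IsTempered a) : Integrable fun z => maxwellian V z * ‖a z‖ ^ 2 := by
  have := ((ha.conj.mul ha).integrable hV).re
  refine this.congr (Eventually.of_forall fun z => ?_)
  simp only
  rw [← Complex.normSq_eq_conj_mul_self, Complex.normSq_eq_norm_sq, ← Complex.ofReal_mul]
  rfl

/-! ### Representing elements of `B²` by functions -/

theorem ae_weight {V : Pos d → ℝ} (hV : IsConfining V) :
    ae (weight V) = ae (volume : Measure (Phase d)) := by
  refine le_antisymm (withDensity_absolutelyContinuous _ _).ae_le
    (withDensity_absolutelyContinuous' ?_ ?_).ae_le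
  · exact ((measurable_maxwellian hV).inv.ennreal_ofReal).aemeasurable
  · exact Eventually.of_forall fun z =>
      (ENNReal.ofReal_pos.2 (inv_pos.2 (maxwellian_pos hV z))).ne'

/-- `f = 𝓜 a` almost everywhere. -/
def Represents (V : Pos d → ℝ) (f : B2 V) (a : Phase d → ℂ) : Prop :=
  f =ᵐ[weight V] fun z => (maxwellian V z : ℂ) * a z

variable {V : Pos d → ℝ}

theorem Represents.add {f g : B2 V} {a b : Phase d → ℂ} (hf : Represents V f a)
    (hg : Represents V g b) : Represents V (f + g) (fun z => a z + b z) := by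
  filter_upwards [Lp.coeFn_add f g, hf, hg] with z h h1 h2
  rw [h, Pi.add_apply, h1, h2]; ring

theorem Represents.smul {f : B2 V} {a : Phase d → ℂ} (hf : Represents V f a) (c : ℂ) :
    Represents V (c • f) (fun z => c * a z) := by
  filter_upwards [Lp.coeFn_smul c f, hf] with z h h1
  rw [h, Pi.smul_apply, h1, smul_eq_mul]; ring

theorem Represents.neg {f : B2 V} {a : Phase d → ℂ} (hf : Represents V f a) :
    Represents V (-f) (fun z => -a z) := by
  simpa using hf.smul (-1)

theorem Represents.sub {f g : B2 V} {a b : Phase d → ℂ} (hf : Represents V f a)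
    (hg : Represents V g b) : Represents V (f - g) (fun z => a z - b z) := by
  simpa [sub_eq_add_neg] using hf.add hg.neg

theorem Represents.zero : Represents V 0 (fun _ => 0) := by
  filter_upwards [Lp.coeFn_zero ℂ 2 (weight V)] with z h
  rw [h]; simp

theorem Represents.congr {f : B2 V} {a b : Phase d → ℂ} (hf : Represents V f a)
    (h : ∀ z, a z = b z) : Represents V f b := by
  rwa [← funext h]

theorem Represents.eq {f g : B2 V} {a : Phase d → ℂ} (hf : Represents V f a)
    (hg : Represents V g a) : f = g :=
  Lp.ext (hf.trans (EventuallyEq.symm hg))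

theorem integrable_weight_iff (hV : IsConfining V) {g : Phase d → ℂ} :
    Integrable g (weight V) ↔ Integrable fun z => ((maxwellian V z)⁻¹ : ℂ) * g z := by
  unfold weight
  rw [integrable_withDensity_iff_integrable_smul']
  · refine integrable_congr (Eventually.of_forall fun z => ?_)
    simp only
    rw [ENNReal.toReal_ofReal (inv_nonneg.2 (maxwellian_nonneg V z)), ← Complex.ofReal_inv,
      Complex.real_smul]
  · exact (measurable_maxwellian hV).inv.ennreal_ofReal
  · exact Eventually.of_forall fun z => ENNReal.ofReal_lt_top

theorem integral_weight (hV : IsConfining V) (g : Phase d → ℂ) :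
    ∫ z, g z ∂(weight V) = ∫ z, ((maxwellian V z)⁻¹ : ℂ) * g z := by
  unfold weight
  rw [integral_withDensity_eq_integral_toReal_smul]
  · refine integral_congr_ae (Eventually.of_forall fun z => ?_)
    simp only
    rw [ENNReal.toReal_ofReal (inv_nonneg.2 (maxwellian_nonneg V z)), ← Complex.ofReal_inv,
      Complex.real_smul]
  · exact (measurable_maxwellian hV).inv.ennreal_ofReal
  · exact Eventually.of_forall fun z => ENNReal.ofReal_lt_top

theorem Represents.inner_integrand (hV : IsConfining V) {e f : B2 V} {a : Phase d → ℂ}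
    (he : Represents V e a) : (fun z => ((maxwellian V z)⁻¹ : ℂ) * inner ℂ (e z) (f z))
      =ᵐ[volume] fun z => starRingEnd ℂ (a z) * f z := by
  have h : ∀ᵐ z ∂(volume : Measure (Phase d)), e z = (maxwellian V z : ℂ) * a z := by
    rw [← ae_weight hV]; exact he
  filter_upwards [h] with z hz
  have hM : (maxwellian V z : ℂ) ≠ 0 := by exact_mod_cast (maxwellian_pos hV z).ne'
  rw [hz]
  simp only [RCLike.inner_apply, map_mul, Complex.conj_ofReal]
  field_simp

theorem Represents.integrable_conj_mul (hV : IsConfining V) {e : B2 V} {a : Phase d → ℂ}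
    (he : Represents V e a) (f : B2 V) : Integrable fun z => starRingEnd ℂ (a z) * f z := by
  have h := L2.integrable_inner (𝕜 := ℂ) e f
  rw [integrable_weight_iff hV] at h
  exact h.congr (he.inner_integrand hV)

theorem Represents.inner_eq (hV : IsConfining V) {e : B2 V} {a : Phase d → ℂ}
    (he : Represents V e a) (f : B2 V) : inner ℂ e f = ∫ z, starRingEnd ℂ (a z) * f z := by
  rw [L2.inner_def, integral_weight hV]
  exact integral_congr_ae (he.inner_integrand hV)

theorem Represents.inner_eq' (hV : IsConfining V) {e f : B2 V} {a b : Phase d → ℂ}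
    (he : Represents V e a) (hf : Represents V f b) :
    inner ℂ e f = ∫ z, (maxwellian V z : ℂ) * (starRingEnd ℂ (a z) * b z) := by
  rw [he.inner_eq hV]
  have h : ∀ᵐ z ∂(volume : Measure (Phase d)), f z = (maxwellian V z : ℂ) * b z := by
    rw [← ae_weight hV]; exact hf
  refine integral_congr_ae ?_
  filter_upwards [h] with z hz
  rw [hz]; ring

theorem Represents.norm_sq (hV : IsConfining V) {e : B2 V} {a : Phase d → ℂ}
    (he : Represents V e a) : ‖e‖ ^ 2 = ∫ z, maxwellian V z * ‖a z‖ ^ 2 := by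
  rw [← re_inner_self_eq, he.inner_eq' hV he]
  have : ∀ z, (maxwellian V z : ℂ) * (starRingEnd ℂ (a z) * a z)
      = ((maxwellian V z * ‖a z‖ ^ 2 : ℝ) : ℂ) := fun z => by
    rw [← Complex.normSq_eq_conj_mul_self, Complex.normSq_eq_norm_sq, ← Complex.ofReal_mul]
  simp_rw [this]
  rw [integral_complex_ofReal, Complex.ofReal_re]

theorem exists_represents_of_integrable (hV : IsConfining V) {a : Phase d → ℂ}
    (ha : AEStronglyMeasurable a volume)
    (h : Integrable fun z => maxwellian V z * ‖a z‖ ^ 2) : ∃ e : B2 V, Represents V e a := by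
  have hm : AEStronglyMeasurable (fun z => (maxwellian V z : ℂ) * a z) volume :=
    (Complex.continuous_ofReal.comp (contDiff_maxwellian hV).continuous).aestronglyMeasurable.mul ha
  have hm' : AEStronglyMeasurable (fun z => (maxwellian V z : ℂ) * a z) (weight V) :=
    hm.mono_ac (withDensity_absolutelyContinuous _ _)
  have hM : MemLp (fun z => (maxwellian V z : ℂ) * a z) 2 (weight V) := by
    rw [memLp_two_iff_integrable_sq_norm hm']
    unfold weight
    have hm1 : Measurable fun z => ENNReal.ofReal (maxwellian V z)⁻¹ :=
      (measurable_maxwellian hV).inv.ennreal_ofReal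
    rw [integrable_withDensity_iff hm1 (by simp)]
    refine h.congr (Eventually.of_forall fun z => ?_)
    have h0 := maxwellian_pos hV z
    simp only
    rw [ENNReal.toReal_ofReal (inv_nonneg.2 h0.le), norm_mul, Complex.norm_real,
      Real.norm_of_nonneg h0.le]
    field_simp
  exact ⟨hM.toLp _, hM.coeFn_toLp⟩

theorem IsTempered.exists_represents (hV : IsConfining V) {a : Phase d → ℂ} (ha : IsTempered a) :
    ∃ e : B2 V, Represents V e a :=
  exists_represents_of_integrable hV ha.continuous.aestronglyMeasurable (ha.integrable_normSq hV)

theorem represents_maxwellianB2 (hV : IsConfining V) : Represents V (maxwellianB2 hV) fun _ => 1 := by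
  filter_upwards [(memLp_maxwellian hV).coeFn_toLp] with z hz
  rw [mul_one]; exact hz

theorem norm_maxwellianB2 (hV : IsConfining V) : ‖maxwellianB2 hV‖ = 1 := by
  have := (represents_maxwellianB2 hV).norm_sq hV
  simp only [norm_one, one_pow, mul_one, integral_maxwellian hV] at this
  nlinarith [norm_nonneg (maxwellianB2 hV)]

end RelaxationBoltzmann

end

open MeasureTheory Filter Topology
open scoped ContDiff Gradient NNReal

noncomputable section

namespace RelaxationBoltzmann

variable {d : ℕ}

/-! ### Test functions -/

/-- `φ` is a test function: smooth with compact support. -/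
structure IsTest {E : Type*} [NormedAddCommGroup E] [NormedSpace ℝ E] (φ : E → ℂ) : Prop where
  smooth : ContDiff ℝ ∞ φ
  compact : HasCompactSupport φ

section Test

variable {E : Type*} [NormedAddCommGroup E] [NormedSpace ℝ E] {φ ψ : E → ℂ}

theorem IsTest.continuous (hφ : IsTest φ) : Continuous φ := hφ.smooth.continuous

theorem _root_.ContDiff.fderiv_apply_const {F : Type*} [NormedAddCommGroup F] [NormedSpace ℝ F]
    {f : E → F} (hf : ContDiff ℝ ∞ f) (e : E) : ContDiff ℝ ∞ fun z => fderiv ℝ f z e :=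
  (hf.fderiv_right (m := ∞) (by norm_cast)).clm_apply contDiff_const

theorem IsTest.fderiv_apply (hφ : IsTest φ) (e : E) : IsTest fun z => fderiv ℝ φ z e :=
  ⟨hφ.smooth.fderiv_apply_const e, hφ.compact.fderiv_apply ℝ e⟩

theorem IsTest.mul_left (hφ : IsTest φ) {a : E → ℂ} (ha : ContDiff ℝ ∞ a) :
    IsTest fun z => a z * φ z := ⟨ha.mul hφ.smooth, hφ.compact.mul_left⟩

theorem IsTest.mul_right (hφ : IsTest φ) {a : E → ℂ} (ha : ContDiff ℝ ∞ a) :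
    IsTest fun z => φ z * a z := ⟨hφ.smooth.mul ha, hφ.compact.mul_right⟩

theorem IsTest.add (hφ : IsTest φ) (hψ : IsTest ψ) : IsTest fun z => φ z + ψ z :=
  ⟨hφ.smooth.add hψ.smooth, hφ.compact.add hψ.compact⟩

theorem IsTest.const_mul (hφ : IsTest φ) (c : ℂ) : IsTest fun z => c * φ z :=
  hφ.mul_left contDiff_const

theorem IsTest.sub (hφ : IsTest φ) (hψ : IsTest ψ) : IsTest fun z => φ z - ψ z := by
  simpa [sub_eq_add_neg] using hφ.add (hψ.const_mul (-1))

theorem IsTest.zero : IsTest fun _ : E => (0 : ℂ) := ⟨contDiff_const, HasCompactSupport.zero⟩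

theorem IsTest.sum {ι : Type*} (s : Finset ι) {a : ι → E → ℂ} (ha : ∀ i ∈ s, IsTest (a i)) :
    IsTest fun z => ∑ i ∈ s, a i z := by
  classical
  induction s using Finset.induction_on with
  | empty => simpa using IsTest.zero
  | insert i s hi ih =>
    simp_rw [Finset.sum_insert hi]
    exact (ha i (Finset.mem_insert_self _ _)).add
      (ih fun j hj => ha j (Finset.mem_insert_of_mem hj))

theorem _root_.ContDiff.complex_conj {a : E → ℂ} (ha : ContDiff ℝ ∞ a) :
    ContDiff ℝ ∞ fun z => starRingEnd ℂ (a z) :=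
  Complex.conjCLE.contDiff.comp ha

theorem IsTest.conj (hφ : IsTest φ) : IsTest fun z => starRingEnd ℂ (φ z) :=
  ⟨hφ.smooth.complex_conj, hφ.compact.comp_left (map_zero _)⟩

theorem _root_.ContDiff.complex_ofReal {a : E → ℝ} (ha : ContDiff ℝ ∞ a) :
    ContDiff ℝ ∞ fun z => (a z : ℂ) :=
  Complex.ofRealCLM.contDiff.comp ha

theorem fderiv_conj_apply (a : E → ℂ) (z e : E) :
    fderiv ℝ (fun z => starRingEnd ℂ (a z)) z e = starRingEnd ℂ (fderiv ℝ a z e) := by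
  have h : (fun z => starRingEnd ℂ (a z)) = Complex.conjCLE ∘ a := rfl
  rw [h, ContinuousLinearEquiv.comp_fderiv]
  rfl

theorem fderiv_mul_apply' {a b : E → ℂ} {z : E} (ha : DifferentiableAt ℝ a z)
    (hb : DifferentiableAt ℝ b z) (e : E) :
    fderiv ℝ (fun z => a z * b z) z e = a z * fderiv ℝ b z e + fderiv ℝ a z e * b z := by
  rw [fderiv_fun_mul ha hb]
  simp only [add_apply, smul_apply, smul_eq_mul]
  ring

theorem fderiv_ofReal_apply {a : E → ℝ} {z : E} (ha : DifferentiableAt ℝ a z) (e : E) :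
    fderiv ℝ (fun z => (a z : ℂ)) z e = (fderiv ℝ a z e : ℝ) := by
  have h := (Complex.ofRealCLM.hasFDerivAt (x := a z)).comp z ha.hasFDerivAt
  have : (fun z => (a z : ℂ)) = Complex.ofRealCLM ∘ a := rfl
  rw [this, h.fderiv]
  rfl

theorem _root_.ContDiff.differentiableAt' {F : Type*} [NormedAddCommGroup F] [NormedSpace ℝ F]
    {f : E → F} (hf : ContDiff ℝ ∞ f) (z : E) : DifferentiableAt ℝ f z :=
  (hf.differentiable (by simp)).differentiableAt

/-- Symmetry of second derivatives. -/
theorem fderiv_fderiv_comm {a : E → ℂ} (ha : ContDiff ℝ ∞ a) (z e e' : E) :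
    fderiv ℝ (fun w => fderiv ℝ a w e) z e' = fderiv ℝ (fun w => fderiv ℝ a w e') z e := by
  have h : ∀ e, fderiv ℝ (fun w => fderiv ℝ a w e) z = (fderiv ℝ (fderiv ℝ a) z).flip e := fun e => by
    have hd : DifferentiableAt ℝ (fderiv ℝ a) z :=
      (ha.fderiv_right (m := ∞) (by norm_cast)).differentiableAt' z
    ext w
    rw [fderiv_clm_apply hd (differentiableAt_const _)]
    simp
  rw [h, h]
  have hs : IsSymmSndFDerivAt ℝ a z :=
    ha.contDiffAt.isSymmSndFDerivAt (by simp [minSmoothness_of_isRCLikeNormedField]; norm_cast)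
  exact (hs e e').symm

end Test

instance isAddHaarMeasure_volume_phase : (volume : Measure (Phase d)).IsAddHaarMeasure :=
  inferInstanceAs ((volume : Measure (Pos d)).prod volume).IsAddHaarMeasure

/-- Integration by parts against a density `M` with `∂ₑ M = -w M`. -/
theorem integral_density_mul_fderiv {E : Type*} [NormedAddCommGroup E] [NormedSpace ℝ E]
    [MeasurableSpace E] [BorelSpace E] [FiniteDimensional ℝ E] {μ : Measure E}
    [μ.IsAddHaarMeasure] {M w : E → ℝ} {e : E} (hM : ContDiff ℝ ∞ M)
    (hw : ∀ z, fderiv ℝ M z e = -(w z * M z)) {a : E → ℂ} (ha : ContDiff ℝ ∞ a)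
    (h1 : Integrable (fun z => (M z : ℂ) * a z) μ)
    (h2 : Integrable (fun z => (M z : ℂ) * fderiv ℝ a z e) μ)
    (h3 : Integrable (fun z => (M z : ℂ) * (w z * a z)) μ) :
    ∫ z, (M z : ℂ) * fderiv ℝ a z e ∂μ = ∫ z, (M z : ℂ) * (w z * a z) ∂μ := by
  have hM' : ∀ z, fderiv ℝ (fun z => (M z : ℂ)) z e = -((w z : ℂ) * M z) := fun z => by
    rw [fderiv_ofReal_apply (hM.differentiableAt' z), hw]; push_cast; ring
  have h3' : Integrable (fun z => fderiv ℝ (fun z => (M z : ℂ)) z e * a z) μ := by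
    refine h3.neg.congr (Eventually.of_forall fun z => ?_)
    simp only [hM', Pi.neg_apply]; ring
  rw [integral_mul_fderiv_eq_neg_fderiv_mul_of_integrable h3' h2 h1
    (fun z _ => hM.complex_ofReal.differentiableAt' z) (fun z _ => ha.differentiableAt' z),
    ← integral_neg]
  refine integral_congr_ae (Eventually.of_forall fun z => ?_)
  simp only [hM']; ring

theorem IsTest.integrable_mul {E : Type*} [NormedAddCommGroup E] [NormedSpace ℝ E]
    [MeasurableSpace E] [BorelSpace E] {μ : Measure E} [IsFiniteMeasureOnCompacts μ] {a φ : E → ℂ}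
    (hφ : IsTest φ) (ha : Continuous a) : Integrable (fun z => a z * φ z) μ :=
  (ha.mul hφ.continuous).integrable_of_hasCompactSupport hφ.compact.mul_left

/-- The adjoint of `∂ₑ` with respect to the density `M`, for compactly supported `a b`. -/
theorem integral_density_mul_fderiv_mul {E : Type*} [NormedAddCommGroup E] [NormedSpace ℝ E]
    [MeasurableSpace E] [BorelSpace E] [FiniteDimensional ℝ E] {μ : Measure E}
    [μ.IsAddHaarMeasure] {M w : E → ℝ} {e : E} (hM : ContDiff ℝ ∞ M) (hwc : ContDiff ℝ ∞ w)
    (hw : ∀ z, fderiv ℝ M z e = -(w z * M z)) {a b : E → ℂ} (ha : IsTest a)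
    (hb : ContDiff ℝ ∞ b) :
    ∫ z, (M z : ℂ) * (a z * (w z * b z - fderiv ℝ b z e)) ∂μ
      = ∫ z, (M z : ℂ) * (fderiv ℝ a z e * b z) ∂μ := by
  have hab : IsTest fun z => a z * b z := ha.mul_right hb
  have hMc : Continuous fun z => (M z : ℂ) := hM.complex_ofReal.continuous
  have h3' := ((hab.mul_left hwc.complex_ofReal).integrable_mul (μ := μ) hMc)
  have key := integral_density_mul_fderiv (μ := μ) hM hw hab.smooth (hab.integrable_mul hMc)
    ((hab.fderiv_apply e).integrable_mul hMc) h3'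
  have h5 : Integrable (fun z => (M z : ℂ) * (a z * fderiv ℝ b z e)) μ :=
    (ha.mul_right (hb.fderiv_apply_const e)).integrable_mul hMc
  have h6 : Integrable (fun z => (M z : ℂ) * (fderiv ℝ a z e * b z)) μ :=
    ((ha.fderiv_apply e).mul_right hb).integrable_mul hMc
  have e1 : ∀ z, (M z : ℂ) * fderiv ℝ (fun z => a z * b z) z e
      = (M z : ℂ) * (a z * fderiv ℝ b z e) + (M z : ℂ) * (fderiv ℝ a z e * b z) := fun z => by
    rw [fderiv_mul_apply' (ha.smooth.differentiableAt' z) (hb.differentiableAt' z)]; ring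
  have e2 : ∀ z, (M z : ℂ) * (a z * (w z * b z - fderiv ℝ b z e))
      = (M z : ℂ) * (w z * (a z * b z)) - (M z : ℂ) * (a z * fderiv ℝ b z e) := fun z => by ring
  simp_rw [e1] at key
  simp_rw [e2]
  rw [integral_add h5 h6] at key
  rw [integral_sub h3' h5, ← key]
  ring

/-! ### The differential operators, relative to the Maxwellian -/

/-- The coordinate directions of phase space. -/
def dir : Fin d ⊕ Fin d → Phase d
  | .inl j => (EuclideanSpace.single j 1, 0)
  | .inr j => (0, EuclideanSpace.single j 1)

/-- The derivatives of `-log 𝓜`. -/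
def drift (V : Pos d → ℝ) : Fin d ⊕ Fin d → Phase d → ℝ
  | .inl j => fun z => (∇ V z.1) j
  | .inr j => fun z => z.2 j

variable {V : Pos d → ℝ}

theorem gradient_apply_eq (hV : IsConfining V) (x : Pos d) (j : Fin d) :
    (∇ V x) j = fderiv ℝ V x (EuclideanSpace.single j 1) := by
  have h := (hV.smooth.differentiableAt' x).hasGradientAt.hasFDerivAt.fderiv
  rw [h, InnerProductSpace.toDual_apply_apply, EuclideanSpace.inner_single_right]
  simp

theorem contDiff_gradient (hV : IsConfining V) : ContDiff ℝ ∞ (∇ V) := by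
  have h : ∇ V = (InnerProductSpace.toDual ℝ (Pos d)).symm ∘ fderiv ℝ V := rfl
  rw [h]
  exact (InnerProductSpace.toDual ℝ (Pos d)).symm.toContinuousLinearEquiv.contDiff.comp
    (hV.smooth.fderiv_right (m := ∞) (by norm_cast))

theorem contDiff_gradient_apply (hV : IsConfining V) (j : Fin d) :
    ContDiff ℝ ∞ fun x => (∇ V x) j := by
  simp_rw [gradient_apply_eq hV]
  exact hV.smooth.fderiv_apply_const _

theorem contDiff_drift (hV : IsConfining V) (i : Fin d ⊕ Fin d) : ContDiff ℝ ∞ (drift V i) := by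
  cases i with
  | inl j => exact (contDiff_gradient_apply hV j).comp contDiff_fst
  | inr j => exact (EuclideanSpace.proj (𝕜 := ℝ) j).contDiff.comp contDiff_snd

theorem fderiv_spatialMaxwellian (hV : IsConfining V) (x : Pos d) (j : Fin d) :
    fderiv ℝ (spatialMaxwellian V) x (EuclideanSpace.single j 1)
      = -((∇ V x) j * spatialMaxwellian V x) := by
  have h := ((hV.smooth.differentiableAt' x).hasFDerivAt.neg.exp.mul_const
    (∫ y, Real.exp (-V y))⁻¹)
  have e : spatialMaxwellian V = fun x => Real.exp (-V x) * (∫ y, Real.exp (-V y))⁻¹ := by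
    funext x; rw [spatialMaxwellian, div_eq_mul_inv]
  rw [gradient_apply_eq hV]
  rw [e]
  erw [h.fderiv]
  simp
  ring

theorem fderiv_velocityMaxwellian (v : Pos d) (j : Fin d) :
    fderiv ℝ velocityMaxwellian v (EuclideanSpace.single j 1)
      = -(v j * velocityMaxwellian v) := by
  have h0 : HasFDerivAt (fun v : Pos d => -‖v‖ ^ 2 / 2) (-(innerSL ℝ v)) v := by
    have h1 := ((hasStrictFDerivAt_norm_sq v).hasFDerivAt.mul_const (-1 / 2 : ℝ))
    have e1 : (fun v : Pos d => -‖v‖ ^ 2 / 2) = fun v => ‖v‖ ^ 2 * (-1 / 2) := by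
      funext v; ring
    rw [e1]
    refine h1.congr_fderiv ?_
    ext w
    simp
    ring
  have h := (h0.exp.mul_const ((2 * Real.pi) ^ ((d : ℝ) / 2))⁻¹)
  have e : (velocityMaxwellian : Pos d → ℝ)
      = fun v => Real.exp (-‖v‖ ^ 2 / 2) * ((2 * Real.pi) ^ ((d : ℝ) / 2))⁻¹ := by
    funext x; rw [velocityMaxwellian, div_eq_mul_inv]
  rw [e, h.fderiv]
  simp [EuclideanSpace.inner_single_right]
  ring

theorem fderiv_comp_fst_apply {F : Type*} [NormedAddCommGroup F] [NormedSpace ℝ F] {u : Pos d → F}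
    {z : Phase d} (hu : DifferentiableAt ℝ u z.1) (w : Phase d) :
    fderiv ℝ (fun z : Phase d => u z.1) z w = fderiv ℝ u z.1 w.1 := by
  have h := hu.hasFDerivAt.comp z (hasFDerivAt_fst (𝕜 := ℝ) (p := z))
  have e : (fun z : Phase d => u z.1) = u ∘ Prod.fst := rfl
  rw [e, h.fderiv]; rfl

theorem fderiv_comp_snd_apply {F : Type*} [NormedAddCommGroup F] [NormedSpace ℝ F] {u : Pos d → F}
    {z : Phase d} (hu : DifferentiableAt ℝ u z.2) (w : Phase d) :
    fderiv ℝ (fun z : Phase d => u z.2) z w = fderiv ℝ u z.2 w.2 := by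
  have h := hu.hasFDerivAt.comp z (hasFDerivAt_snd (𝕜 := ℝ) (p := z))
  have e : (fun z : Phase d => u z.2) = u ∘ Prod.snd := rfl
  rw [e, h.fderiv]; rfl

theorem fderiv_maxwellian (hV : IsConfining V) (z : Phase d) (i : Fin d ⊕ Fin d) :
    fderiv ℝ (maxwellian V) z (dir i) = -(drift V i z * maxwellian V z) := by
  have h1 : DifferentiableAt ℝ (spatialMaxwellian V) z.1 :=
    (contDiff_spatialMaxwellian hV).differentiableAt' _
  have h2 : DifferentiableAt ℝ (velocityMaxwellian : Pos d → ℝ) z.2 :=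
    contDiff_velocityMaxwellian.differentiableAt' _
  have h1' : DifferentiableAt ℝ (fun z : Phase d => spatialMaxwellian V z.1) z :=
    h1.comp z differentiableAt_fst
  have h2' : DifferentiableAt ℝ (fun z : Phase d => velocityMaxwellian z.2) z :=
    h2.comp z differentiableAt_snd
  have e : maxwellian V = fun z : Phase d => spatialMaxwellian V z.1 * velocityMaxwellian z.2 := rfl
  rw [e, fderiv_fun_mul h1' h2']
  simp only [add_apply, smul_apply, smul_eq_mul]
  rw [fderiv_comp_fst_apply h1, fderiv_comp_snd_apply h2]
  cases i with
  | inl j =>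
    simp only [dir, drift, map_zero, mul_zero, zero_add, fderiv_spatialMaxwellian hV]
    ring
  | inr j =>
    simp only [dir, drift, map_zero, mul_zero, add_zero, fderiv_velocityMaxwellian]
    ring

/-- The transport operator `v · ∂_x - ∂_x V · ∂_v`. -/
def transport (V : Pos d → ℝ) (a : Phase d → ℂ) (z : Phase d) : ℂ :=
  fderiv ℝ a z (z.2, -∇ V z.1)

/-- `∑ ∂ᵢ* ∂ᵢ`, the adjoints being taken in `L²(𝓜)`. -/
def ellipticOp (V : Pos d → ℝ) (a : Phase d → ℂ) (z : Phase d) : ℂ :=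
  ∑ i, ((drift V i z : ℂ) * fderiv ℝ a z (dir i)
    - fderiv ℝ (fun w => fderiv ℝ a w (dir i)) z (dir i))

theorem transport_eq_sum (a : Phase d → ℂ) (z : Phase d) :
    transport V a z = ∑ j, ((z.2 j : ℂ) * fderiv ℝ a z (dir (.inl j))
      - ((∇ V z.1) j : ℂ) * fderiv ℝ a z (dir (.inr j))) := by
  have h : ((z.2, -∇ V z.1) : Phase d)
      = ∑ j, ((z.2 j) • dir (.inl j) - ((∇ V z.1) j) • dir (.inr j)) := by
    have hb : ∀ x : Pos d, x = ∑ j, x j • EuclideanSpace.single j (1 : ℝ) := fun x => by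
      conv_lhs => rw [← (EuclideanSpace.basisFun (Fin d) ℝ).sum_repr x]
      simp
    refine Prod.ext ?_ ?_
    · rw [Prod.fst_sum]
      simp only [dir, Prod.fst_sub, Prod.smul_fst, smul_zero, sub_zero]
      exact hb _
    · rw [Prod.snd_sum]
      simp only [dir, Prod.snd_sub, Prod.smul_snd, smul_zero, zero_sub, Finset.sum_neg_distrib]
      exact congrArg _ (hb _)
  rw [transport, h, map_sum]
  refine Finset.sum_congr rfl fun j _ => ?_
  rw [map_sub, map_smul, map_smul, Complex.real_smul, Complex.real_smul]

theorem contDiff_transport (hV : IsConfining V) {a : Phase d → ℂ} (ha : ContDiff ℝ ∞ a) :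
    ContDiff ℝ ∞ (transport V a) := by
  have h : ContDiff ℝ ∞ fun z : Phase d => ((z.2, -∇ V z.1) : Phase d) :=
    contDiff_snd.prodMk ((contDiff_gradient hV).comp contDiff_fst).neg
  exact (ha.fderiv_right (m := ∞) (by norm_cast)).clm_apply h

theorem IsTest.transport (hV : IsConfining V) {a : Phase d → ℂ} (ha : IsTest a) :
    IsTest (transport V a) := by
  refine ⟨contDiff_transport hV ha.smooth, (ha.compact.fderiv ℝ).mono fun z hz => ?_⟩
  contrapose! hz
  simp only [Function.mem_support, not_not] at hz ⊢
  simp [RelaxationBoltzmann.transport, hz]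

theorem contDiff_ellipticOp (hV : IsConfining V) {a : Phase d → ℂ} (ha : ContDiff ℝ ∞ a) :
    ContDiff ℝ ∞ (ellipticOp V a) :=
  ContDiff.sum fun i _ => ((contDiff_drift hV i).complex_ofReal.mul
    (ha.fderiv_apply_const _)).sub ((ha.fderiv_apply_const _).fderiv_apply_const _)

theorem IsTest.ellipticOp (hV : IsConfining V) {a : Phase d → ℂ} (ha : IsTest a) :
    IsTest (ellipticOp V a) :=
  IsTest.sum _ fun i _ => ((ha.fderiv_apply _).mul_left (contDiff_drift hV i).complex_ofReal).sub
    ((ha.fderiv_apply _).fderiv_apply _)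

theorem transport_mul {a b : Phase d → ℂ} (ha : ContDiff ℝ ∞ a) (hb : ContDiff ℝ ∞ b)
    (z : Phase d) : transport V (fun z => a z * b z) z
      = a z * transport V b z + transport V a z * b z :=
  fderiv_mul_apply' (ha.differentiableAt' z) (hb.differentiableAt' z) _

theorem transport_conj (a : Phase d → ℂ) (z : Phase d) :
    transport V (fun z => starRingEnd ℂ (a z)) z = starRingEnd ℂ (transport V a z) :=
  fderiv_conj_apply _ _ _

theorem integral_maxwellian_mul_transport (hV : IsConfining V) {a : Phase d → ℂ} (ha : IsTest a) :
    ∫ z, (maxwellian V z : ℂ) * transport V a z = 0 := by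
  have hM := contDiff_maxwellian hV
  have hMc : Continuous fun z => (maxwellian V z : ℂ) := hM.complex_ofReal.continuous
  have key : ∀ i k : Fin d ⊕ Fin d, (∀ z, fderiv ℝ (drift V k) z (dir i) = 0) →
      ∫ z, (maxwellian V z : ℂ) * (drift V k z * fderiv ℝ a z (dir i))
        = ∫ z, (maxwellian V z : ℂ) * (drift V i z * (drift V k z * a z)) := by
    intro i k hk
    have hka : IsTest fun z => (drift V k z : ℂ) * a z :=
      ha.mul_left (contDiff_drift hV k).complex_ofReal
    rw [← integral_density_mul_fderiv (μ := volume) hM (fun z => fderiv_maxwellian hV z i)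
      hka.smooth (hka.integrable_mul hMc) ((hka.fderiv_apply _).integrable_mul hMc)
      ((hka.mul_left (contDiff_drift hV i).complex_ofReal).integrable_mul hMc)]
    refine integral_congr_ae (Eventually.of_forall fun z => ?_)
    simp only
    rw [fderiv_mul_apply' ((contDiff_drift hV k).complex_ofReal.differentiableAt' z)
      (ha.smooth.differentiableAt' z),
      fderiv_ofReal_apply ((contDiff_drift hV k).differentiableAt' z), hk]
    simp
  have h1 : ∀ j z, fderiv ℝ (drift V (.inr j)) z (dir (.inl j)) = 0 := fun j z => by
    have := fderiv_comp_snd_apply (z := z) (u := fun v : Pos d => v j)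
      (by fun_prop) (dir (.inl j))
    exact this.trans (by simp [dir])
  have h2 : ∀ j z, fderiv ℝ (drift V (.inl j)) z (dir (.inr j)) = 0 := fun j z => by
    have := fderiv_comp_fst_apply (z := z) (u := fun x : Pos d => (∇ V x) j)
      ((contDiff_gradient_apply hV j).differentiableAt' _) (dir (.inr j))
    exact this.trans (by simp [dir])
  have hi : ∀ i k : Fin d ⊕ Fin d,
      Integrable fun z => (maxwellian V z : ℂ) * (drift V k z * fderiv ℝ a z (dir i)) :=
    fun i k => ((ha.fderiv_apply _).mul_left (contDiff_drift hV k).complex_ofReal).integrable_mul hMc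
  have e : ∀ z, (maxwellian V z : ℂ) * transport V a z = ∑ j,
      ((maxwellian V z : ℂ) * (drift V (.inr j) z * fderiv ℝ a z (dir (.inl j)))
      - (maxwellian V z : ℂ) * (drift V (.inl j) z * fderiv ℝ a z (dir (.inr j)))) := fun z => by
    rw [transport_eq_sum, Finset.mul_sum]
    refine Finset.sum_congr rfl fun j _ => ?_
    simp only [drift]; ring
  simp_rw [e]
  rw [integral_finsetSum _ fun j _ => ?_]
  swap
  · exact (hi _ _).sub (hi _ _)
  refine Finset.sum_eq_zero fun j _ => ?_
  rw [integral_sub (hi _ _) (hi _ _), key _ _ (h1 j), key _ _ (h2 j), sub_eq_zero]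
  refine integral_congr_ae (Eventually.of_forall fun z => ?_)
  simp only; ring

theorem integral_conj_mul_transport (hV : IsConfining V) {a b : Phase d → ℂ} (ha : IsTest a)
    (hb : IsTest b) : ∫ z, (maxwellian V z : ℂ) * (starRingEnd ℂ (a z) * transport V b z)
      = -∫ z, (maxwellian V z : ℂ) * (starRingEnd ℂ (transport V a z) * b z) := by
  have hMc : Continuous fun z => (maxwellian V z : ℂ) :=
    (contDiff_maxwellian hV).complex_ofReal.continuous
  have h := integral_maxwellian_mul_transport hV (ha.conj.mul_right hb.smooth)
  have e : ∀ z, (maxwellian V z : ℂ) * transport V (fun z => starRingEnd ℂ (a z) * b z) z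
      = (maxwellian V z : ℂ) * (starRingEnd ℂ (a z) * transport V b z)
      + (maxwellian V z : ℂ) * (starRingEnd ℂ (transport V a z) * b z) := fun z => by
    rw [transport_mul ha.conj.smooth hb.smooth, transport_conj]; ring
  simp_rw [e] at h
  rw [integral_add ((ha.conj.mul_right (contDiff_transport hV hb.smooth)).integrable_mul hMc)
    (((ha.transport hV).conj.mul_right hb.smooth).integrable_mul hMc)] at h
  exact eq_neg_of_add_eq_zero_left h

theorem integral_conj_mul_ellipticOp (hV : IsConfining V) {a b : Phase d → ℂ} (ha : IsTest a)
    (hb : ContDiff ℝ ∞ b) :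
    ∫ z, (maxwellian V z : ℂ) * (starRingEnd ℂ (a z) * ellipticOp V b z)
      = ∑ i, ∫ z, (maxwellian V z : ℂ) *
        (starRingEnd ℂ (fderiv ℝ a z (dir i)) * fderiv ℝ b z (dir i)) := by
  have hMc : Continuous fun z => (maxwellian V z : ℂ) :=
    (contDiff_maxwellian hV).complex_ofReal.continuous
  have e : ∀ z, (maxwellian V z : ℂ) * (starRingEnd ℂ (a z) * ellipticOp V b z)
      = ∑ i, (maxwellian V z : ℂ) * (starRingEnd ℂ (a z) * ((drift V i z : ℂ) *
        fderiv ℝ b z (dir i) - fderiv ℝ (fun w => fderiv ℝ b w (dir i)) z (dir i))) := fun z => by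
    rw [ellipticOp, Finset.mul_sum, Finset.mul_sum]
  simp_rw [e]
  rw [integral_finsetSum]
  · refine Finset.sum_congr rfl fun i _ => ?_
    rw [integral_density_mul_fderiv_mul (contDiff_maxwellian hV) (contDiff_drift hV i)
      (fun z => fderiv_maxwellian hV z i) ha.conj (hb.fderiv_apply_const _)]
    simp_rw [fderiv_conj_apply]
  · intro i _
    exact (ha.conj.mul_right (((contDiff_drift hV i).complex_ofReal.mul
      (hb.fderiv_apply_const _)).sub
        ((hb.fderiv_apply_const _).fderiv_apply_const _))).integrable_mul hMc

end RelaxationBoltzmann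

end

open MeasureTheory Filter Topology
open scoped ContDiff Gradient NNReal

noncomputable section

namespace RelaxationBoltzmann

variable {d : ℕ} {V : Pos d → ℝ}

/-! ### Cutoff functions -/

theorem norm_fderiv_fderiv_eq (x : Pos d) :
    ‖fderiv ℝ (fderiv ℝ V) x‖ = ‖iteratedFDeriv ℝ 2 V x‖ := by
  rw [← norm_iteratedFDeriv_fderiv, norm_iteratedFDeriv_one]

theorem norm_fderiv_fderiv_sub_le {E F : Type*} [NormedAddCommGroup E] [NormedSpace ℝ E]
    [NormedAddCommGroup F] [NormedSpace ℝ F] {f : E → F} (hf : ContDiff ℝ ∞ f) {C : ℝ}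
    (hC : ∀ x, ‖iteratedFDeriv ℝ 3 f x‖ ≤ C) (x y : E) :
    ‖fderiv ℝ (fderiv ℝ f) y - fderiv ℝ (fderiv ℝ f) x‖ ≤ C * ‖y - x‖ := by
  have h1 : ContDiff ℝ ∞ (fderiv ℝ f) := hf.fderiv_right (m := ∞) (by norm_cast)
  have h2 : ContDiff ℝ ∞ (fderiv ℝ (fderiv ℝ f)) := h1.fderiv_right (m := ∞) (by norm_cast)
  refine Convex.norm_image_sub_le_of_norm_fderiv_le (𝕜 := ℝ) (s := Set.univ)
    (fun z _ => h2.differentiable (by simp) z) (fun z _ => ?_) convex_univ trivial trivial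
  refine le_trans (le_of_eq ?_) (hC z)
  rw [← norm_iteratedFDeriv_fderiv, ← norm_iteratedFDeriv_fderiv, norm_iteratedFDeriv_one]

theorem exists_norm_gradient_le (hV : IsConfining V) :
    ∃ K, 0 ≤ K ∧ ∀ x, ‖∇ V x‖ ≤ K * (1 + ‖x‖) := by
  obtain ⟨C, hC⟩ := hV.bounded 2 le_rfl
  have hC0 : 0 ≤ C := (norm_nonneg _).trans (hC 0)
  refine ⟨C + ‖fderiv ℝ V 0‖, by positivity, fun x => ?_⟩
  have h1 := Convex.norm_image_sub_le_of_norm_fderiv_le (𝕜 := ℝ) (f := fderiv ℝ V) (C := C)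
    (s := Set.univ) (x := 0) (y := x)
    (fun y _ => (hV.smooth.fderiv_right (m := ∞) (by norm_cast)).differentiableAt' y)
    (fun y _ => by rw [norm_fderiv_fderiv_eq]; exact hC y) convex_univ trivial trivial
  have h2 : ‖∇ V x‖ = ‖fderiv ℝ V x‖ := by
    rw [gradient, LinearIsometryEquiv.norm_map]
  rw [h2]
  have h3 : ‖fderiv ℝ V x‖ ≤ ‖fderiv ℝ V x - fderiv ℝ V 0‖ + ‖fderiv ℝ V 0‖ := by
    simpa using norm_add_le (fderiv ℝ V x - fderiv ℝ V 0) (fderiv ℝ V 0)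
  rw [sub_zero] at h1
  have := norm_nonneg x
  have := norm_nonneg (fderiv ℝ V 0)
  nlinarith

theorem exists_abs_drift_le (hV : IsConfining V) :
    ∃ K, 0 ≤ K ∧ ∀ i z, |drift V i z| ≤ K * (1 + ‖z‖) := by
  obtain ⟨K, hK0, hK⟩ := exists_norm_gradient_le hV
  refine ⟨K + 1, by positivity, fun i z => ?_⟩
  have h1 := norm_fst_le z
  have h2 := norm_snd_le z
  have h0 := norm_nonneg z
  cases i with
  | inl j =>
    have h3 := PiLp.norm_apply_le (∇ V z.1) j
    have h4 := hK z.1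
    have h5 : K * ‖z.1‖ ≤ K * ‖z‖ := by gcongr
    simp only [drift]
    rw [Real.norm_eq_abs] at h3
    nlinarith
  | inr j =>
    have h3 := PiLp.norm_apply_le z.2 j
    simp only [drift]
    rw [Real.norm_eq_abs] at h3
    nlinarith

/-- A fixed smooth cutoff function on phase space. -/
def unitCutoff (d : ℕ) : ContDiffBump (0 : Phase d) := ⟨1, 2, one_pos, one_lt_two⟩

/-- The unit cutoff, rescaled to the scale `n + 1`. -/
def cutoff (n : ℕ) (z : Phase d) : ℂ := (unitCutoff d (((n : ℝ) + 1)⁻¹ • z) : ℝ)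

theorem isTest_unitCutoff : IsTest fun z : Phase d => (unitCutoff d z : ℂ) :=
  ⟨(unitCutoff d).contDiff.complex_ofReal,
    (unitCutoff d).hasCompactSupport.comp_left Complex.ofReal_zero⟩

theorem isTest_cutoff (n : ℕ) : IsTest (cutoff n : Phase d → ℂ) := by
  have hn : ((n : ℝ) + 1)⁻¹ ≠ 0 := by positivity
  refine ⟨isTest_unitCutoff.smooth.comp (contDiff_const_smul _), ?_⟩
  exact isTest_unitCutoff.compact.comp_homeomorph (Homeomorph.smulOfNeZero _ hn)

theorem norm_cutoff_le (n : ℕ) (z : Phase d) : ‖cutoff n z‖ ≤ 1 := by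
  rw [cutoff, Complex.norm_real, Real.norm_of_nonneg (unitCutoff d).nonneg]
  exact (unitCutoff d).le_one

theorem cutoff_eq_one {n : ℕ} {z : Phase d} (hz : ‖z‖ ≤ n + 1) : cutoff n z = 1 := by
  rw [cutoff, (unitCutoff d).one_of_mem_closedBall, Complex.ofReal_one]
  rw [mem_closedBall_zero_iff, norm_smul, norm_inv, Real.norm_of_nonneg (by positivity)]
  change _ ≤ (1 : ℝ)
  rw [inv_mul_le_iff₀ (by positivity)]
  linarith

theorem cutoff_eq_zero {n : ℕ} {z : Phase d} (hz : 2 * (n + 1) ≤ ‖z‖) : cutoff n z = 0 := by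
  rw [cutoff, (unitCutoff d).zero_of_le_dist, Complex.ofReal_zero]
  rw [dist_zero_right, norm_smul, norm_inv, Real.norm_of_nonneg (by positivity)]
  change (2 : ℝ) ≤ _
  rw [le_inv_mul_iff₀ (by positivity)]
  linarith

theorem fderiv_comp_smul_apply {E : Type*} [NormedAddCommGroup E] [NormedSpace ℝ E] {u : E → ℂ}
    (hu : ContDiff ℝ ∞ u) (c : ℝ) (z e : E) :
    fderiv ℝ (fun z => u (c • z)) z e = c * fderiv ℝ u (c • z) e := by
  have h := (hu.differentiableAt' (c • z)).hasFDerivAt.comp z ((hasFDerivAt_id z).const_smul c)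
  have e1 : (fun z => u (c • z)) = u ∘ HSMul.hSMul c := rfl
  rw [e1, h.fderiv]
  simp

theorem fderiv_const_mul_apply' {E : Type*} [NormedAddCommGroup E] [NormedSpace ℝ E] {a : E → ℂ}
    {z : E} (ha : DifferentiableAt ℝ a z) (c : ℂ) (e : E) :
    fderiv ℝ (fun z => c * a z) z e = c * fderiv ℝ a z e := by
  rw [fderiv_const_mul ha]; rfl

theorem fderiv_cutoff_apply (n : ℕ) (z e : Phase d) :
    fderiv ℝ (cutoff n) z e = (((n : ℝ) + 1)⁻¹ : ℝ) *
      fderiv ℝ (fun z : Phase d => (unitCutoff d z : ℂ)) (((n : ℝ) + 1)⁻¹ • z) e :=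
  fderiv_comp_smul_apply isTest_unitCutoff.smooth _ z e

theorem fderiv_fderiv_cutoff_apply (n : ℕ) (z e e' : Phase d) :
    fderiv ℝ (fun w => fderiv ℝ (cutoff n) w e) z e'
      = (((n : ℝ) + 1)⁻¹ : ℝ) * ((((n : ℝ) + 1)⁻¹ : ℝ) *
        fderiv ℝ (fun w => fderiv ℝ (fun z : Phase d => (unitCutoff d z : ℂ)) w e)
          (((n : ℝ) + 1)⁻¹ • z) e') := by
  have h : (fun w : Phase d => fderiv ℝ (cutoff n) w e) = fun w => (((n : ℝ) + 1)⁻¹ : ℝ) *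
      fderiv ℝ (fun z : Phase d => (unitCutoff d z : ℂ)) (((n : ℝ) + 1)⁻¹ • w) e :=
    funext fun w => fderiv_cutoff_apply n w e
  have hs := isTest_unitCutoff (d := d) |>.smooth.fderiv_apply_const e
  rw [h]
  have hd : DifferentiableAt ℝ (fun w : Phase d => fderiv ℝ
      (fun z : Phase d => (unitCutoff d z : ℂ)) (((n : ℝ) + 1)⁻¹ • w) e) z :=
    (hs.comp (contDiff_const_smul (((n : ℝ) + 1)⁻¹))).differentiableAt' z
  rw [fderiv_const_mul_apply' hd, fderiv_comp_smul_apply hs]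

theorem eventually_norm_lt (z : Phase d) : ∀ᶠ n : ℕ in atTop, ‖z‖ < n + 1 := by
  filter_upwards [eventually_ge_atTop ⌈‖z‖⌉₊] with n hn
  have := Nat.ceil_le.1 hn
  linarith

theorem cutoff_eventuallyEq_one {n : ℕ} {z : Phase d} (hz : ‖z‖ < n + 1) :
    cutoff n =ᶠ[𝓝 z] fun _ => (1 : ℂ) := by
  filter_upwards [(isOpen_lt continuous_norm continuous_const).mem_nhds hz] with w hw
  exact cutoff_eq_one (le_of_lt hw)

theorem fderiv_cutoff_eq_zero {n : ℕ} {z : Phase d} (hz : ‖z‖ < n + 1) :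
    fderiv ℝ (cutoff n) z = 0 := by
  rw [(cutoff_eventuallyEq_one hz).fderiv_eq]; simp

theorem fderiv_fderiv_cutoff_eq_zero {n : ℕ} {z : Phase d} (hz : ‖z‖ < n + 1) (e : Phase d) :
    fderiv ℝ (fun w => fderiv ℝ (cutoff n) w e) z = 0 := by
  have h : (fun w => fderiv ℝ (cutoff n) w e) =ᶠ[𝓝 z] fun _ => (0 : ℂ) := by
    filter_upwards [(isOpen_lt continuous_norm continuous_const).mem_nhds hz] with w hw
    rw [fderiv_cutoff_eq_zero hw]; rfl
  rw [h.fderiv_eq]; simp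

theorem exists_cutoff_bounds (hV : IsConfining V) : ∃ C, 0 ≤ C ∧ ∀ (n : ℕ) (z : Phase d) i,
    ‖fderiv ℝ (cutoff n) z (dir i)‖ ≤ C ∧
    (∀ k, ‖(drift V k z : ℂ) * fderiv ℝ (cutoff n) z (dir i)‖ ≤ C) ∧
    ‖fderiv ℝ (fun w => fderiv ℝ (cutoff n) w (dir i)) z (dir i)‖ ≤ C := by
  obtain ⟨K, hK0, hK⟩ := exists_abs_drift_le hV
  have h1 : ∃ C₁, ∀ i, ∀ z, ‖fderiv ℝ (fun z : Phase d => (unitCutoff d z : ℂ)) z (dir i)‖ ≤ C₁ := by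
    choose C hC using fun i => ((isTest_unitCutoff (d := d)).fderiv_apply
      (dir i)).continuous.bounded_above_of_compact_support (isTest_unitCutoff.fderiv_apply _).compact
    exact ⟨∑ i, |C i|, fun i z => (hC i z).trans ((le_abs_self _).trans
      (Finset.single_le_sum (f := fun i => |C i|) (fun _ _ => abs_nonneg _) (Finset.mem_univ i)))⟩
  have h2 : ∃ C₂, ∀ i, ∀ z, ‖fderiv ℝ (fun w => fderiv ℝ (fun z : Phase d =>
      (unitCutoff d z : ℂ)) w (dir i)) z (dir i)‖ ≤ C₂ := by
    choose C hC using fun i => (((isTest_unitCutoff (d := d)).fderiv_apply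
      (dir i)).fderiv_apply (dir i)).continuous.bounded_above_of_compact_support
        ((isTest_unitCutoff.fderiv_apply _).fderiv_apply _).compact
    exact ⟨∑ i, |C i|, fun i z => (hC i z).trans ((le_abs_self _).trans
      (Finset.single_le_sum (f := fun i => |C i|) (fun _ _ => abs_nonneg _) (Finset.mem_univ i)))⟩
  obtain ⟨C₁, hC₁⟩ := h1
  obtain ⟨C₂, hC₂⟩ := h2
  refine ⟨|C₁| + |C₂| + 3 * K * |C₁|, by positivity, fun n z i => ?_⟩
  set r : ℝ := ((n : ℝ) + 1)⁻¹ with hr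
  have hr0 : 0 ≤ r := by positivity
  have hr1 : r ≤ 1 := inv_le_one_of_one_le₀ (by linarith [n.cast_nonneg (α := ℝ)])
  have hp1 := abs_nonneg C₁
  have hp2 := abs_nonneg C₂
  have hp3 : 0 ≤ 3 * K * |C₁| := by positivity
  have b1 : ‖fderiv ℝ (cutoff n) z (dir i)‖ ≤ r * |C₁| := by
    rw [fderiv_cutoff_apply, norm_mul, Complex.norm_real, Real.norm_of_nonneg hr0]
    exact mul_le_mul_of_nonneg_left ((hC₁ i _).trans (le_abs_self _)) hr0
  refine ⟨?_, fun k => ?_, ?_⟩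
  · nlinarith
  · by_cases hz : 2 * ((n : ℝ) + 1) < ‖z‖
    · have h0 : cutoff n =ᶠ[𝓝 z] fun _ => (0 : ℂ) := by
        filter_upwards [(isOpen_lt continuous_const continuous_norm).mem_nhds hz] with w hw
        exact cutoff_eq_zero (le_of_lt hw)
      rw [h0.fderiv_eq]
      simp
      positivity
    · rw [norm_mul, Complex.norm_real, Real.norm_eq_abs]
      have h3 : |drift V k z| ≤ K * (3 * ((n : ℝ) + 1)) := by
        refine (hK k z).trans (mul_le_mul_of_nonneg_left ?_ hK0)
        have := n.cast_nonneg (α := ℝ)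
        linarith
      calc |drift V k z| * ‖fderiv ℝ (cutoff n) z (dir i)‖
          ≤ (K * (3 * ((n : ℝ) + 1))) * (r * |C₁|) :=
            mul_le_mul h3 b1 (norm_nonneg _) (by positivity)
        _ = 3 * K * |C₁| := by rw [hr]; field_simp
        _ ≤ _ := by linarith
  · rw [fderiv_fderiv_cutoff_apply, norm_mul, norm_mul, Complex.norm_real, Real.norm_of_nonneg hr0]
    have h3 := (hC₂ i (r • z)).trans (le_abs_self _)
    have h4 : r * (r * ‖fderiv ℝ (fun w => fderiv ℝ (fun z : Phase d =>
      (unitCutoff d z : ℂ)) w (dir i)) (r • z) (dir i)‖) ≤ 1 * (1 * |C₂|) := by gcongr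
    linarith

theorem exists_transport_cutoff_bound (hV : IsConfining V) :
    ∃ C, 0 ≤ C ∧ ∀ (n : ℕ) (z : Phase d), ‖transport V (cutoff n) z‖ ≤ C := by
  obtain ⟨C, hC0, hC⟩ := exists_cutoff_bounds hV
  refine ⟨∑ _j : Fin d, (C + C), by positivity, fun n z => ?_⟩
  rw [transport_eq_sum]
  refine (norm_sum_le _ _).trans (Finset.sum_le_sum fun j _ => (norm_sub_le _ _).trans ?_)
  exact add_le_add ((hC n z (.inl j)).2.1 (.inr j)) ((hC n z (.inr j)).2.1 (.inl j))

/-! ### The graphs of the transport and the elliptic operator -/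

/-- The graph of the operator `T` on the test functions, in the representation `f = 𝓜 φ`. -/
def testGraph (V : Pos d → ℝ) (T : (Phase d → ℂ) → Phase d → ℂ)
    (hadd : ∀ φ ψ, IsTest φ → IsTest ψ → ∀ z, T (fun z => φ z + ψ z) z = T φ z + T ψ z)
    (hsmul : ∀ (c : ℂ) φ, IsTest φ → ∀ z, T (fun z => c * φ z) z = c * T φ z) :
    Submodule ℂ (B2 V × B2 V) where
  carrier := {p | ∃ φ, IsTest φ ∧ Represents V p.1 φ ∧ Represents V p.2 (T φ)}
  add_mem' := by
    rintro p q ⟨φ, hφ, h1, h2⟩ ⟨ψ, hψ, h3, h4⟩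
    exact ⟨_, hφ.add hψ, h1.add h3, (h2.add h4).congr fun z => (hadd φ ψ hφ hψ z).symm⟩
  zero_mem' := ⟨_, IsTest.zero, Represents.zero, Represents.zero.congr fun z => by
    have := hsmul 0 _ IsTest.zero z
    simpa using this.symm⟩
  smul_mem' := by
    rintro c p ⟨φ, hφ, h1, h2⟩
    exact ⟨_, hφ.const_mul c, h1.smul c, (h2.smul c).congr fun z => (hsmul c φ hφ z).symm⟩

theorem fderiv_add_apply' {E : Type*} [NormedAddCommGroup E] [NormedSpace ℝ E] {a b : E → ℂ}
    {z : E} (ha : DifferentiableAt ℝ a z) (hb : DifferentiableAt ℝ b z) (e : E) :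
    fderiv ℝ (fun z => a z + b z) z e = fderiv ℝ a z e + fderiv ℝ b z e := by
  rw [fderiv_fun_add ha hb]; rfl

theorem ellipticOp_add {a b : Phase d → ℂ} (ha : ContDiff ℝ ∞ a) (hb : ContDiff ℝ ∞ b)
    (z : Phase d) : ellipticOp V (fun z => a z + b z) z = ellipticOp V a z + ellipticOp V b z := by
  simp only [ellipticOp, ← Finset.sum_add_distrib]
  refine Finset.sum_congr rfl fun i _ => ?_
  have h : (fun w => fderiv ℝ (fun z => a z + b z) w (dir i))
      = fun w => fderiv ℝ a w (dir i) + fderiv ℝ b w (dir i) :=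
    funext fun w => fderiv_add_apply' (ha.differentiableAt' w) (hb.differentiableAt' w) _
  rw [h, fderiv_add_apply' ((ha.fderiv_apply_const _).differentiableAt' z)
    ((hb.fderiv_apply_const _).differentiableAt' z),
    fderiv_add_apply' (ha.differentiableAt' z) (hb.differentiableAt' z)]
  ring

theorem ellipticOp_const_mul {a : Phase d → ℂ} (ha : ContDiff ℝ ∞ a) (c : ℂ) (z : Phase d) :
    ellipticOp V (fun z => c * a z) z = c * ellipticOp V a z := by
  simp only [ellipticOp, Finset.mul_sum]
  refine Finset.sum_congr rfl fun i _ => ?_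
  have h : (fun w => fderiv ℝ (fun z => c * a z) w (dir i)) = fun w => c * fderiv ℝ a w (dir i) :=
    funext fun w => fderiv_const_mul_apply' (ha.differentiableAt' w) _ _
  rw [h, fderiv_const_mul_apply' ((ha.fderiv_apply_const _).differentiableAt' z),
    fderiv_const_mul_apply' (ha.differentiableAt' z)]
  ring

theorem ellipticOp_mul {a b : Phase d → ℂ} (ha : ContDiff ℝ ∞ a) (hb : ContDiff ℝ ∞ b)
    (z : Phase d) : ellipticOp V (fun z => a z * b z) z = a z * ellipticOp V b z
      + ellipticOp V a z * b z - 2 * ∑ i, fderiv ℝ a z (dir i) * fderiv ℝ b z (dir i) := by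
  simp only [ellipticOp, Finset.mul_sum, Finset.sum_mul, ← Finset.sum_add_distrib,
    ← Finset.sum_sub_distrib]
  refine Finset.sum_congr rfl fun i _ => ?_
  have h : (fun w => fderiv ℝ (fun z => a z * b z) w (dir i))
      = fun w => a w * fderiv ℝ b w (dir i) + fderiv ℝ a w (dir i) * b w :=
    funext fun w => fderiv_mul_apply' (ha.differentiableAt' w) (hb.differentiableAt' w) _
  have ha' := ha.fderiv_apply_const (dir i)
  have hb' := hb.fderiv_apply_const (dir i)
  rw [h, fderiv_add_apply' ((ha.mul hb').differentiableAt' z) ((ha'.mul hb).differentiableAt' z),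
    fderiv_mul_apply' (ha.differentiableAt' z) (hb'.differentiableAt' z),
    fderiv_mul_apply' (ha'.differentiableAt' z) (hb.differentiableAt' z),
    fderiv_mul_apply' (ha.differentiableAt' z) (hb.differentiableAt' z)]
  ring

/-- The graph of the transport operator on the test functions. -/
def transportCore (V : Pos d → ℝ) : Submodule ℂ (B2 V × B2 V) :=
  testGraph V (transport V)
    (fun _ _ hφ hψ z => fderiv_add_apply' (hφ.smooth.differentiableAt' z)
      (hψ.smooth.differentiableAt' z) _)
    (fun c _ hφ z => fderiv_const_mul_apply' (hφ.smooth.differentiableAt' z) c _)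

/-- The graph of the closure of the transport operator. -/
def transportGraph (V : Pos d → ℝ) : Submodule ℂ (B2 V × B2 V) :=
  (transportCore V).topologicalClosure

/-- The graph of the elliptic operator on the test functions. -/
def ellipticCore (V : Pos d → ℝ) : Submodule ℂ (B2 V × B2 V) :=
  testGraph V (ellipticOp V) (fun _ _ hφ hψ z => ellipticOp_add hφ.smooth hψ.smooth z)
    (fun c _ hφ z => ellipticOp_const_mul hφ.smooth c z)

/-- The graph of the closure of the elliptic operator. -/
def ellipticGraph (V : Pos d → ℝ) : Submodule ℂ (B2 V × B2 V) :=
  (ellipticCore V).topologicalClosure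

theorem IsTest.tempered {a : Phase d → ℂ} (ha : IsTest a) : IsTempered a :=
  .of_hasCompactSupport ha.continuous ha.compact

/-- Dominated convergence in `B²`. -/
theorem Represents.tendsto (hV : IsConfining V) {e : ℕ → B2 V} {e' : B2 V}
    {a : ℕ → Phase d → ℂ} {a' : Phase d → ℂ} (he : ∀ n, Represents V (e n) (a n))
    (he' : Represents V e' a') (hac : ∀ n, Continuous (a n)) (hac' : Continuous a') {g : Phase d → ℝ}
    (hg : Integrable fun z => maxwellian V z * g z ^ 2)
    (hle : ∀ n z, ‖a n z - a' z‖ ≤ g z) (hlim : ∀ z, Tendsto (fun n => a n z) atTop (𝓝 (a' z))) :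
    Tendsto e atTop (𝓝 e') := by
  rw [tendsto_iff_norm_sub_tendsto_zero]
  have hM := (contDiff_maxwellian hV).continuous
  have h1 : ∀ n, ‖e n - e'‖ = Real.sqrt (∫ z, maxwellian V z * ‖a n z - a' z‖ ^ 2) := fun n => by
    rw [← ((he n).sub he').norm_sq hV, Real.sqrt_sq (norm_nonneg _)]
  simp_rw [h1]
  have h2 : Tendsto (fun n => ∫ z, maxwellian V z * ‖a n z - a' z‖ ^ 2) atTop
      (𝓝 (∫ _ : Phase d, (0 : ℝ))) := by
    refine tendsto_integral_of_dominated_convergence (fun z => maxwellian V z * g z ^ 2)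
      (fun n => ?_) hg (fun n => Eventually.of_forall fun z => ?_)
      (Eventually.of_forall fun z => ?_)
    · exact (hM.mul (((hac n).sub hac').norm.pow 2)).aestronglyMeasurable
    · have h0 := maxwellian_nonneg V z
      rw [Real.norm_of_nonneg (by positivity)]
      gcongr
      exact hle n z
    · have := (tendsto_iff_norm_sub_tendsto_zero.1 (hlim z))
      simpa using (this.pow 2).const_mul (maxwellian V z)
  rw [integral_zero] at h2
  simpa [Function.comp_def] using (Real.continuous_sqrt.tendsto 0).comp h2

theorem Represents.integrable_normSq (hV : IsConfining V) {e : B2 V} {a : Phase d → ℂ}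
    (he : Represents V e a) : Integrable fun z => maxwellian V z * ‖a z‖ ^ 2 := by
  have h1 := (he.integrable_conj_mul hV e).re
  have h : ∀ᵐ z ∂(volume : Measure (Phase d)), e z = (maxwellian V z : ℂ) * a z := by
    rw [← ae_weight hV]; exact he
  refine h1.congr ?_
  filter_upwards [h] with z hz
  rw [hz]
  have : starRingEnd ℂ (a z) * ((maxwellian V z : ℂ) * a z)
      = ((maxwellian V z * ‖a z‖ ^ 2 : ℝ) : ℂ) := by
    rw [mul_left_comm, ← Complex.normSq_eq_conj_mul_self, Complex.normSq_eq_norm_sq,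
      ← Complex.ofReal_mul]
  rw [this]; rfl

theorem integrable_mul_sq_add {M : Phase d → ℝ} (hM : ∀ z, 0 ≤ M z) (hMc : Continuous M)
    {f g : Phase d → ℝ} (hfc : Continuous f) (hgc : Continuous g)
    (hf : Integrable fun z => M z * f z ^ 2) (hg : Integrable fun z => M z * g z ^ 2) :
    Integrable fun z => M z * (f z + g z) ^ 2 := by
  refine ((hf.const_mul 2).add (hg.const_mul 2)).mono'
    (Continuous.aestronglyMeasurable (by fun_prop)) (Eventually.of_forall fun z => ?_)
  rw [Real.norm_of_nonneg (mul_nonneg (hM z) (sq_nonneg _))]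
  simp only [Pi.add_apply]
  nlinarith [mul_nonneg (hM z) (sq_nonneg (f z - g z))]

theorem mem_transportGraph (hV : IsConfining V) {a : Phase d → ℂ} (ha : ContDiff ℝ ∞ a)
    {p : B2 V × B2 V} (h1 : Represents V p.1 a) (h2 : Represents V p.2 (transport V a)) :
    p ∈ transportGraph V := by
  obtain ⟨C, hC0, hC⟩ := exists_transport_cutoff_bound hV
  have hMc := (contDiff_maxwellian hV).continuous
  have ht : ∀ n, IsTest fun z => cutoff n z * a z := fun n => (isTest_cutoff n).mul_right ha
  choose e he using fun n => (ht n).tempered.exists_represents hV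
  choose e' he' using fun n => ((ht n).transport hV).tempered.exists_represents hV
  have hsub : ∀ (n : ℕ) (z : Phase d) (b : ℂ), ‖cutoff n z * b - b‖ ≤ 2 * ‖b‖ := fun n z b => by
    have := norm_sub_le (cutoff n z * b) b
    rw [norm_mul] at this
    nlinarith [norm_cutoff_le n z, norm_nonneg b]
  have hev : ∀ z : Phase d, ∀ᶠ n : ℕ in atTop, cutoff n z = 1 ∧ fderiv ℝ (cutoff n) z = 0 := fun z => by
    filter_upwards [eventually_norm_lt z] with n hn
    exact ⟨cutoff_eq_one hn.le, fderiv_cutoff_eq_zero hn⟩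
  have i1 := h1.integrable_normSq hV
  have i2 := h2.integrable_normSq hV
  have c2 := (contDiff_transport hV ha).continuous
  have t1 : Tendsto e atTop (𝓝 p.1) := by
    refine Represents.tendsto hV he h1 (fun n => (ht n).continuous) ha.continuous
      (g := fun z => 2 * ‖a z‖) ?_ (fun n z => hsub n z _) fun z => ?_
    · refine (i1.const_mul 4).congr (Eventually.of_forall fun z => ?_)
      simp only; ring
    · refine tendsto_const_nhds.congr' ?_
      filter_upwards [hev z] with n hn
      rw [hn.1, one_mul]
  have t2 : Tendsto e' atTop (𝓝 p.2) := by
    refine Represents.tendsto hV he' h2 (fun n => ((ht n).transport hV).continuous)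
      (contDiff_transport hV ha).continuous
      (g := fun z => 2 * ‖transport V a z‖ + C * ‖a z‖) ?_ (fun n z => ?_) fun z => ?_
    · refine integrable_mul_sq_add (maxwellian_nonneg V) hMc (by fun_prop)
        (continuous_const.mul ha.continuous.norm) ?_ ?_
      · refine (i2.const_mul 4).congr (Eventually.of_forall fun z => ?_)
        simp only; ring
      · refine (i1.const_mul (C ^ 2)).congr (Eventually.of_forall fun z => ?_)
        simp only; ring
    · rw [transport_mul (isTest_cutoff n).smooth ha, add_sub_right_comm]
      refine (norm_add_le _ _).trans (add_le_add (hsub n z _) ?_)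
      rw [norm_mul]
      gcongr
      exact hC n z
    · refine tendsto_const_nhds.congr' ?_
      filter_upwards [hev z] with n hn
      rw [transport_mul (isTest_cutoff n).smooth ha, hn.1, transport, transport, hn.2]
      simp
  exact mem_closure_of_tendsto (t1.prodMk_nhds t2)
    (Eventually.of_forall fun n => ⟨_, ht n, he n, he' n⟩)

theorem mem_ellipticGraph (hV : IsConfining V) {a : Phase d → ℂ} (ha : ContDiff ℝ ∞ a)
    {p : B2 V × B2 V} (h1 : Represents V p.1 a) (h2 : Represents V p.2 (ellipticOp V a))
    (h3 : ∀ i, ∃ e : B2 V, Represents V e fun z => fderiv ℝ a z (dir i)) :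
    p ∈ ellipticGraph V := by
  obtain ⟨C, hC0, hC⟩ := exists_cutoff_bounds hV
  have hMc := (contDiff_maxwellian hV).continuous
  have ht : ∀ n, IsTest fun z => cutoff n z * a z := fun n => (isTest_cutoff n).mul_right ha
  choose e he using fun n => (ht n).tempered.exists_represents hV
  choose e' he' using fun n => ((ht n).ellipticOp hV).tempered.exists_represents hV
  have hsub : ∀ (n : ℕ) (z : Phase d) (b : ℂ), ‖cutoff n z * b - b‖ ≤ 2 * ‖b‖ := fun n z b => by
    have := norm_sub_le (cutoff n z * b) b
    rw [norm_mul] at this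
    nlinarith [norm_cutoff_le n z, norm_nonneg b]
  have i1 := h1.integrable_normSq hV
  have i2 := h2.integrable_normSq hV
  have c2 := (contDiff_ellipticOp hV ha).continuous
  have c3 : ∀ i, Continuous fun z => fderiv ℝ a z (dir i) := fun i =>
    (ha.fderiv_apply_const _).continuous
  have t1 : Tendsto e atTop (𝓝 p.1) := by
    refine Represents.tendsto hV he h1 (fun n => (ht n).continuous) ha.continuous
      (g := fun z => 2 * ‖a z‖) ?_ (fun n z => hsub n z _) fun z => ?_
    · refine (i1.const_mul 4).congr (Eventually.of_forall fun z => ?_)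
      simp only; ring
    · refine tendsto_const_nhds.congr' ?_
      filter_upwards [eventually_norm_lt z] with n hn
      rw [cutoff_eq_one hn.le, one_mul]
  have hgrad : ∀ s : Finset (Fin d ⊕ Fin d), Integrable fun z => maxwellian V z *
      (∑ i ∈ s, 2 * C * ‖fderiv ℝ a z (dir i)‖) ^ 2 := by
    classical
    intro s
    induction s using Finset.induction_on with
    | empty => simp
    | insert i s hi ih =>
      simp_rw [Finset.sum_insert hi]
      refine integrable_mul_sq_add (maxwellian_nonneg V) hMc
        (continuous_const.mul (c3 i).norm)
        (continuous_finsetSum _ fun j _ => continuous_const.mul (c3 j).norm) ?_ ih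
      obtain ⟨b, hb⟩ := h3 i
      refine ((hb.integrable_normSq hV).const_mul ((2 * C) ^ 2)).congr
        (Eventually.of_forall fun z => ?_)
      simp only; ring
  set C' : ℝ := ∑ _i : Fin d ⊕ Fin d, (C + C) with hC'
  have t2 : Tendsto e' atTop (𝓝 p.2) := by
    refine Represents.tendsto hV he' h2 (fun n => ((ht n).ellipticOp hV).continuous)
      (contDiff_ellipticOp hV ha).continuous
      (g := fun z => 2 * ‖ellipticOp V a z‖ + C' * ‖a z‖
        + ∑ i, 2 * C * ‖fderiv ℝ a z (dir i)‖) ?_ (fun n z => ?_) fun z => ?_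
    · have hac := ha.continuous
      refine integrable_mul_sq_add (maxwellian_nonneg V) hMc (by fun_prop)
        (continuous_finsetSum _ fun j _ => continuous_const.mul (c3 j).norm) ?_ (hgrad _)
      refine integrable_mul_sq_add (maxwellian_nonneg V) hMc (by fun_prop) (by fun_prop) ?_ ?_
      · refine (i2.const_mul 4).congr (Eventually.of_forall fun z => ?_)
        simp only; ring
      · refine (i1.const_mul (C' ^ 2)).congr (Eventually.of_forall fun z => ?_)
        simp only; ring
    · rw [ellipticOp_mul (isTest_cutoff n).smooth ha]
      have e1 : cutoff n z * ellipticOp V a z + ellipticOp V (cutoff n) z * a z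
          - 2 * ∑ i, fderiv ℝ (cutoff n) z (dir i) * fderiv ℝ a z (dir i) - ellipticOp V a z
          = (cutoff n z * ellipticOp V a z - ellipticOp V a z)
            + ellipticOp V (cutoff n) z * a z
            - ∑ i, 2 * (fderiv ℝ (cutoff n) z (dir i) * fderiv ℝ a z (dir i)) := by
        rw [Finset.mul_sum]; ring
      rw [e1]
      refine (norm_sub_le _ _).trans (add_le_add ((norm_add_le _ _).trans
        (add_le_add (hsub n z _) ?_)) ?_)
      · rw [norm_mul]
        gcongr
        rw [ellipticOp]
        exact (norm_sum_le _ _).trans (Finset.sum_le_sum fun i _ => (norm_sub_le _ _).trans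
          (add_le_add ((hC n z i).2.1 i) (hC n z i).2.2))
      · refine (norm_sum_le _ _).trans (Finset.sum_le_sum fun i _ => ?_)
        rw [norm_mul, norm_mul, mul_assoc]
        simp only [Complex.norm_ofNat]
        gcongr
        exact (hC n z i).1
    · refine tendsto_const_nhds.congr' ?_
      filter_upwards [eventually_norm_lt z] with n hn
      rw [ellipticOp_mul (isTest_cutoff n).smooth ha, cutoff_eq_one hn.le,
        fderiv_cutoff_eq_zero hn]
      have : ellipticOp V (cutoff n) z = 0 := by
        simp [ellipticOp, fderiv_cutoff_eq_zero hn, fderiv_fderiv_cutoff_eq_zero hn]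
      rw [this]
      simp
  exact mem_closure_of_tendsto (t1.prodMk_nhds t2)
    (Eventually.of_forall fun n => ⟨_, ht n, he n, he' n⟩)

end RelaxationBoltzmann

end

open MeasureTheory Filter Topology
open scoped ContDiff Gradient NNReal

noncomputable section

namespace RelaxationBoltzmann

/-! ### Approximate solutions of `λ u - F · ∇u = φ` -/

section Resolvent

variable {E : Type*} [NormedAddCommGroup E] [NormedSpace ℝ E]

/-- `u` is smooth, with explicit bounds on `u`, `Du` and the Lipschitz constant of `Du`. -/
structure HasC11Bound (C K b : ℝ) (u : E → ℂ) : Prop where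
  smooth : ContDiff ℝ ∞ u
  norm_le : ∀ z, ‖u z‖ ≤ C
  norm_fderiv_le : ∀ z, ‖fderiv ℝ u z‖ ≤ K
  lipschitz : ∀ z w, ‖fderiv ℝ u z - fderiv ℝ u w‖ ≤ b * ‖z - w‖

theorem HasC11Bound.taylor {C K b : ℝ} {u : E → ℂ} (hu : HasC11Bound C K b u) (hb : 0 ≤ b)
    (z w : E) : ‖u (z + w) - u z - fderiv ℝ u z w‖ ≤ b * ‖w‖ ^ 2 := by
  have h := Convex.norm_image_sub_le_of_norm_fderiv_le' (𝕜 := ℝ) (f := u) (φ := fderiv ℝ u z)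
    (s := Metric.closedBall z ‖w‖) (C := b * ‖w‖) (x := z) (y := z + w)
    (fun y _ => hu.smooth.differentiableAt' y)
    (fun y hy => (hu.lipschitz y z).trans (by
      gcongr; simpa [dist_eq_norm] using hy)) (convex_closedBall _ _)
    (Metric.mem_closedBall_self (norm_nonneg _)) (by simp)
  simp only [add_sub_cancel_left] at h
  calc _ ≤ b * ‖w‖ * ‖w‖ := h
    _ = _ := by ring

theorem HasC11Bound.step {F : E → E} (hF : ContDiff ℝ ∞ F) {ℓ L : ℝ}
    (hF1 : ∀ z, ‖fderiv ℝ F z‖ ≤ ℓ) (hF2 : ∀ z w, ‖fderiv ℝ F z - fderiv ℝ F w‖ ≤ L * ‖z - w‖)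
    (hℓ : 0 ≤ ℓ) (hL : 0 ≤ L) {C K : ℝ} (hC : 0 ≤ C) (hK : 0 ≤ K) {φ u : E → ℂ}
    (hφ : HasC11Bound C K K φ) (hu : HasC11Bound C K (K + K * L) u) {l h : ℝ}
    (hl : 2 * ℓ + ℓ ^ 2 + 1 ≤ l) (h0 : 0 < h) (h1 : h ≤ 1) :
    HasC11Bound C K (K + K * L)
      fun z => ((1 + l * h)⁻¹ : ℝ) * ((h : ℂ) * φ z + u (z + h • F z)) := by
  have hT : ContDiff ℝ ∞ fun z => z + h • F z := contDiff_id.add (hF.const_smul h)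
  have hDT : ∀ z, HasFDerivAt (fun z => z + h • F z)
      (ContinuousLinearMap.id ℝ E + h • fderiv ℝ F z) z := fun z =>
    (hasFDerivAt_id z).add ((hF.differentiableAt' z).hasFDerivAt.const_smul h)
  have hnDT : ∀ z, ‖ContinuousLinearMap.id ℝ E + h • fderiv ℝ F z‖ ≤ 1 + h * ℓ := fun z => by
    refine (norm_add_le _ _).trans (add_le_add ContinuousLinearMap.norm_id_le ?_)
    rw [norm_smul, Real.norm_of_nonneg h0.le]
    exact mul_le_mul_of_nonneg_left (hF1 z) h0.le
  have hlip : ∀ z w, ‖z + h • F z - (w + h • F w)‖ ≤ (1 + h * ℓ) * ‖z - w‖ := fun z w =>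
    Convex.norm_image_sub_le_of_norm_hasFDerivWithin_le (𝕜 := ℝ) (s := Set.univ)
      (fun x _ => (hDT x).hasFDerivWithinAt) (fun x _ => hnDT x) convex_univ trivial trivial
  have hl0 : 0 < 1 + l * h := by nlinarith [sq_nonneg ℓ]
  have hr0 : 0 ≤ (1 + l * h)⁻¹ := by positivity
  have hD : ∀ z, fderiv ℝ (fun z => ((1 + l * h)⁻¹ : ℝ) * ((h : ℂ) * φ z + u (z + h • F z))) z
      = (1 + l * h)⁻¹ • (h • fderiv ℝ φ z + (fderiv ℝ u (z + h • F z)).comp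
        (ContinuousLinearMap.id ℝ E + h • fderiv ℝ F z)) := fun z => by
    have e1 : (fun z => (((1 + l * h)⁻¹ : ℝ) : ℂ) * ((h : ℂ) * φ z + u (z + h • F z)))
        = fun z => (1 + l * h)⁻¹ • (h • φ z + u (z + h • F z)) := by
      funext z; simp only [Complex.real_smul]
    rw [e1]
    have e2 := ((hu.smooth.differentiableAt' (z + h • F z)).hasFDerivAt.comp z (hDT z))
    exact ((((hφ.smooth.differentiableAt' z).hasFDerivAt.const_smul h).add e2).const_smul
      ((1 + l * h)⁻¹)).fderiv
  refine ⟨?_, fun z => ?_, fun z => ?_, fun z w => ?_⟩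
  · exact contDiff_const.mul ((contDiff_const.mul hφ.smooth).add (hu.smooth.comp hT))
  · rw [norm_mul, Complex.norm_real, Real.norm_of_nonneg hr0, inv_mul_le_iff₀ hl0]
    refine (norm_add_le _ _).trans ?_
    rw [norm_mul, Complex.norm_real, Real.norm_of_nonneg h0.le]
    have a1 := hφ.norm_le z
    have a2 := hu.norm_le (z + h • F z)
    have a3 : h * ‖φ z‖ ≤ h * C := by gcongr
    have a4 : h * C * 1 ≤ h * C * l :=
      mul_le_mul_of_nonneg_left (by nlinarith [sq_nonneg ℓ]) (by positivity)
    linarith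
  · rw [hD, norm_smul, Real.norm_of_nonneg hr0, inv_mul_le_iff₀ hl0]
    refine (norm_add_le _ _).trans ?_
    rw [norm_smul, Real.norm_of_nonneg h0.le]
    have a1 : h * ‖fderiv ℝ φ z‖ ≤ h * K := by gcongr; exact hφ.norm_fderiv_le z
    have a2 := (ContinuousLinearMap.opNorm_comp_le (fderiv ℝ u (z + h • F z))
      (ContinuousLinearMap.id ℝ E + h • fderiv ℝ F z)).trans
      (mul_le_mul (hu.norm_fderiv_le _) (hnDT z) (norm_nonneg _) hK)
    have a3 : h * K * (ℓ + 1) ≤ h * K * l :=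
      mul_le_mul_of_nonneg_left (by nlinarith [sq_nonneg ℓ]) (by positivity)
    linarith
  · have e0 : ∀ (r : ℝ) (A B : E →L[ℝ] ℂ), 0 ≤ r → ‖r • A - r • B‖ = r * ‖A - B‖ :=
      fun r A B hr => by
        have : r • A - r • B = r • (A - B) := by ext v; simp; ring
        rw [this, norm_smul, Real.norm_of_nonneg hr]
    rw [hD, hD, e0 _ _ _ hr0, mul_comm, ← div_eq_mul_inv, div_le_iff₀ hl0]
    set A := fderiv ℝ u (z + h • F z)
    set A' := fderiv ℝ u (w + h • F w)
    set D := ContinuousLinearMap.id ℝ E + h • fderiv ℝ F z with hDdef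
    set D' := ContinuousLinearMap.id ℝ E + h • fderiv ℝ F w with hDdef'
    have e1 : h • fderiv ℝ φ z + A.comp D - (h • fderiv ℝ φ w + A'.comp D')
        = h • (fderiv ℝ φ z - fderiv ℝ φ w) + ((A - A').comp D + A'.comp (D - D')) := by
      ext v; simp; ring
    rw [e1]
    have b1 : ‖h • (fderiv ℝ φ z - fderiv ℝ φ w)‖ ≤ h * (K * ‖z - w‖) := by
      rw [norm_smul, Real.norm_of_nonneg h0.le]
      exact mul_le_mul_of_nonneg_left (hφ.lipschitz z w) h0.le
    have b2 : ‖(A - A').comp D‖ ≤ ((K + K * L) * ((1 + h * ℓ) * ‖z - w‖)) * (1 + h * ℓ) :=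
      (ContinuousLinearMap.opNorm_comp_le _ _).trans (mul_le_mul
        ((hu.lipschitz _ _).trans (mul_le_mul_of_nonneg_left (hlip z w) (by positivity)))
        (hnDT z) (norm_nonneg _) (by positivity))
    have b3 : ‖A'.comp (D - D')‖ ≤ K * (h * (L * ‖z - w‖)) := by
      refine (ContinuousLinearMap.opNorm_comp_le _ _).trans (mul_le_mul (hu.norm_fderiv_le _) ?_
        (norm_nonneg _) hK)
      rw [hDdef, hDdef', add_sub_add_left_eq_sub, ← smul_sub, norm_smul, Real.norm_of_nonneg h0.le]
      exact mul_le_mul_of_nonneg_left (hF2 z w) h0.le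
    have b4 := (norm_add_le (h • (fderiv ℝ φ z - fderiv ℝ φ w))
      ((A - A').comp D + A'.comp (D - D'))).trans (add_le_add_right (norm_add_le _ _) _)
    refine b4.trans ((add_le_add b1 (add_le_add b2 b3)).trans ?_)
    have hB : 0 ≤ (K + K * L) * ‖z - w‖ := by positivity
    have c1 : h * (K * ‖z - w‖) + (((K + K * L) * ((1 + h * ℓ) * ‖z - w‖)) * (1 + h * ℓ)
        + K * (h * (L * ‖z - w‖))) = ((K + K * L) * ‖z - w‖) * (h + (1 + h * ℓ) ^ 2) := by ring
    rw [c1]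
    refine mul_le_mul_of_nonneg_left ?_ hB
    have c2 : h * (2 * ℓ + ℓ ^ 2 + 1) ≤ h * l := mul_le_mul_of_nonneg_left hl h0.le
    have c3 : h * (h * ℓ ^ 2) ≤ h * (1 * ℓ ^ 2) := by gcongr
    nlinarith

/-- Approximate solutions of `l u - F · ∇u = φ`, bounded independently of the accuracy. -/
theorem exists_approx_resolvent {F : E → E} (hF : ContDiff ℝ ∞ F) {ℓ L : ℝ}
    (hF1 : ∀ z, ‖fderiv ℝ F z‖ ≤ ℓ) (hF2 : ∀ z w, ‖fderiv ℝ F z - fderiv ℝ F w‖ ≤ L * ‖z - w‖)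
    (hℓ : 0 ≤ ℓ) (hL : 0 ≤ L) {C K : ℝ} (hC : 0 ≤ C) (hK : 0 ≤ K) {φ : E → ℂ}
    (hφ : HasC11Bound C K K φ) {l : ℝ} (hl : 2 * ℓ + ℓ ^ 2 + 1 ≤ l) (ρ : ℝ) {ε : ℝ}
    (hε : 0 < ε) : ∃ u : E → ℂ, ContDiff ℝ ∞ u ∧ (∀ z, ‖u z‖ ≤ C) ∧
      ∀ z, ‖z‖ ≤ ρ → ‖(l : ℂ) * u z - fderiv ℝ u z (F z) - φ z‖ ≤ ε := by
  have hl1 : 1 ≤ l := by nlinarith [sq_nonneg ℓ]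
  set b : ℝ := K + K * L with hb
  have hb0 : 0 ≤ b := by positivity
  -- a bound for `F` on the ball
  have hFb : ∀ z, ‖z‖ ≤ ρ → ‖F z‖ ≤ ‖F 0‖ + ℓ * |ρ| := fun z hz => by
    have h := Convex.norm_image_sub_le_of_norm_fderiv_le (𝕜 := ℝ) (f := F) (C := ℓ)
      (s := Set.univ) (x := 0) (y := z) (fun y _ => hF.differentiableAt' y) (fun y _ => hF1 y)
      convex_univ trivial trivial
    have h2 : ‖F z‖ ≤ ‖F z - F 0‖ + ‖F 0‖ := by simpa using norm_add_le (F z - F 0) (F 0)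
    rw [sub_zero] at h
    have h3 : ℓ * ‖z‖ ≤ ℓ * |ρ| := by gcongr; exact hz.trans (le_abs_self _)
    linarith
  set B : ℝ := ‖F 0‖ + ℓ * |ρ| with hB
  have hB0 : 0 ≤ B := by positivity
  obtain ⟨h, h0, h1, hh⟩ : ∃ h : ℝ, 0 < h ∧ h ≤ 1 ∧ b * h * B ^ 2 ≤ ε / 2 := by
    refine ⟨min 1 (ε / 2 / (b * B ^ 2 + 1)), by positivity, min_le_left _ _, ?_⟩
    have hp : 0 ≤ b * B ^ 2 := by positivity
    have h2 := min_le_right 1 (ε / 2 / (b * B ^ 2 + 1))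
    calc b * min 1 (ε / 2 / (b * B ^ 2 + 1)) * B ^ 2
        = (b * B ^ 2) * min 1 (ε / 2 / (b * B ^ 2 + 1)) := by ring
      _ ≤ (b * B ^ 2 + 1) * (ε / 2 / (b * B ^ 2 + 1)) := by gcongr; linarith
      _ = ε / 2 := by field_simp
  have hl0 : 0 < 1 + l * h := by positivity
  set q : ℝ := (1 + l * h)⁻¹ with hq
  have hq0 : 0 ≤ q := by positivity
  have hq1 : q < 1 := inv_lt_one_of_one_lt₀ (by nlinarith)
  let step : (E → ℂ) → E → ℂ := fun u z => (q : ℂ) * ((h : ℂ) * φ z + u (z + h • F z))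
  let u : ℕ → E → ℂ := fun n => step^[n] fun _ => 0
  have hsucc : ∀ n, u (n + 1) = step (u n) := fun n => Function.iterate_succ_apply' _ _ _
  have hu : ∀ n, HasC11Bound C K b (u n) := fun n => by
    induction n with
    | zero =>
      refine ⟨contDiff_const, fun z => ?_, fun z => ?_, fun z w => ?_⟩
      · simpa [u] using hC
      · simpa [u] using hK
      · simp only [u, Function.iterate_zero, id, fderiv_fun_const, Pi.zero_apply, sub_self,
          norm_zero]
        positivity
    | succ n ih =>
      rw [hsucc]
      exact HasC11Bound.step hF hF1 hF2 hℓ hL hC hK hφ ih hl h0 h1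
  have hdiff : ∀ n z, ‖u (n + 1) z - u n z‖ ≤ q ^ n * C := fun n => by
    induction n with
    | zero => intro z; simpa [u] using (hu 1).norm_le z
    | succ n ih =>
      intro z
      have e1 : u (n + 1 + 1) z - u (n + 1) z
          = (q : ℂ) * (u (n + 1) (z + h • F z) - u n (z + h • F z)) := by
        rw [hsucc (n + 1)]
        nth_rw 2 [hsucc n]
        simp only [step]
        ring
      rw [e1, norm_mul, Complex.norm_real, Real.norm_of_nonneg hq0, pow_succ', mul_assoc]
      exact mul_le_mul_of_nonneg_left (ih _) hq0
  obtain ⟨n, hn⟩ : ∃ n : ℕ, (1 + l * h) / h * (q ^ n * C) ≤ ε / 2 := by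
    have ht : Tendsto (fun n : ℕ => (1 + l * h) / h * (q ^ n * C)) atTop (𝓝 0) := by
      simpa using ((tendsto_pow_atTop_nhds_zero_of_lt_one hq0 hq1).mul_const C).const_mul
        ((1 + l * h) / h)
    exact ((ht.eventually (gt_mem_nhds (by positivity : 0 < ε / 2))).exists).imp fun _ h => h.le
  refine ⟨u n, (hu n).smooth, (hu n).norm_le, fun z hz => ?_⟩
  have hh0 : (h : ℂ) ≠ 0 := by exact_mod_cast h0.ne'
  have hl0' : (1 + l * h : ℂ) ≠ 0 := by exact_mod_cast hl0.ne'
  have hs : (1 + l * h : ℂ) * u (n + 1) z = h * φ z + u n (z + h • F z) := by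
    rw [hsucc]
    simp only [step, hq]
    push_cast
    rw [mul_inv_cancel_left₀ hl0']
  have key : (l : ℂ) * u n z - fderiv ℝ (u n) z (F z) - φ z
      = -((((1 + l * h) / h : ℝ) : ℂ) * (u (n + 1) z - u n z))
        + ((h⁻¹ : ℝ) : ℂ) * (u n (z + h • F z) - u n z - fderiv ℝ (u n) z (h • F z)) := by
    rw [map_smul, Complex.real_smul]
    push_cast
    field_simp
    linear_combination hs
  rw [key]
  refine (norm_add_le _ _).trans ?_
  rw [norm_neg, norm_mul, norm_mul, Complex.norm_real, Complex.norm_real,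
    Real.norm_of_nonneg (by positivity), Real.norm_of_nonneg (by positivity)]
  have t1 : (1 + l * h) / h * ‖u (n + 1) z - u n z‖ ≤ ε / 2 :=
    (mul_le_mul_of_nonneg_left (hdiff n z) (by positivity)).trans hn
  have t2 : h⁻¹ * ‖u n (z + h • F z) - u n z - fderiv ℝ (u n) z (h • F z)‖ ≤ ε / 2 := by
    refine (mul_le_mul_of_nonneg_left ((hu n).taylor hb0 z (h • F z)) (by positivity)).trans ?_
    rw [norm_smul, Real.norm_of_nonneg h0.le]
    have := hFb z hz
    calc h⁻¹ * (b * (h * ‖F z‖) ^ 2) = b * h * ‖F z‖ ^ 2 := by field_simp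
      _ ≤ b * h * B ^ 2 := by gcongr
      _ ≤ ε / 2 := hh
  linarith

theorem IsTest.exists_hasC11Bound {φ : E → ℂ} (hφ : IsTest φ) :
    ∃ C K, 0 ≤ C ∧ 0 ≤ K ∧ HasC11Bound C K K φ := by
  obtain ⟨C, hC⟩ := hφ.continuous.bounded_above_of_compact_support hφ.compact
  have hs1 : ContDiff ℝ ∞ (fderiv ℝ φ) := hφ.smooth.fderiv_right (m := ∞) (by norm_cast)
  obtain ⟨K, hK⟩ := hs1.continuous.bounded_above_of_compact_support (hφ.compact.fderiv ℝ)
  obtain ⟨K', hK'⟩ := (hs1.continuous_fderiv (by simp)).bounded_above_of_compact_support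
    ((hφ.compact.fderiv ℝ).fderiv ℝ)
  refine ⟨C, max K K', (norm_nonneg _).trans (hC 0),
    ((norm_nonneg _).trans (hK 0)).trans (le_max_left _ _), hφ.smooth, hC,
    fun z => (hK z).trans (le_max_left _ _), fun z w => ?_⟩
  refine (Convex.norm_image_sub_le_of_norm_fderiv_le (𝕜 := ℝ) (s := Set.univ)
    (fun y _ => hs1.differentiableAt' y) (fun y _ => hK' y) convex_univ trivial trivial).trans ?_
  gcongr
  exact le_max_right _ _

end Resolvent

variable {d : ℕ} {V : Pos d → ℝ}

/-! ### The transport operator is skew-adjoint -/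

theorem exists_fderiv_transportField_bounds (hV : IsConfining V) (s : ℝ) (hs : |s| = 1) :
    ∃ ℓ L, 0 ≤ ℓ ∧ 0 ≤ L ∧
      (∀ z : Phase d, ‖fderiv ℝ (fun z : Phase d => s • ((z.2, -∇ V z.1) : Phase d)) z‖ ≤ ℓ) ∧
      ∀ z w : Phase d, ‖fderiv ℝ (fun z : Phase d => s • ((z.2, -∇ V z.1) : Phase d)) z
        - fderiv ℝ (fun z : Phase d => s • ((z.2, -∇ V z.1) : Phase d)) w‖ ≤ L * ‖z - w‖ := by
  obtain ⟨C₂, hC₂⟩ := hV.bounded 2 le_rfl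
  obtain ⟨C₃, hC₃⟩ := hV.bounded 3 (by norm_num)
  have h20 : 0 ≤ C₂ := (norm_nonneg _).trans (hC₂ 0)
  have h30 : 0 ≤ C₃ := (norm_nonneg _).trans (hC₃ 0)
  have hg : ∀ x, HasFDerivAt (∇ V) ((InnerProductSpace.toDual ℝ (Pos d)).symm.toContinuousLinearEquiv.toContinuousLinearMap.comp
      (fderiv ℝ (fderiv ℝ V) x)) x := fun x => by
    exact ((InnerProductSpace.toDual ℝ (Pos d)).symm.toContinuousLinearEquiv.toContinuousLinearMap.hasFDerivAt).comp
      x ((hV.smooth.fderiv_right (m := ∞) (by norm_cast)).differentiableAt' x).hasFDerivAt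
  have hD : ∀ z w : Phase d, fderiv ℝ (fun z : Phase d => s • ((z.2, -∇ V z.1) : Phase d)) z w
      = s • ((w.2, -(InnerProductSpace.toDual ℝ (Pos d)).symm (fderiv ℝ (fderiv ℝ V) z.1 w.1)) : Phase d) :=
    fun z w => by
    have h := ((hasFDerivAt_snd (𝕜 := ℝ) (p := z)).prodMk
      ((hg z.1).comp z (hasFDerivAt_fst (𝕜 := ℝ) (p := z))).neg).const_smul s
    exact DFunLike.congr_fun h.fderiv w
  refine ⟨1 + C₂, C₃, by positivity, h30, fun z => ?_, fun z w => ?_⟩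
  · refine ContinuousLinearMap.opNorm_le_bound _ (by positivity) fun w => ?_
    rw [hD, norm_smul, Real.norm_eq_abs, hs, one_mul, Prod.norm_def, norm_neg,
      LinearIsometryEquiv.norm_map]
    refine max_le ?_ ?_
    · exact (norm_snd_le w).trans (by nlinarith [norm_nonneg w])
    · refine (ContinuousLinearMap.le_opNorm _ _).trans ?_
      rw [norm_fderiv_fderiv_eq]
      exact mul_le_mul ((hC₂ _).trans (by linarith)) (norm_fst_le w) (norm_nonneg _) (by positivity)
  · refine ContinuousLinearMap.opNorm_le_bound _ (by positivity) fun y => ?_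
    rw [sub_apply, hD, hD, ← smul_sub, norm_smul, Real.norm_eq_abs, hs, one_mul,
      Prod.mk_sub_mk, sub_self, Prod.norm_def, norm_zero, max_eq_right (norm_nonneg _),
      neg_sub_neg, ← map_sub, LinearIsometryEquiv.norm_map, ← sub_apply]
    refine (ContinuousLinearMap.le_opNorm _ _).trans ?_
    refine mul_le_mul ?_ (norm_fst_le y) (norm_nonneg _) (by positivity)
    refine (norm_fderiv_fderiv_sub_le hV.smooth hC₃ _ _).trans ?_
    gcongr
    rw [norm_sub_rev]
    exact norm_fst_le (z - w)

theorem locallyIntegrable_B2 (hV : IsConfining V) (f : B2 V) :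
    LocallyIntegrable f (volume : Measure (Phase d)) := by
  rw [locallyIntegrable_iff]
  intro K hK
  obtain ⟨r, hr⟩ := hK.isBounded.exists_norm_le
  obtain ⟨n, hn⟩ := exists_nat_ge r
  obtain ⟨e, he⟩ := (isTest_cutoff n).tempered.exists_represents hV
  refine ((he.integrable_conj_mul hV f).integrableOn (s := K)).congr ?_
  refine (ae_restrict_iff' hK.measurableSet).2 (Eventually.of_forall fun z hz => ?_)
  simp only
  rw [cutoff_eq_one ((hr z hz).trans (by linarith))]
  simp

/-- The elements of `B²` of the form `𝓜 φ` with a test function `φ`. -/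
def testSpace (V : Pos d → ℝ) : Submodule ℂ (B2 V) where
  carrier := {e | ∃ φ, IsTest φ ∧ Represents V e φ}
  add_mem' := by
    rintro e f ⟨φ, hφ, h1⟩ ⟨ψ, hψ, h2⟩
    exact ⟨_, hφ.add hψ, h1.add h2⟩
  zero_mem' := ⟨_, IsTest.zero, Represents.zero⟩
  smul_mem' := by
    rintro c e ⟨φ, hφ, h1⟩
    exact ⟨_, hφ.const_mul c, h1.smul c⟩

theorem eq_zero_of_forall_test (hV : IsConfining V) {f : B2 V}
    (h : ∀ φ, IsTest φ → ∫ z, φ z * f z = 0) : f = 0 := by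
  have h0 : ∀ᵐ z ∂(volume : Measure (Phase d)), f z = 0 := by
    refine ae_eq_zero_of_integral_contDiff_smul_eq_zero (locallyIntegrable_B2 hV f) fun g hg hgc => ?_
    have := h (fun z => (g z : ℂ)) ⟨hg.complex_ofReal, hgc.comp_left Complex.ofReal_zero⟩
    simpa [Complex.real_smul] using this
  rw [← ae_weight hV] at h0
  exact (Lp.eq_zero_iff_ae_eq_zero).2 h0

theorem dense_testSpace (hV : IsConfining V) : Dense (testSpace V : Set (B2 V)) := by
  rw [Submodule.dense_iff_topologicalClosure_eq_top,
    Submodule.topologicalClosure_eq_top_iff, Submodule.eq_bot_iff]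
  intro f hf
  rw [Submodule.mem_orthogonal] at hf
  refine eq_zero_of_forall_test hV fun φ hφ => ?_
  obtain ⟨e, he⟩ := hφ.conj.tempered.exists_represents hV
  have := hf e ⟨_, hφ.conj, he⟩
  rw [he.inner_eq hV] at this
  simpa using this

theorem exists_transport_approx (hV : IsConfining V) (s : ℝ) (hs : |s| = 1) : ∃ l₀ : ℝ,
    ∀ l : ℝ, l₀ ≤ l → ∀ e ∈ testSpace V,
      e ∈ closure {y | ∃ p ∈ transportGraph V, (l : ℂ) • p.1 - (s : ℂ) • p.2 = y} := by
  obtain ⟨ℓ, L, hℓ, hL, hF1, hF2⟩ := exists_fderiv_transportField_bounds hV s hs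
  refine ⟨2 * ℓ + ℓ ^ 2 + 1, fun l hl e ⟨φ, hφ, he⟩ => ?_⟩
  have hF : ContDiff ℝ ∞ fun z : Phase d => s • ((z.2, -∇ V z.1) : Phase d) :=
    (contDiff_snd.prodMk ((contDiff_gradient hV).comp contDiff_fst).neg).const_smul s
  obtain ⟨C, K, hC, hK, hφb⟩ := hφ.exists_hasC11Bound
  choose u hu huC hur using fun n : ℕ => exists_approx_resolvent hF hF1 hF2 hℓ hL hC hK hφb hl
    (2 * ((n : ℝ) + 1)) (one_div_pos.2 (by positivity : (0 : ℝ) < (n : ℝ) + 1))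
  have hur' : ∀ (n : ℕ) z, ‖z‖ ≤ 2 * ((n : ℝ) + 1) →
      ‖(l : ℂ) * u n z - s * transport V (u n) z - φ z‖ ≤ 1 / ((n : ℝ) + 1) := fun n z hz => by
    have := hur n z hz
    rw [map_smul, Complex.real_smul] at this
    exact this
  have ht : ∀ n, IsTest fun z => cutoff n z * u n z := fun n => (isTest_cutoff n).mul_right (hu n)
  choose a ha using fun n => (ht n).tempered.exists_represents hV
  choose b hb using fun n => ((ht n).transport hV).tempered.exists_represents hV
  obtain ⟨B, hB0, hB⟩ := exists_transport_cutoff_bound hV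
  have hrep := fun n => ((ha n).smul (l : ℂ)).sub ((hb n).smul (s : ℂ))
  have hsn : ‖(s : ℂ)‖ = 1 := by rw [Complex.norm_real, Real.norm_eq_abs, hs]
  have heq : ∀ n z, (l : ℂ) * (cutoff n z * u n z)
      - s * transport V (fun z => cutoff n z * u n z) z - φ z
      = cutoff n z * ((l : ℂ) * u n z - s * transport V (u n) z - φ z)
        - s * (transport V (cutoff n) z * u n z) + (cutoff n z * φ z - φ z) := fun n z => by
    rw [transport_mul (isTest_cutoff n).smooth (hu n)]; ring
  have hcut : ∀ n z, ‖cutoff n z * ((l : ℂ) * u n z - s * transport V (u n) z - φ z)‖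
      ≤ 1 / ((n : ℝ) + 1) := fun n z => by
    by_cases hz : ‖z‖ ≤ 2 * ((n : ℝ) + 1)
    · rw [norm_mul]
      exact (mul_le_mul (norm_cutoff_le n z) (hur' n z hz) (norm_nonneg _) zero_le_one).trans
        (one_mul _).le
    · rw [cutoff_eq_zero (le_of_lt (not_le.1 hz)), zero_mul, norm_zero]
      positivity
  refine mem_closure_of_tendsto (Represents.tendsto hV hrep he
    (fun n => ?_) hφ.continuous (g := fun z => 1 + B * C + 2 * C) ?_ (fun n z => ?_) fun z => ?_)
    (Eventually.of_forall fun n => ⟨(a n, b n), subset_closure ⟨_, ht n, ha n, hb n⟩, rfl⟩)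
  · exact (continuous_const.mul (ht n).continuous).sub
      (continuous_const.mul ((ht n).transport hV).continuous)
  · exact (integrable_maxwellian hV).mul_const _
  · rw [heq]
    have h1 : ‖cutoff n z * ((l : ℂ) * u n z - s * transport V (u n) z - φ z)‖ ≤ 1 :=
      (hcut n z).trans (div_le_one_of_le₀ (by simp) (by positivity))
    have h2 : ‖(s : ℂ) * (transport V (cutoff n) z * u n z)‖ ≤ B * C := by
      rw [norm_mul, hsn, one_mul, norm_mul]
      exact mul_le_mul (hB n z) (huC n z) (norm_nonneg _) hB0
    have h3 : ‖cutoff n z * φ z - φ z‖ ≤ 2 * C := by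
      refine (norm_sub_le _ _).trans ?_
      rw [norm_mul]
      have := norm_cutoff_le n z
      have h4 : ‖φ z‖ ≤ C := hφb.norm_le z
      have := mul_le_mul this h4 (norm_nonneg _) zero_le_one
      linarith
    exact (norm_add_le _ _).trans (add_le_add ((norm_sub_le _ _).trans (add_le_add h1 h2)) h3)
  · rw [tendsto_iff_norm_sub_tendsto_zero]
    refine squeeze_zero' (Eventually.of_forall fun n => norm_nonneg _) ?_
      tendsto_one_div_add_atTop_nhds_zero_nat
    filter_upwards [eventually_norm_lt z] with n hn
    have h1 : transport V (cutoff n) z = 0 := by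
      rw [transport, fderiv_cutoff_eq_zero hn]; rfl
    have := hcut n z
    rw [heq, h1, cutoff_eq_one hn.le]
    rw [cutoff_eq_one hn.le] at this
    simpa using this

theorem isSkewAdjointGraph_transportGraph (hV : IsConfining V) :
    IsSkewAdjointGraph (transportGraph V) := by
  have hskew : ∀ p ∈ transportCore V, ∀ q ∈ transportCore V,
      inner ℂ p.1 q.2 = -inner ℂ p.2 q.1 := by
    rintro p ⟨φ, hφ, h1, h2⟩ q ⟨ψ, hψ, h3, h4⟩
    rw [h1.inner_eq' hV h4, h2.inner_eq' hV h3]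
    exact integral_conj_mul_transport hV hφ hψ
  have hdense : ∀ e : B2 V, e ∈ closure (testSpace V : Set (B2 V)) := dense_testSpace hV
  have hcl : ∀ S : Set (B2 V), (∀ e ∈ testSpace V, e ∈ closure S) → ∀ h, h ∈ closure S :=
    fun S hS h => closure_minimal hS isClosed_closure (hdense h)
  refine ⟨Submodule.isClosed_topologicalClosure _, fun p hp q hq => ?_, ?_, ?_, ?_⟩
  · have hc1 : ∀ q ∈ transportCore V, ∀ p ∈ transportGraph V,
        inner ℂ p.1 q.2 = -inner ℂ p.2 q.1 := fun q hq p hp =>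
      closure_minimal (s := (transportCore V : Set (B2 V × B2 V)))
        (t := {p | inner ℂ p.1 q.2 = -inner ℂ p.2 q.1}) (fun p hp => hskew p hp q hq)
        (isClosed_eq (by fun_prop) (by fun_prop)) hp
    exact closure_minimal (s := (transportCore V : Set (B2 V × B2 V)))
        (t := {q | inner ℂ p.1 q.2 = -inner ℂ p.2 q.1}) (fun q hq => hc1 q hq p hp)
        (isClosed_eq (by fun_prop) (by fun_prop)) hq
  · obtain ⟨l₀, hl₀⟩ := exists_transport_approx hV (-1) (by simp)
    refine ⟨l₀, fun l hl => hcl _ fun e he => ?_⟩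
    simpa using hl₀ l hl e he
  · obtain ⟨l₀, hl₀⟩ := exists_transport_approx hV 1 (by simp)
    refine ⟨l₀, fun l hl => hcl _ fun e he => ?_⟩
    simpa using hl₀ l hl e he
  · refine (dense_testSpace hV).mono ?_
    rintro e ⟨φ, hφ, he⟩
    obtain ⟨e', he'⟩ := (hφ.transport hV).tempered.exists_represents hV
    exact ⟨(e, e'), subset_closure ⟨φ, hφ, he, he'⟩, rfl⟩

end RelaxationBoltzmann

end

open MeasureTheory Filter Topology
open scoped ContDiff Gradient NNReal

noncomputable section

namespace RelaxationBoltzmann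

/-! ### Functions with vanishing weak gradient -/

section WeakGradient

variable {E : Type*} [NormedAddCommGroup E] [NormedSpace ℝ E] [FiniteDimensional ℝ E]
  [MeasurableSpace E] [BorelSpace E] {μ : Measure E} [μ.IsAddHaarMeasure]

theorem convolution_eq_of_weak_gradient_zero {f : E → ℂ} (hf : LocallyIntegrable f μ) {S : Set E}
    (hS : Submodule.span ℝ S = ⊤)
    (h : ∀ η : E → ℂ, IsTest η → ∀ e ∈ S, ∫ z, fderiv ℝ η z e * f z ∂μ = 0) {θ : E → ℝ}
    (hθ : ContDiff ℝ ∞ θ) (hθc : HasCompactSupport θ) (x y : E) :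
    convolution θ f (ContinuousLinearMap.lsmul ℝ ℝ) μ x
      = convolution θ f (ContinuousLinearMap.lsmul ℝ ℝ) μ y := by
  have hd := fun x₀ => hθc.hasFDerivAt_convolution_left (ContinuousLinearMap.lsmul ℝ ℝ)
    (hθ.of_le (by norm_cast)) hf x₀
  refine is_const_of_fderiv_eq_zero (𝕜 := ℝ) (fun x₀ => (hd x₀).differentiableAt)
    (fun x₀ => ?_) x y
  rw [(hd x₀).fderiv]
  refine ContinuousLinearMap.coe_injective (LinearMap.ext_on hS fun e he => ?_)
  have hθ' : ContDiff ℝ ∞ (fderiv ℝ θ) := hθ.fderiv_right (m := ∞) (by norm_cast)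
  have hce := (hθc.fderiv ℝ).convolutionExists_left
    ((ContinuousLinearMap.lsmul ℝ ℝ).precompL E : (E →L[ℝ] ℝ) →L[ℝ] ℂ →L[ℝ] E →L[ℝ] ℂ)
    hθ'.continuous hf x₀
  have hce' := hce.integrable_swap
  simp only [ContinuousLinearMap.coe_coe, zero_apply, convolution_eq_swap]
  rw [ContinuousLinearMap.integral_apply hce']
  have hη : IsTest fun z => -((θ (x₀ - z) : ℝ) : ℂ) := by
    refine ⟨(hθ.comp (contDiff_const.sub contDiff_id)).complex_ofReal.neg, ?_⟩
    have : HasCompactSupport fun z => θ (x₀ - z) :=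
      hθc.comp_homeomorph (Homeomorph.subLeft x₀)
    exact this.comp_left (g := fun r : ℝ => -(r : ℂ)) (by simp)
  rw [← h _ hη e he]
  refine integral_congr_ae (Eventually.of_forall fun z => ?_)
  have e1 : HasFDerivAt (fun z => θ (x₀ - z)) (-(fderiv ℝ θ (x₀ - z))) z := by
    have := (hθ.differentiableAt' (x₀ - z)).hasFDerivAt.comp z ((hasFDerivAt_id z).const_sub x₀)
    refine this.congr_fderiv ?_
    ext w; simp
  have e2 : fderiv ℝ (fun z => -((θ (x₀ - z) : ℝ) : ℂ)) z e = (fderiv ℝ θ (x₀ - z) e : ℝ) := by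
    rw [fderiv_fun_neg, neg_apply, fderiv_ofReal_apply e1.differentiableAt, e1.fderiv]
    simp
  simp only
  rw [e2, ContinuousLinearMap.precompL_apply, ContinuousLinearMap.lsmul_apply, Complex.real_smul]

/-- A locally integrable function with vanishing weak gradient is constant. -/
theorem ae_eq_const_of_weak_gradient_zero {f : E → ℂ} (hf : LocallyIntegrable f μ) {S : Set E}
    (hS : Submodule.span ℝ S = ⊤)
    (h : ∀ η : E → ℂ, IsTest η → ∀ e ∈ S, ∫ z, fderiv ℝ η z e * f z ∂μ = 0) :
    ∃ c, f =ᵐ[μ] fun _ => c := by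
  let φ : ℕ → ContDiffBump (0 : E) := fun n =>
    ⟨1 / ((n : ℝ) + 1), 2 * (1 / ((n : ℝ) + 1)), by positivity,
      by have : 0 < 1 / ((n : ℝ) + 1) := by positivity
         linarith⟩
  have hφ : Tendsto (fun n => (φ n).rOut) atTop (𝓝 0) := by
    have := (tendsto_one_div_add_atTop_nhds_zero_nat (𝕜 := ℝ)).const_mul 2
    rwa [mul_zero] at this
  have key := ContDiffBump.ae_convolution_tendsto_right_of_locallyIntegrable (μ := μ) (K := 2) hφ
    (Eventually.of_forall fun n => le_rfl) hf
  obtain ⟨x₀, hx₀⟩ := key.exists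
  refine ⟨f x₀, key.mono fun x hx => tendsto_nhds_unique hx (hx₀.congr fun n => ?_)⟩
  exact convolution_eq_of_weak_gradient_zero hf hS h (φ n).contDiff_normed
    (φ n).hasCompactSupport_normed x₀ x

end WeakGradient

variable {d : ℕ} {V : Pos d → ℝ}

theorem span_range_dir : Submodule.span ℝ (Set.range (dir : Fin d ⊕ Fin d → Phase d)) = ⊤ := by
  rw [eq_top_iff]
  rintro ⟨x, v⟩ -
  have hb : ∀ x : Pos d, x = ∑ j, x j • EuclideanSpace.single j (1 : ℝ) := fun x => by
    conv_lhs => rw [← (EuclideanSpace.basisFun (Fin d) ℝ).sum_repr x]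
    simp
  have h : ((x, v) : Phase d) = ∑ j, (x j • dir (.inl j) + v j • dir (.inr j)) := by
    refine Prod.ext ?_ ?_
    · rw [Prod.fst_sum]
      simpa [dir] using hb x
    · rw [Prod.snd_sum]
      simpa [dir] using hb v
  rw [h]
  exact Submodule.sum_mem _ fun j _ => add_mem
    (Submodule.smul_mem _ _ (Submodule.subset_span ⟨_, rfl⟩))
    (Submodule.smul_mem _ _ (Submodule.subset_span ⟨_, rfl⟩))

/-! ### The operator `Λ² - 1` -/

theorem fderiv_maxwellian_mul (hV : IsConfining V) {a : Phase d → ℂ} (ha : ContDiff ℝ ∞ a)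
    (z : Phase d) (i : Fin d ⊕ Fin d) :
    fderiv ℝ (fun z => (maxwellian V z : ℂ) * a z) z (dir i)
      = (maxwellian V z : ℂ) * (fderiv ℝ a z (dir i) - drift V i z * a z) := by
  have hM := contDiff_maxwellian hV
  rw [fderiv_mul_apply' (hM.complex_ofReal.differentiableAt' z) (ha.differentiableAt' z),
    fderiv_ofReal_apply (hM.differentiableAt' z), fderiv_maxwellian hV]
  push_cast; ring

theorem lambdaSqSubOne_maxwellian_mul (hV : IsConfining V) (γ : ℝ) {a : Phase d → ℂ}
    (ha : ContDiff ℝ ∞ a) (z : Phase d) :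
    lambdaSqSubOne γ V (fun z => (maxwellian V z : ℂ) * a z) z
      = (maxwellian V z : ℂ) * (γ * ellipticOp V a z) := by
  have h1 : ∀ i w, fderiv ℝ (fun z => (maxwellian V z : ℂ) * a z) w (dir i)
      + (drift V i w : ℂ) * ((maxwellian V w : ℂ) * a w)
      = (maxwellian V w : ℂ) * fderiv ℝ a w (dir i) := fun i w => by
    rw [fderiv_maxwellian_mul hV ha]; ring
  have h2 : ∀ i, fderiv ℝ (fun w => fderiv ℝ (fun z => (maxwellian V z : ℂ) * a z) w (dir i)
      + (drift V i w : ℂ) * ((maxwellian V w : ℂ) * a w)) z (dir i)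
      = -((maxwellian V z : ℂ) * ((drift V i z : ℂ) * fderiv ℝ a z (dir i)
    - fderiv ℝ (fun w => fderiv ℝ a w (dir i)) z (dir i))) := fun i => by
    simp_rw [h1]
    rw [fderiv_maxwellian_mul hV (ha.fderiv_apply_const _)]; ring
  have hx : ∀ j, dx j (fun w => dx j (fun z => (maxwellian V z : ℂ) * a z) w
      + ((∇ V w.1) j : ℂ) * ((maxwellian V w : ℂ) * a w)) z = _ := fun j => h2 (.inl j)
  have hv : ∀ j, dv j (fun w => dv j (fun z => (maxwellian V z : ℂ) * a z) w
      + (w.2 j : ℂ) * ((maxwellian V w : ℂ) * a w)) z = _ := fun j => h2 (.inr j)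
  rw [lambdaSqSubOne, Finset.sum_congr rfl fun j _ => hx j, Finset.sum_congr rfl fun j _ => hv j,
    ellipticOp, Fintype.sum_sum_type]
  simp only [Finset.sum_neg_distrib, ← Finset.mul_sum]
  ring

theorem mem_closedGraph_iff (hV : IsConfining V) {γ : ℝ} (hγ : γ ≠ 0) {p : B2 V × B2 V} :
    p ∈ closedGraph γ V ↔ (p.1, (γ : ℂ)⁻¹ • p.2) ∈ ellipticGraph V := by
  have hγ' : (γ : ℂ) ≠ 0 := by exact_mod_cast hγ
  let T : B2 V × B2 V ≃ₜ B2 V × B2 V :=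
    (Homeomorph.refl _).prodCongr (Homeomorph.smulOfNeZero ((γ : ℂ)⁻¹) (inv_ne_zero hγ'))
  have hT : ∀ p, T p = (p.1, (γ : ℂ)⁻¹ • p.2) := fun p => rfl
  have hM := contDiff_maxwellian hV
  have hset : {p : B2 V × B2 V | ∃ φ : Phase d → ℂ, ContDiff ℝ ∞ φ ∧ HasCompactSupport φ ∧
      p.1 =ᵐ[weight V] φ ∧ p.2 =ᵐ[weight V] lambdaSqSubOne γ V φ}
      = T ⁻¹' (ellipticCore V : Set (B2 V × B2 V)) := by
    ext p
    simp only [Set.mem_ofPred_eq, Set.mem_preimage, hT]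
    constructor
    · rintro ⟨φ, h1, h2, h3, h4⟩
      have ha : IsTest fun z => ((maxwellian V z)⁻¹ : ℝ) * φ z :=
        IsTest.mul_left ⟨h1, h2⟩ (hM.inv fun z => (maxwellian_pos hV z).ne').complex_ofReal
      have e : φ = fun z => (maxwellian V z : ℂ) * (((maxwellian V z)⁻¹ : ℝ) * φ z) := by
        funext z
        have : (maxwellian V z : ℂ) ≠ 0 := by exact_mod_cast (maxwellian_pos hV z).ne'
        push_cast
        rw [mul_inv_cancel_left₀ this]
      rw [e] at h3 h4
      refine ⟨_, ha, h3, ?_⟩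
      have h5 : Represents V p.2 fun z => γ * ellipticOp V
          (fun z => ((maxwellian V z)⁻¹ : ℝ) * φ z) z := by
        filter_upwards [h4] with z hz
        rw [hz, lambdaSqSubOne_maxwellian_mul hV γ ha.smooth]
      exact (h5.smul _).congr fun z => inv_mul_cancel_left₀ hγ' _
    · rintro ⟨a, ha, h1, h2⟩
      refine ⟨_, (ha.mul_left hM.complex_ofReal).smooth, (ha.mul_left hM.complex_ofReal).compact,
        h1, ?_⟩
      have h3 := h2.smul (γ : ℂ)
      rw [smul_inv_smul₀ hγ'] at h3
      filter_upwards [h3] with z hz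
      rw [hz, lambdaSqSubOne_maxwellian_mul hV γ ha.smooth]
  rw [closedGraph, hset, ← T.preimage_closure]
  rfl

theorem ellipticGraph_induction {P : B2 V × B2 V → Prop} (hP : IsClosed {p | P p})
    (h : ∀ p φ, IsTest φ → Represents V p.1 φ → Represents V p.2 (ellipticOp V φ) → P p)
    {p : B2 V × B2 V} (hp : p ∈ ellipticGraph V) : P p :=
  closure_minimal (s := (ellipticCore V : Set (B2 V × B2 V))) (t := {p | P p})
    (by rintro p ⟨φ, hφ, h1, h2⟩; exact h p φ hφ h1 h2) hP hp

theorem Represents.inner_ellipticOp (hV : IsConfining V) {e f : B2 V} {a b : Phase d → ℂ}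
    (ha : IsTest a) (hb : ContDiff ℝ ∞ b) (he : Represents V e a)
    (hf : Represents V f (ellipticOp V b)) : inner ℂ e f = ∑ i, ∫ z, (maxwellian V z : ℂ) *
        (starRingEnd ℂ (fderiv ℝ a z (dir i)) * fderiv ℝ b z (dir i)) := by
  rw [he.inner_eq' hV hf, integral_conj_mul_ellipticOp hV ha hb]

theorem ellipticGraph_symm (hV : IsConfining V) {p q : B2 V × B2 V} (hp : p ∈ ellipticGraph V)
    (hq : q ∈ ellipticGraph V) : inner ℂ p.2 q.1 = inner ℂ p.1 q.2 := by
  refine ellipticGraph_induction (P := fun p => inner ℂ p.2 q.1 = inner ℂ p.1 q.2)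
    (isClosed_eq (by fun_prop) (by fun_prop)) (fun p φ hφ h1 h2 => ?_) hp
  refine ellipticGraph_induction (P := fun q => inner ℂ p.2 q.1 = inner ℂ p.1 q.2)
    (isClosed_eq (by fun_prop) (by fun_prop)) (fun q ψ hψ h3 h4 => ?_) hq
  rw [← inner_conj_symm, h3.inner_ellipticOp hV hψ hφ.smooth h2,
    h1.inner_ellipticOp hV hφ hψ.smooth h4, map_sum]
  refine Finset.sum_congr rfl fun i _ => ?_
  rw [← integral_conj]
  refine integral_congr_ae (Eventually.of_forall fun z => ?_)
  simp only [map_mul, Complex.conj_ofReal, Complex.conj_conj]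
  ring

theorem maxwellianB2_mem_ellipticGraph (hV : IsConfining V) :
    (maxwellianB2 hV, 0) ∈ ellipticGraph V := by
  refine mem_ellipticGraph hV (a := fun _ => 1) contDiff_const (represents_maxwellianB2 hV)
    (Represents.zero.congr fun z => ?_) fun i => ⟨0, Represents.zero.congr fun z => ?_⟩
  · simp [ellipticOp]
  · simp

theorem maxwellianB2_mem_transportGraph (hV : IsConfining V) :
    (maxwellianB2 hV, 0) ∈ transportGraph V := by
  refine mem_transportGraph hV (a := fun _ => 1) contDiff_const (represents_maxwellianB2 hV)
    (Represents.zero.congr fun z => ?_)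
  simp [transport]

/-- The adjoint of `∂ᵢ`, tested against an element of the domain of the elliptic operator. -/
theorem norm_integral_adjoint_mul_le (hV : IsConfining V) {ψ : Phase d → ℂ} (hψ : IsTest ψ)
    (i : Fin d ⊕ Fin d) : ∃ C, ∀ p ∈ ellipticGraph V,
      ‖∫ z, (drift V i z * ψ z - fderiv ℝ ψ z (dir i)) * p.1 z‖ ^ 2
        ≤ C * (inner ℂ p.1 p.2).re := by
  have hA : IsTest fun z => starRingEnd ℂ (drift V i z * ψ z - fderiv ℝ ψ z (dir i)) :=
    ((hψ.mul_left (contDiff_drift hV i).complex_ofReal).sub (hψ.fderiv_apply _)).conj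
  obtain ⟨e, he⟩ := hA.tempered.exists_represents hV
  obtain ⟨w, hw⟩ := hψ.conj.tempered.exists_represents hV
  have hin : ∀ f : B2 V, ∫ z, (drift V i z * ψ z - fderiv ℝ ψ z (dir i)) * f z = inner ℂ e f :=
    fun f => by rw [he.inner_eq hV]; simp only [Complex.conj_conj]
  refine ⟨‖w‖ ^ 2, fun p hp => ?_⟩
  rw [hin]
  refine ellipticGraph_induction (P := fun p => ‖(inner ℂ e p.1 : ℂ)‖ ^ 2 ≤ ‖w‖ ^ 2 * (inner ℂ p.1 p.2).re)
    (isClosed_le (by fun_prop) (continuous_const.mul (Complex.continuous_re.comp (by fun_prop))))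
    (fun p φ hφ h1 h2 => ?_) hp
  obtain ⟨g, hg⟩ := (hφ.fderiv_apply (dir i)).tempered.exists_represents hV
  have e1 : inner ℂ e p.1 = inner ℂ w g := by
    rw [he.inner_eq' hV h1, hw.inner_eq' hV hg]
    simp only [Complex.conj_conj]
    rw [eq_comm]
    have := integral_density_mul_fderiv_mul (μ := volume) (contDiff_maxwellian hV)
      (contDiff_drift hV i) (fun z => fderiv_maxwellian hV z i) hφ hψ.smooth
    have l1 : ∀ z, (maxwellian V z : ℂ) * (ψ z * fderiv ℝ φ z (dir i))
        = (maxwellian V z : ℂ) * (fderiv ℝ φ z (dir i) * ψ z) := fun z => by ring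
    have l2 : ∀ z, (maxwellian V z : ℂ) * ((drift V i z * ψ z - fderiv ℝ ψ z (dir i)) * φ z)
        = (maxwellian V z : ℂ) * (φ z * (drift V i z * ψ z - fderiv ℝ ψ z (dir i))) :=
      fun z => by ring
    simp_rw [l1, l2]
    exact this.symm
  have e2 : ‖g‖ ^ 2 ≤ (inner ℂ p.1 p.2).re := by
    rw [h1.inner_ellipticOp hV hφ hφ.smooth h2, Complex.re_sum]
    have e3 : ∀ k, (∫ z, (maxwellian V z : ℂ) * (starRingEnd ℂ (fderiv ℝ φ z (dir k)) *
        fderiv ℝ φ z (dir k))).re = ∫ z, maxwellian V z * ‖fderiv ℝ φ z (dir k)‖ ^ 2 := fun k => by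
      obtain ⟨g, hg⟩ := (hφ.fderiv_apply (dir k)).tempered.exists_represents hV
      rw [← hg.inner_eq' hV hg, re_inner_self_eq, hg.norm_sq hV]
    simp_rw [e3]
    rw [hg.norm_sq hV]
    exact Finset.single_le_sum (f := fun k => ∫ z, maxwellian V z * ‖fderiv ℝ φ z (dir k)‖ ^ 2)
      (fun k _ => integral_nonneg fun z => mul_nonneg (maxwellian_nonneg V z) (sq_nonneg _))
      (Finset.mem_univ i)
  rw [e1]
  calc ‖(inner ℂ w g : ℂ)‖ ^ 2 ≤ (‖w‖ * ‖g‖) ^ 2 := by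
        gcongr; exact norm_inner_le_norm _ _
    _ = ‖w‖ ^ 2 * ‖g‖ ^ 2 := mul_pow _ _ _
    _ ≤ _ := by gcongr

theorem ellipticGraph_kernel (hV : IsConfining V) {k : B2 V} (hk : (k, 0) ∈ ellipticGraph V) :
    ∃ c : ℂ, k = c • maxwellianB2 hV := by
  have hM := contDiff_maxwellian hV
  have hMinv : ContDiff ℝ ∞ fun z => ((maxwellian V z)⁻¹ : ℝ) :=
    hM.inv fun z => (maxwellian_pos hV z).ne'
  have hM0 : ∀ z, (maxwellian V z : ℂ) ≠ 0 := fun z => by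
    exact_mod_cast (maxwellian_pos hV z).ne'
  have hloc : LocallyIntegrable (fun z => ((maxwellian V z)⁻¹ : ℝ) * (k z : ℂ))
      (volume : Measure (Phase d)) := by
    have := (locallyIntegrable_B2 hV k).continuous_smul (g := fun z => (maxwellian V z)⁻¹)
      hMinv.continuous
    simpa only [Complex.real_smul] using this
  obtain ⟨c, hc⟩ := ae_eq_const_of_weak_gradient_zero hloc span_range_dir (by
    rintro η hη _ ⟨i, rfl⟩
    have hψ : IsTest fun z => ((maxwellian V z)⁻¹ : ℝ) * η z := hη.mul_left hMinv.complex_ofReal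
    obtain ⟨C, hC⟩ := norm_integral_adjoint_mul_le hV hψ i
    have h0 := hC _ hk
    simp only [inner_zero_right, Complex.zero_re, mul_zero] at h0
    have h1 := norm_eq_zero.1 (pow_eq_zero_iff (two_ne_zero) |>.1 (le_antisymm h0 (sq_nonneg _)))
    rw [← neg_eq_zero, ← integral_neg, ← h1]
    refine integral_congr_ae (Eventually.of_forall fun z => ?_)
    have e : η = fun z => (maxwellian V z : ℂ) * (((maxwellian V z)⁻¹ : ℝ) * η z) := by
      funext z
      push_cast
      rw [mul_inv_cancel_left₀ (hM0 z)]
    have e2 := fderiv_maxwellian_mul hV hψ.smooth z i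
    rw [← e] at e2
    simp only
    rw [e2]
    push_cast
    field_simp [hM0 z]
    ring)
  refine ⟨c, Represents.eq (a := fun _ => c) ?_ ?_⟩
  · rw [Represents, ae_weight hV]
    filter_upwards [hc] with z hz
    rw [← hz]
    push_cast
    rw [mul_inv_cancel_left₀ (hM0 z)]
  · simpa using (represents_maxwellianB2 hV).smul c

/-! ### The Poincaré inequality -/

theorem HasSpectralGap.isResolventPoint {γ α : ℝ} (h : HasSpectralGap γ V α) {c : ℝ} (hc : c ≠ 0)
    (hcα : c < α) : IsResolventPoint (closedGraph γ V) c := by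
  by_contra hn
  exact absurd (h.2.1 ⟨hn, hc⟩) (not_le.2 hcα)

theorem HasSpectralGap.poincare (hV : IsConfining V) {γ α : ℝ} (hγ : 0 < γ)
    (h : HasSpectralGap γ V α) {p : B2 V × B2 V} (hp : p ∈ ellipticGraph V)
    (hpe : inner ℂ (maxwellianB2 hV) p.1 = 0) :
    α / γ * ‖p.1‖ ^ 2 ≤ (inner ℂ p.1 p.2).re := by
  have hγ' : (γ : ℂ) ≠ 0 := by exact_mod_cast hγ.ne'
  have key := poincare_of_spectralGap (G := closedGraph γ V) (fun p hp q hq => ?_) h.1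
    (fun c hc hcα => h.isResolventPoint hc hcα) (e₀ := maxwellianB2 hV) ?_ (fun k hk => ?_)
    (p := (p.1, (γ : ℂ) • p.2)) ?_ hpe
  · simp only [inner_smul_right, Complex.re_ofReal_mul] at key
    rw [div_mul_eq_mul_div, div_le_iff₀ hγ]
    linarith
  · have := ellipticGraph_symm hV ((mem_closedGraph_iff hV hγ.ne').1 hp)
      ((mem_closedGraph_iff hV hγ.ne').1 hq)
    simp only [inner_smul_left, inner_smul_right, map_inv₀, Complex.conj_ofReal] at this
    exact mul_left_cancel₀ (inv_ne_zero hγ') this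
  · rw [mem_closedGraph_iff hV hγ.ne', smul_zero]
    exact maxwellianB2_mem_ellipticGraph hV
  · rw [mem_closedGraph_iff hV hγ.ne', smul_zero] at hk
    exact ellipticGraph_kernel hV hk
  · rw [mem_closedGraph_iff hV hγ.ne', inv_smul_smul₀ hγ']
    exact hp

theorem contDiff_velocity (j : Fin d) : ContDiff ℝ ∞ fun z : Phase d => ((z.2 j : ℝ) : ℂ) :=
  ((EuclideanSpace.proj (𝕜 := ℝ) j).contDiff.comp contDiff_snd).complex_ofReal

theorem fderiv_velocity_apply (j : Fin d) (z w : Phase d) :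
    fderiv ℝ (fun z : Phase d => (z.2 j : ℂ)) z w = (w.2 j : ℂ) := by
  have h1 : ContDiff ℝ ∞ fun v : Pos d => ((v j : ℝ) : ℂ) :=
    ((EuclideanSpace.proj (𝕜 := ℝ) j).contDiff).complex_ofReal
  rw [fderiv_comp_snd_apply (u := fun v : Pos d => ((v j : ℝ) : ℂ)) (h1.differentiableAt' _)]
  have h2 := (EuclideanSpace.proj (𝕜 := ℝ) j).hasFDerivAt (x := z.2)
  have h3 : fderiv ℝ (fun v : Pos d => v j) z.2 = EuclideanSpace.proj (𝕜 := ℝ) j := h2.fderiv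
  have h4 : DifferentiableAt ℝ (fun v : Pos d => v j) z.2 := h2.differentiableAt
  rw [fderiv_ofReal_apply h4, h3]
  rfl

theorem HasSpectralGap.le (hV : IsConfining V) {γ α : ℝ} (hγ : 0 < γ)
    (h : HasSpectralGap γ V α) (j : Fin d) : α ≤ γ := by
  obtain ⟨e, he⟩ := (IsTempered.velocity j).exists_represents hV
  have hder : ∀ z (i : Fin d ⊕ Fin d), fderiv ℝ (fun z : Phase d => (z.2 j : ℂ)) z (dir i)
      = ((dir i : Phase d).2 j : ℂ) := fun z i => fderiv_velocity_apply j z _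
  have hop : ∀ z, ellipticOp V (fun z : Phase d => (z.2 j : ℂ)) z = z.2 j := fun z => by
    simp only [ellipticOp, hder]
    rw [Fintype.sum_sum_type, Finset.sum_eq_zero, zero_add, Finset.sum_eq_single j]
    · simp [dir, drift]
    · intro k _ hk
      simp [dir, Ne.symm hk]
    · simp
    · intro k _
      simp [dir]
  have hsm := contDiff_velocity (d := d) j
  have hmem : (e, e) ∈ ellipticGraph V :=
    mem_ellipticGraph hV hsm he (he.congr fun z => (hop z).symm) fun i =>
      ((IsTempered.const _).exists_represents hV).imp fun b hb => hb.congr fun z => (hder z i).symm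
  have horth : inner ℂ (maxwellianB2 hV) e = 0 := by
    have := ellipticGraph_symm hV (maxwellianB2_mem_ellipticGraph hV) hmem
    simpa using this.symm
  have key := h.poincare hV hγ hmem horth
  simp only [re_inner_self_eq] at key
  have he0 : 0 < ‖e‖ ^ 2 := by
    refine pow_pos (norm_pos_iff.2 fun h0 => ?_) 2
    rw [h0] at he
    have h1 : (fun _ : Phase d => (0 : ℂ)) =ᵐ[volume] fun z => (maxwellian V z : ℂ) * (z.2 j : ℂ) := by
      rw [← ae_weight hV]
      filter_upwards [he, (Represents.zero (V := V))] with z h1 h2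
      rw [← h1, h2, mul_zero]
    have h2 := (Continuous.ae_eq_iff_eq volume continuous_const
      ((contDiff_maxwellian hV).complex_ofReal.continuous.mul hsm.continuous)).1 h1
    have h3 := congrFun h2 (0, EuclideanSpace.single j 1)
    simp only [Pi.mul_apply, PiLp.single_apply, if_true, Complex.ofReal_one, mul_one] at h3
    exact (maxwellian_pos hV _).ne' (Complex.ofReal_eq_zero.1 h3.symm)
  have := le_of_mul_le_mul_right (key.trans (one_mul _).symm.le) he0
  rwa [div_le_one hγ] at this

end RelaxationBoltzmann

end

open MeasureTheory Filter Topology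
open scoped ContDiff Gradient NNReal

noncomputable section

namespace RelaxationBoltzmann

variable {d : ℕ} {V : Pos d → ℝ}

/-! ### Functions of the position -/

theorem IsTest.tempered_fst {u : Pos d → ℂ} (hu : IsTest u) :
    IsTempered fun z : Phase d => u z.1 := .comp_fst hu.continuous hu.compact

theorem contDiff_comp_fst {u : Pos d → ℂ} (hu : ContDiff ℝ ∞ u) :
    ContDiff ℝ ∞ fun z : Phase d => u z.1 := hu.comp contDiff_fst

/-- The functions `𝓜 u(x)` with a test function `u`. -/
def macroTestSpace (V : Pos d → ℝ) : Submodule ℂ (B2 V) where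
  carrier := {e | ∃ u : Pos d → ℂ, IsTest u ∧ Represents V e fun z => u z.1}
  add_mem' := by
    rintro e f ⟨u, hu, h1⟩ ⟨w, hw, h2⟩
    exact ⟨_, hu.add hw, h1.add h2⟩
  zero_mem' := ⟨_, IsTest.zero, Represents.zero⟩
  smul_mem' := by
    rintro c e ⟨u, hu, h1⟩
    exact ⟨_, hu.const_mul c, h1.smul c⟩

/-- The space of the functions `𝓜 u(x)` in `B²`. -/
def macroSpace (V : Pos d → ℝ) : Submodule ℂ (B2 V) := (macroTestSpace V).topologicalClosure

instance completeSpace_macroSpace : CompleteSpace (macroSpace V) :=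
  inferInstanceAs (CompleteSpace (macroTestSpace V).topologicalClosure)

theorem mem_macroSpace {u : Pos d → ℂ} (hu : IsTest u) {e : B2 V}
    (he : Represents V e fun z => u z.1) : e ∈ macroSpace V :=
  subset_closure (s := (macroTestSpace V : Set (B2 V))) ⟨u, hu, he⟩

theorem starProjection_macroSpace_eq {f g : B2 V} (hg : g ∈ macroSpace V)
    (h : ∀ (u : Pos d → ℂ) (e : B2 V), IsTest u → Represents V e (fun z => u z.1) →
      inner ℂ e f = inner ℂ e g) : (macroSpace V).starProjection f = g := by
  refine (Submodule.eq_starProjection_of_mem_of_inner_eq_zero hg fun w hw => ?_)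
  have hc : ∀ w ∈ macroSpace V, inner ℂ w (f - g) = 0 := fun w hw =>
    closure_minimal (s := (macroTestSpace V : Set (B2 V))) (t := {w | inner ℂ w (f - g) = 0})
      (by
        rintro e ⟨u, hu, he⟩
        change inner ℂ e (f - g) = 0
        rw [inner_sub_right, h u e hu he, sub_self]) (isClosed_eq (by fun_prop) (by fun_prop)) hw
  rw [← inner_conj_symm, hc w hw, map_zero]

/-- The cutoff functions in position. -/
def posCutoff (n : ℕ) (x : Pos d) : ℂ := cutoff n ((x, 0) : Phase d)

theorem isTest_posCutoff (n : ℕ) : IsTest (posCutoff n : Pos d → ℂ) := by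
  refine ⟨(isTest_cutoff n).smooth.comp (contDiff_id.prodMk contDiff_const), ?_⟩
  refine HasCompactSupport.intro ((isTest_cutoff n).compact.isCompact.image continuous_fst)
    fun x hx => ?_
  by_contra hne
  exact hx ⟨(x, 0), subset_tsupport _ hne, rfl⟩

theorem maxwellianB2_mem_macroSpace (hV : IsConfining V) : maxwellianB2 hV ∈ macroSpace V := by
  choose e he using fun n => (isTest_posCutoff n).tempered_fst.exists_represents hV
  refine mem_closure_of_tendsto (s := (macroTestSpace V : Set (B2 V)))
    (Represents.tendsto hV he (represents_maxwellianB2 hV) (fun n => ?_) continuous_const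
    (g := fun _ => 2) ((integrable_maxwellian hV).mul_const _) (fun n z => ?_) fun z => ?_)
    (Eventually.of_forall fun n => ⟨_, isTest_posCutoff n, he n⟩)
  · exact (isTest_posCutoff n).continuous.comp continuous_fst
  · refine (norm_sub_le _ _).trans ?_
    have := norm_cutoff_le n ((z.1, 0) : Phase d)
    rw [norm_one]
    unfold posCutoff
    linarith
  · refine tendsto_const_nhds.congr' ?_
    filter_upwards [eventually_norm_lt ((z.1, 0) : Phase d)] with n hn
    exact (cutoff_eq_one hn.le).symm

/-! ### The velocity average -/

/-- The average in velocity. -/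
def average (ψ : Phase d → ℂ) (x : Pos d) : ℂ := ∫ v, (velocityMaxwellian v : ℂ) * ψ (x, v)

theorem IsTest.average {ψ : Phase d → ℂ} (hψ : IsTest ψ) : IsTest (average ψ) := by
  have hfst := hψ.compact.isCompact.image continuous_fst
  have hsnd := hψ.compact.isCompact.image (f := fun z : Phase d => -z.2) (by fun_prop)
  refine ⟨?_, HasCompactSupport.intro hfst fun x hx => ?_⟩
  · have key := contDiffOn_convolution_right_with_param (𝕜 := ℝ) (μ := (volume : Measure (Pos d)))
      (n := ⊤) (f := fun v : Pos d => velocityMaxwellian v) (ContinuousLinearMap.lsmul ℝ ℝ)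
      (g := fun x y => ψ (x, -y)) (s := Set.univ) isOpen_univ hsnd (fun x y _ hy => ?_)
      (contDiff_velocityMaxwellian.continuous.locallyIntegrable) ?_
    · rw [Set.univ_prod_univ, contDiffOn_univ] at key
      have h2 := key.comp (contDiff_id.prodMk contDiff_const : ContDiff ℝ ∞ fun x : Pos d => (x, (0 : Pos d)))
      convert h2 using 1
      funext x
      simp [RelaxationBoltzmann.average, convolution_def, Complex.real_smul]
    · by_contra hne
      exact hy ⟨(x, -y), subset_tsupport _ hne, by simp⟩
    · rw [Set.univ_prod_univ, contDiffOn_univ]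
      exact hψ.smooth.comp (contDiff_fst.prodMk contDiff_snd.neg)
  · have : ∀ v, ψ (x, v) = 0 := fun v => by
      by_contra hne
      exact hx ⟨(x, v), subset_tsupport _ hne, rfl⟩
    simp [RelaxationBoltzmann.average, this]

/-- Fubini for functions of the position against functions on phase space. -/
theorem integral_conj_fst_mul (hV : IsConfining V) {u : Pos d → ℂ} (hu : IsTest u)
    {a : Phase d → ℂ} (ha : IsTempered a) :
    ∫ z : Phase d, (maxwellian V z : ℂ) * (starRingEnd ℂ (u z.1) * a z)
      = ∫ x, (spatialMaxwellian V x : ℂ) * (starRingEnd ℂ (u x) * average a x) := by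
  have hi := (hu.tempered_fst.conj.mul ha).integrable hV
  rw [Measure.volume_eq_prod] at hi ⊢
  rw [integral_prod _ hi]
  refine integral_congr_ae (Eventually.of_forall fun x => ?_)
  simp only [average]
  rw [← integral_const_mul, ← integral_const_mul]
  refine integral_congr_ae (Eventually.of_forall fun v => ?_)
  simp only [maxwellian, Complex.ofReal_mul]
  ring

theorem average_fst (u : Pos d → ℂ) (x : Pos d) : average (fun z => u z.1) x = u x := by
  simp only [average]
  rw [integral_mul_const, integral_complex_ofReal, integral_velocityMaxwellian]
  simp

theorem starProjection_macroSpace (hV : IsConfining V) {a : Phase d → ℂ} (ha : IsTempered a)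
    (hav : IsTest (average a)) {e f : B2 V} (he : Represents V e a)
    (hf : Represents V f fun z => average a z.1) : (macroSpace V).starProjection e = f := by
  refine starProjection_macroSpace_eq (mem_macroSpace hav hf) fun u g hu hg => ?_
  rw [hg.inner_eq' hV he, hg.inner_eq' hV hf, integral_conj_fst_mul hV hu ha,
    integral_conj_fst_mul hV hu hav.tempered_fst]
  simp_rw [average_fst]

/-- `∑ ∂ⱼ* ∂ⱼ` in position. -/
def posOp (V : Pos d → ℝ) (u : Pos d → ℂ) (x : Pos d) : ℂ :=
  ∑ j, (((∇ V x) j : ℂ) * fderiv ℝ u x (EuclideanSpace.single j 1)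
    - fderiv ℝ (fun y => fderiv ℝ u y (EuclideanSpace.single j 1)) x (EuclideanSpace.single j 1))

theorem IsTest.posOp (hV : IsConfining V) {u : Pos d → ℂ} (hu : IsTest u) : IsTest (posOp V u) :=
  IsTest.sum _ fun j _ => ((hu.fderiv_apply _).mul_left
    (contDiff_gradient_apply hV j).complex_ofReal).sub ((hu.fderiv_apply _).fderiv_apply _)

theorem fderiv_fst_dir_inl {u : Pos d → ℂ} (hu : ContDiff ℝ ∞ u) (z : Phase d) (j : Fin d) :
    fderiv ℝ (fun z : Phase d => u z.1) z (dir (.inl j))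
      = fderiv ℝ u z.1 (EuclideanSpace.single j 1) :=
  fderiv_comp_fst_apply (hu.differentiableAt' _) _

theorem fderiv_fst_dir_inr {u : Pos d → ℂ} (hu : ContDiff ℝ ∞ u) (z : Phase d) (j : Fin d) :
    fderiv ℝ (fun z : Phase d => u z.1) z (dir (.inr j)) = 0 :=
  (fderiv_comp_fst_apply (hu.differentiableAt' _) _).trans (by simp [dir])

theorem ellipticOp_fst {u : Pos d → ℂ} (hu : ContDiff ℝ ∞ u) (z : Phase d) :
    ellipticOp V (fun z => u z.1) z = posOp V u z.1 := by
  rw [ellipticOp, Fintype.sum_sum_type]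
  simp only [fderiv_fst_dir_inr hu, fderiv_fst_dir_inl hu]
  simp only [fderiv_fst_dir_inl (hu.fderiv_apply_const _)]
  simp [posOp, drift]

theorem mem_ellipticGraph_fst (hV : IsConfining V) {u : Pos d → ℂ} (hu : IsTest u)
    {p : B2 V × B2 V} (h1 : Represents V p.1 fun z => u z.1)
    (h2 : Represents V p.2 fun z => posOp V u z.1) : p ∈ ellipticGraph V := by
  refine mem_ellipticGraph hV (contDiff_comp_fst hu.smooth) h1
    (h2.congr fun z => (ellipticOp_fst hu.smooth z).symm) fun i => ?_
  cases i with
  | inl j =>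
    obtain ⟨e, he⟩ := (hu.fderiv_apply (EuclideanSpace.single j 1)).tempered_fst.exists_represents hV
    exact ⟨e, he.congr fun z => (fderiv_fst_dir_inl hu.smooth z j).symm⟩
  | inr j => exact ⟨0, Represents.zero.congr fun z => (fderiv_fst_dir_inr hu.smooth z j).symm⟩

theorem starProjection_ellipticOp (hV : IsConfining V) {ψ : Phase d → ℂ} (hψ : IsTest ψ)
    {e f : B2 V} (he : Represents V e (ellipticOp V ψ))
    (hf : Represents V f fun z => posOp V (average ψ) z.1) :
    (macroSpace V).starProjection e = f := by
  refine starProjection_macroSpace_eq (mem_macroSpace (hψ.average.posOp hV) hf) fun u g hu hg => ?_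
  obtain ⟨g', hg'⟩ := (hu.posOp hV).tempered_fst.exists_represents hV
  obtain ⟨k, hk⟩ := hψ.tempered.exists_represents hV
  obtain ⟨k', hk'⟩ := hψ.average.tempered_fst.exists_represents hV
  have h1 := ellipticGraph_symm hV (mem_ellipticGraph_fst hV hu (p := (g, g')) hg hg')
    (subset_closure ⟨ψ, hψ, hk, he⟩ : (k, e) ∈ ellipticGraph V)
  have h2 := ellipticGraph_symm hV (mem_ellipticGraph_fst hV hu (p := (g, g')) hg hg')
    (mem_ellipticGraph_fst hV hψ.average (p := (k', f)) hk' hf)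
  simp only at h1 h2
  rw [← h1, ← h2, hg'.inner_eq' hV hk, hg'.inner_eq' hV hk',
    integral_conj_fst_mul hV (hu.posOp hV) hψ.tempered,
    integral_conj_fst_mul hV (hu.posOp hV) hψ.average.tempered_fst]
  simp_rw [average_fst]

theorem macroSpace_subset_closure_one_add_posOp (hV : IsConfining V) {γ α : ℝ} (hγ : 0 < γ)
    (hα : HasSpectralGap γ V α) {h : B2 V} (hh : h ∈ macroSpace V) :
    h ∈ closure {w | ∃ u : Pos d → ℂ, IsTest u ∧ Represents V w fun z => u z.1 + posOp V u z.1} := by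
  have hγ' : (γ : ℂ) ≠ 0 := by exact_mod_cast hγ.ne'
  obtain ⟨R, hR, -⟩ := hα.isResolventPoint (c := -γ) (by linarith) (by linarith [hα.1])
  have h1 := (mem_closedGraph_iff hV hγ.ne').1 (hR ((γ : ℂ) • h))
  have hsum : R ((γ : ℂ) • h) + (γ : ℂ)⁻¹ • ((γ : ℂ) • h + ((-γ : ℝ) : ℂ) • R ((γ : ℂ) • h)) = h := by
    rw [smul_add, inv_smul_smul₀ hγ', smul_smul]
    push_cast
    rw [mul_neg, inv_mul_cancel₀ hγ', neg_smul, one_smul]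
    abel
  set S := {w : B2 V | ∃ u : Pos d → ℂ, IsTest u ∧ Represents V w fun z => u z.1 + posOp V u z.1}
  have hP : (macroSpace V).starProjection h = h := Submodule.starProjection_eq_self_iff.2 hh
  have key : ∀ p ∈ ellipticGraph V, (macroSpace V).starProjection (p.1 + p.2) ∈ closure S :=
    fun p hp => by
    refine ellipticGraph_induction (P := fun p => (macroSpace V).starProjection (p.1 + p.2) ∈ closure S)
      (isClosed_closure.preimage ((macroSpace V).starProjection.continuous.comp (by fun_prop)))
      (fun p φ hφ h1 h2 => subset_closure ?_) hp
    obtain ⟨k, hk⟩ := hφ.average.tempered_fst.exists_represents hV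
    obtain ⟨k', hk'⟩ := (hφ.average.posOp hV).tempered_fst.exists_represents hV
    refine ⟨_, hφ.average, ?_⟩
    rw [map_add, starProjection_macroSpace hV hφ.tempered hφ.average h1 hk,
      starProjection_ellipticOp hV hφ h2 hk']
    exact hk.add hk'
  have := key _ h1
  simp only at this
  rwa [hsum, hP] at this

end RelaxationBoltzmann

end

open MeasureTheory Filter Topology
open scoped ContDiff Gradient NNReal

noncomputable section

namespace RelaxationBoltzmann

variable {d : ℕ} {V : Pos d → ℝ}

/-! ### The Bochner identity in position -/

/-- The partial derivatives in position. -/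
def pderiv (j : Fin d) (u : Pos d → ℂ) (x : Pos d) : ℂ := fderiv ℝ u x (EuclideanSpace.single j 1)

/-- The Hessian of the potential. -/
def hessian (V : Pos d → ℝ) (i j : Fin d) (x : Pos d) : ℝ :=
  fderiv ℝ (fun y => (∇ V y) i) x (EuclideanSpace.single j 1)

theorem _root_.ContDiff.pderiv {u : Pos d → ℂ} (hu : ContDiff ℝ ∞ u) (j : Fin d) :
    ContDiff ℝ ∞ (pderiv j u) := hu.fderiv_apply_const _

theorem IsTest.pderiv {u : Pos d → ℂ} (hu : IsTest u) (j : Fin d) : IsTest (pderiv j u) :=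
  hu.fderiv_apply _

theorem pderiv_comm {u : Pos d → ℂ} (hu : ContDiff ℝ ∞ u) (i j : Fin d) :
    pderiv i (pderiv j u) = pderiv j (pderiv i u) :=
  funext fun x => fderiv_fderiv_comm hu x _ _

theorem posOp_eq (u : Pos d → ℂ) (x : Pos d) :
    posOp V u x = ∑ j, (((∇ V x) j : ℂ) * pderiv j u x - pderiv j (pderiv j u) x) := rfl

theorem contDiff_hessian (hV : IsConfining V) (i j : Fin d) : ContDiff ℝ ∞ (hessian V i j) :=
  (contDiff_gradient_apply hV i).fderiv_apply_const _

theorem abs_hessian_le (hV : IsConfining V) {C₂ : ℝ} (hC : ∀ x, ‖iteratedFDeriv ℝ 2 V x‖ ≤ C₂)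
    (i j : Fin d) (x : Pos d) : |hessian V i j x| ≤ C₂ := by
  have h1 : (fun y => (∇ V y) i) = fun y => fderiv ℝ V y (EuclideanSpace.single i 1) :=
    funext fun y => gradient_apply_eq hV y i
  have hd : DifferentiableAt ℝ (fderiv ℝ V) x :=
    (hV.smooth.fderiv_right (m := ∞) (by norm_cast)).differentiableAt' x
  have h2 : hessian V i j x
      = fderiv ℝ (fderiv ℝ V) x (EuclideanSpace.single j 1) (EuclideanSpace.single i 1) := by
    rw [hessian, h1, fderiv_clm_apply hd (differentiableAt_const _)]
    simp
  rw [h2, ← Real.norm_eq_abs]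
  refine ((fderiv ℝ (fderiv ℝ V) x).le_opNorm₂ _ _).trans ?_
  rw [norm_fderiv_fderiv_eq]
  simpa using hC x

theorem integral_spatial_adjoint (hV : IsConfining V) {a b : Pos d → ℂ} (ha : IsTest a)
    (hb : ContDiff ℝ ∞ b) (j : Fin d) :
    ∫ x, (spatialMaxwellian V x : ℂ) * (a x * ((∇ V x) j * b x - pderiv j b x))
      = ∫ x, (spatialMaxwellian V x : ℂ) * (pderiv j a x * b x) :=
  integral_density_mul_fderiv_mul (μ := volume) (contDiff_spatialMaxwellian hV)
    (contDiff_gradient_apply hV j) (fun x => fderiv_spatialMaxwellian hV x j) ha hb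

theorem IsTest.integrable_spatial (hV : IsConfining V) {a : Pos d → ℂ} (ha : IsTest a) :
    Integrable fun x => (spatialMaxwellian V x : ℂ) * a x :=
  ha.integrable_mul (contDiff_spatialMaxwellian hV).complex_ofReal.continuous

theorem pderiv_conj (j : Fin d) (u : Pos d → ℂ) (x : Pos d) :
    pderiv j (fun x => starRingEnd ℂ (u x)) x = starRingEnd ℂ (pderiv j u x) :=
  fderiv_conj_apply _ _ _

theorem integral_conj_mul_posOp (hV : IsConfining V) {a b : Pos d → ℂ} (ha : IsTest a)
    (hb : ContDiff ℝ ∞ b) :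
    ∫ x, (spatialMaxwellian V x : ℂ) * (a x * posOp V b x)
      = ∑ j, ∫ x, (spatialMaxwellian V x : ℂ) * (pderiv j a x * pderiv j b x) := by
  simp_rw [posOp_eq, Finset.mul_sum]
  rw [integral_finsetSum]
  · exact Finset.sum_congr rfl fun j _ => integral_spatial_adjoint hV ha (hb.pderiv j) j
  · exact fun j _ => (ha.mul_right (((contDiff_gradient_apply hV j).complex_ofReal.mul
      (hb.pderiv j)).sub ((hb.pderiv j).pderiv j))).integrable_spatial hV

theorem conj_posOp (u : Pos d → ℂ) (x : Pos d) :
    posOp V (fun x => starRingEnd ℂ (u x)) x = starRingEnd ℂ (posOp V u x) := by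
  have h : ∀ j, pderiv j (fun x => starRingEnd ℂ (u x)) = fun x => starRingEnd ℂ (pderiv j u x) :=
    fun j => funext fun x => pderiv_conj j u x
  simp_rw [posOp_eq, h, pderiv_conj, map_sum, map_sub, map_mul, Complex.conj_ofReal]

theorem pderiv_posOp (hV : IsConfining V) {u : Pos d → ℂ} (hu : IsTest u) (j : Fin d) (x : Pos d) :
    pderiv j (posOp V u) x
      = posOp V (pderiv j u) x + ∑ i, (hessian V i j x : ℂ) * pderiv i u x := by
  have e : posOp V u = fun x => ∑ i, (((∇ V x) i : ℂ) * pderiv i u x - pderiv i (pderiv i u) x) :=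
    funext fun x => posOp_eq u x
  have hg := fun i => (contDiff_gradient_apply hV i)
  have h1 : ∀ i, ContDiff ℝ ∞ fun x => ((∇ V x) i : ℂ) * pderiv i u x := fun i =>
    (hg i).complex_ofReal.mul (hu.smooth.pderiv i)
  have h2 : ∀ i, ContDiff ℝ ∞ (pderiv i (pderiv i u)) := fun i => (hu.smooth.pderiv i).pderiv i
  rw [e, pderiv, fderiv_fun_sum fun i _ => ((h1 i).sub (h2 i)).differentiableAt' x, posOp_eq,
    ← Finset.sum_add_distrib, sum_apply]
  refine Finset.sum_congr rfl fun i _ => ?_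
  rw [fderiv_fun_sub ((h1 i).differentiableAt' x) ((h2 i).differentiableAt' x), sub_apply,
    fderiv_mul_apply' ((hg i).complex_ofReal.differentiableAt' x)
      ((hu.smooth.pderiv i).differentiableAt' x),
    fderiv_ofReal_apply ((hg i).differentiableAt' x)]
  have c1 : fderiv ℝ (pderiv i u) x (EuclideanSpace.single j 1) = pderiv i (pderiv j u) x :=
    congrFun (pderiv_comm hu.smooth j i) x
  have c2 : fderiv ℝ (pderiv i (pderiv i u)) x (EuclideanSpace.single j 1)
      = pderiv i (pderiv i (pderiv j u)) x := by
    have := congrFun (pderiv_comm (hu.smooth.pderiv i) j i) x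
    rw [pderiv_comm hu.smooth j i] at this
    exact this
  rw [c1, c2, hessian]
  ring

theorem integral_norm_sq_eq (a : Pos d → ℂ) :
    (∫ x, (spatialMaxwellian V x : ℂ) * (starRingEnd ℂ (a x) * a x)).re
      = ∫ x, spatialMaxwellian V x * ‖a x‖ ^ 2 := by
  have : ∀ x, (spatialMaxwellian V x : ℂ) * (starRingEnd ℂ (a x) * a x)
      = ((spatialMaxwellian V x * ‖a x‖ ^ 2 : ℝ) : ℂ) := fun x => by
    rw [← Complex.normSq_eq_conj_mul_self, Complex.normSq_eq_norm_sq, ← Complex.ofReal_mul]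
  simp_rw [this]
  rw [integral_complex_ofReal, Complex.ofReal_re]

theorem IsTest.integrable_norm_sq (hV : IsConfining V) {a : Pos d → ℂ} (ha : IsTest a) :
    Integrable fun x => spatialMaxwellian V x * ‖a x‖ ^ 2 := by
  have := ((ha.conj.mul_right ha.smooth).integrable_spatial hV).re
  refine this.congr (Eventually.of_forall fun x => ?_)
  simp only
  rw [← Complex.normSq_eq_conj_mul_self, Complex.normSq_eq_norm_sq, ← Complex.ofReal_mul]
  rfl

theorem sum_integral_norm_pderiv_sq (hV : IsConfining V) {u : Pos d → ℂ} (hu : IsTest u) :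
    ∑ j, ∫ x, spatialMaxwellian V x * ‖pderiv j u x‖ ^ 2
      = (∫ x, (spatialMaxwellian V x : ℂ) * (starRingEnd ℂ (u x) * posOp V u x)).re := by
  rw [integral_conj_mul_posOp hV hu.conj hu.smooth, Complex.re_sum]
  simp_rw [pderiv_conj, integral_norm_sq_eq]

/-- The `H²` estimate. -/
theorem sum_integral_norm_pderiv_pderiv_sq_le (hV : IsConfining V) {C₂ : ℝ}
    (hC : ∀ x, ‖iteratedFDeriv ℝ 2 V x‖ ≤ C₂) {u : Pos d → ℂ} (hu : IsTest u) :
    ∑ j, ∑ i, ∫ x, spatialMaxwellian V x * ‖pderiv i (pderiv j u) x‖ ^ 2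
      ≤ (∫ x, spatialMaxwellian V x * ‖posOp V u x‖ ^ 2)
        + C₂ * d * ∑ j, ∫ x, spatialMaxwellian V x * ‖pderiv j u x‖ ^ 2 := by
  have hC0 : 0 ≤ C₂ := (norm_nonneg _).trans (hC 0)
  have hL := hu.posOp hV
  have hhess : ∀ i j, IsTest fun x => starRingEnd ℂ (pderiv j u x) *
      ((hessian V i j x : ℂ) * pderiv i u x) := fun i j =>
    (hu.pderiv j).conj.mul_right ((contDiff_hessian hV i j).complex_ofReal.mul (hu.smooth.pderiv i))
  have h1 : ∀ j, ∑ i, ∫ x, (spatialMaxwellian V x : ℂ) *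
        (starRingEnd ℂ (pderiv i (pderiv j u) x) * pderiv i (pderiv j u) x)
      = (∫ x, (spatialMaxwellian V x : ℂ) * (pderiv j (posOp V u) x *
          pderiv j (fun x => starRingEnd ℂ (u x)) x))
        - ∑ i, ∫ x, (spatialMaxwellian V x : ℂ) * (starRingEnd ℂ (pderiv j u x) *
          ((hessian V i j x : ℂ) * pderiv i u x)) := fun j => by
    have e1 := integral_conj_mul_posOp hV (hu.pderiv j).conj (hu.smooth.pderiv j)
    simp_rw [pderiv_conj] at e1
    rw [← e1, ← integral_finsetSum _ fun i _ => (hhess i j).integrable_spatial hV, ← integral_sub]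
    · refine integral_congr_ae (Eventually.of_forall fun x => ?_)
      simp only
      rw [pderiv_posOp hV hu, pderiv_conj, ← Finset.mul_sum, ← Finset.mul_sum]
      ring
    · exact ((hL.pderiv j).mul_right (hu.conj.smooth.pderiv j)).integrable_spatial hV
    · exact integrable_finsetSum _ fun i _ => (hhess i j).integrable_spatial hV
  have h2 := integral_conj_mul_posOp hV hL hu.conj.smooth
  have h3 : ∑ j, ∑ i, ∫ x, spatialMaxwellian V x * ‖pderiv i (pderiv j u) x‖ ^ 2
      = (∫ x, spatialMaxwellian V x * ‖posOp V u x‖ ^ 2) - ∑ j, ∑ i,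
        (∫ x, (spatialMaxwellian V x : ℂ) * (starRingEnd ℂ (pderiv j u x) *
          ((hessian V i j x : ℂ) * pderiv i u x))).re := by
    have e1 := congrArg Complex.re (Finset.sum_congr rfl fun j (_ : j ∈ Finset.univ) => h1 j)
    rw [Finset.sum_sub_distrib, ← h2] at e1
    simp only [Complex.sub_re, Complex.re_sum, integral_norm_sq_eq] at e1
    rw [e1, ← integral_norm_sq_eq]
    congr 2
    refine integral_congr_ae (Eventually.of_forall fun x => ?_)
    simp only
    rw [conj_posOp]
    ring
  have hi := fun j => (hu.pderiv j).integrable_norm_sq hV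
  have h4 : ∀ i j, -(∫ x, (spatialMaxwellian V x : ℂ) * (starRingEnd ℂ (pderiv j u x) *
          ((hessian V i j x : ℂ) * pderiv i u x))).re
      ≤ C₂ / 2 * ((∫ x, spatialMaxwellian V x * ‖pderiv j u x‖ ^ 2)
        + ∫ x, spatialMaxwellian V x * ‖pderiv i u x‖ ^ 2) := fun i j => by
    rw [← integral_add (hi j) (hi i), ← integral_const_mul]
    refine (neg_le_abs _).trans ((Complex.abs_re_le_norm _).trans ?_)
    refine norm_integral_le_of_norm_le (((hi j).add (hi i)).const_mul _)
      (Eventually.of_forall fun x => ?_)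
    have hρ := (spatialMaxwellian_pos hV x).le
    simp only [norm_mul, Complex.norm_real, Real.norm_of_nonneg hρ, RCLike.norm_conj]
    have hh : ‖hessian V i j x‖ ≤ C₂ := abs_hessian_le hV hC i j x
    have a1 : ‖pderiv j u x‖ * (‖hessian V i j x‖ * ‖pderiv i u x‖)
        ≤ ‖pderiv j u x‖ * (C₂ * ‖pderiv i u x‖) := by gcongr
    have a2 : ‖pderiv j u x‖ * (C₂ * ‖pderiv i u x‖)
        ≤ C₂ / 2 * (‖pderiv j u x‖ ^ 2 + ‖pderiv i u x‖ ^ 2) := by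
      nlinarith [mul_nonneg hC0 (sq_nonneg (‖pderiv j u x‖ - ‖pderiv i u x‖))]
    calc spatialMaxwellian V x * (‖pderiv j u x‖ * (‖hessian V i j x‖ * ‖pderiv i u x‖))
        ≤ spatialMaxwellian V x * (C₂ / 2 * (‖pderiv j u x‖ ^ 2 + ‖pderiv i u x‖ ^ 2)) := by
          exact mul_le_mul_of_nonneg_left (a1.trans a2) hρ
      _ = _ := by ring
  rw [h3, sub_eq_add_neg, ← Finset.sum_neg_distrib]
  simp_rw [← Finset.sum_neg_distrib]
  gcongr
  refine (Finset.sum_le_sum fun j _ => Finset.sum_le_sum fun i _ => h4 i j).trans (le_of_eq ?_)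
  simp_rw [← Finset.mul_sum, Finset.sum_add_distrib, Finset.sum_const, Finset.card_univ,
    Fintype.card_fin, nsmul_eq_mul, ← Finset.mul_sum]
  ring

/-! ### Second order transport of functions of the position -/

theorem transport_fst {u : Pos d → ℂ} (hu : ContDiff ℝ ∞ u) (z : Phase d) :
    transport V (fun z => u z.1) z = ∑ j, (z.2 j : ℂ) * pderiv j u z.1 := by
  rw [transport_eq_sum]
  simp [fderiv_fst_dir_inl hu, fderiv_fst_dir_inr hu, pderiv]

theorem transport_transport_fst {u : Pos d → ℂ} (hu : ContDiff ℝ ∞ u)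
    (z : Phase d) : transport V (transport V fun z => u z.1) z
      = ∑ j, (∑ i, (z.2 i : ℂ) * (z.2 j : ℂ) * pderiv i (pderiv j u) z.1
        - ((∇ V z.1) j : ℂ) * pderiv j u z.1) := by
  have e : (transport V fun z : Phase d => u z.1)
      = fun z => ∑ j, (z.2 j : ℂ) * pderiv j u z.1 := funext fun z => transport_fst hu z
  have hs : ∀ j, ContDiff ℝ ∞ fun z : Phase d => pderiv j u z.1 := fun j =>
    contDiff_comp_fst (hu.pderiv j)
  rw [e, transport, fderiv_fun_sum fun j _ =>
    ((contDiff_velocity j).mul (hs j)).differentiableAt' z, sum_apply]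
  refine Finset.sum_congr rfl fun j _ => ?_
  rw [fderiv_mul_apply' ((contDiff_velocity j).differentiableAt' z) ((hs j).differentiableAt' z),
    fderiv_velocity_apply]
  have := transport_fst (V := V) (hu.pderiv j) z
  rw [transport] at this
  rw [this, Finset.mul_sum]
  simp only [PiLp.neg_apply, Complex.ofReal_neg, neg_mul, ← sub_eq_add_neg]
  congr 1
  exact Finset.sum_congr rfl fun i _ => by ring

theorem transport_transport_fst' {u : Pos d → ℂ} (hu : ContDiff ℝ ∞ u)
    (z : Phase d) : transport V (transport V fun z => u z.1) z
      = (∑ j, ∑ i, ((z.2 i : ℂ) * (z.2 j : ℂ) - if i = j then 1 else 0) *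
        pderiv i (pderiv j u) z.1) - posOp V u z.1 := by
  rw [transport_transport_fst hu, posOp_eq, ← Finset.sum_sub_distrib]
  refine Finset.sum_congr rfl fun j _ => ?_
  simp_rw [sub_mul, Finset.sum_sub_distrib, ite_mul, one_mul, zero_mul]
  rw [Finset.sum_ite_eq' Finset.univ j]
  simp

theorem integrable_velocityMaxwellian_mul {a : Pos d → ℂ} (ha : Continuous a) {C : ℝ} {k : ℕ}
    (hle : ∀ v, ‖a v‖ ≤ C * (1 + ‖v‖) ^ k) :
    Integrable fun v => (velocityMaxwellian v : ℂ) * a v := by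
  have hc := (contDiff_velocityMaxwellian (d := d)).continuous
  refine ((integrable_one_add_norm_pow_mul_velocityMaxwellian (d := d) k).const_mul C).mono'
    (Continuous.aestronglyMeasurable (by fun_prop)) (Eventually.of_forall fun v => ?_)
  rw [norm_mul, Complex.norm_real, Real.norm_of_nonneg (velocityMaxwellian_pos v).le, mul_comm,
    ← mul_assoc]
  exact mul_le_mul_of_nonneg_right (hle v) (velocityMaxwellian_pos v).le

theorem norm_velocity_le (v : Pos d) (j : Fin d) : ‖(v j : ℂ)‖ ≤ 1 + ‖v‖ := by
  rw [Complex.norm_real]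
  linarith [PiLp.norm_apply_le v j]

theorem norm_velocity_mul_le (v : Pos d) (i j : Fin d) :
    ‖(v i : ℂ) * (v j : ℂ)‖ ≤ ‖v‖ ^ 2 := by
  rw [norm_mul, Complex.norm_real, Complex.norm_real, sq]
  exact mul_le_mul (PiLp.norm_apply_le v i) (PiLp.norm_apply_le v j) (norm_nonneg _) (norm_nonneg _)

theorem integral_velocity (j : Fin d) : ∫ v : Pos d, (velocityMaxwellian v : ℂ) * (v j : ℂ) = 0 := by
  have := integral_density_mul_fderiv (μ := volume) (contDiff_velocityMaxwellian (d := d))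
    (fun v => fderiv_velocityMaxwellian v j) (a := fun _ => 1) contDiff_const
    (integrable_velocityMaxwellian_mul (C := 1) (k := 0) continuous_const (by simp)) (by simp)
    (integrable_velocityMaxwellian_mul (C := 1) (k := 1) (by fun_prop) fun v => by
      simpa using norm_velocity_le v j)
  simpa using this.symm

theorem integral_velocity_mul (i j : Fin d) :
    ∫ v : Pos d, (velocityMaxwellian v : ℂ) * ((v i : ℂ) * (v j : ℂ)) = if i = j then 1 else 0 := by
  have hd : ∀ v : Pos d, fderiv ℝ (fun v : Pos d => (v j : ℂ)) v (EuclideanSpace.single i 1)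
      = if i = j then 1 else 0 := fun v => by
    have h2 := (EuclideanSpace.proj (𝕜 := ℝ) j).hasFDerivAt (x := v)
    have h3 : fderiv ℝ (fun v : Pos d => v j) v = EuclideanSpace.proj (𝕜 := ℝ) j := h2.fderiv
    have h4 : DifferentiableAt ℝ (fun v : Pos d => v j) v := h2.differentiableAt
    rw [fderiv_ofReal_apply h4, h3]
    by_cases hij : i = j <;> simp [hij, Ne.symm]
  have := integral_density_mul_fderiv (μ := volume) (contDiff_velocityMaxwellian (d := d))
    (fun v => fderiv_velocityMaxwellian v i) (a := fun v => (v j : ℂ))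
    ((EuclideanSpace.proj (𝕜 := ℝ) j).contDiff).complex_ofReal
    (integrable_velocityMaxwellian_mul (C := 1) (k := 1) (by fun_prop) fun v => by
      simpa using norm_velocity_le v j) ?_
    (integrable_velocityMaxwellian_mul (C := 1) (k := 2) (by fun_prop) fun v => ?_)
  · rw [← this]
    simp_rw [hd]
    rw [integral_mul_const, integral_complex_ofReal, integral_velocityMaxwellian]
    simp
  · simp_rw [hd]
    exact integrable_velocityMaxwellian_mul (C := 1) (k := 0) continuous_const fun v => by
      split <;> simp
  · refine (norm_velocity_mul_le v i j).trans ?_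
    rw [one_mul]
    gcongr
    linarith

theorem average_sum {ι : Type*} (s : Finset ι) {a : ι → Phase d → ℂ} {x : Pos d}
    (ha : ∀ i ∈ s, Integrable fun v => (velocityMaxwellian v : ℂ) * a i (x, v)) :
    average (fun z => ∑ i ∈ s, a i z) x = ∑ i ∈ s, average (a i) x := by
  simp only [average, Finset.mul_sum]
  exact integral_finsetSum _ ha

theorem average_transport_fst {u : Pos d → ℂ} (hu : ContDiff ℝ ∞ u) (x : Pos d) :
    average (transport V fun z => u z.1) x = 0 := by
  have e : (transport V fun z : Phase d => u z.1)
      = fun z => ∑ j, (z.2 j : ℂ) * pderiv j u z.1 := funext fun z => transport_fst hu z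
  rw [e, average_sum]
  · refine Finset.sum_eq_zero fun j _ => ?_
    simp only [average, ← mul_assoc]
    rw [integral_mul_const, integral_velocity, zero_mul]
  · intro j _
    simp only [← mul_assoc]
    exact (integrable_velocityMaxwellian_mul (C := 1) (k := 1) (by fun_prop) fun v => by
      simpa using norm_velocity_le v j).mul_const _

theorem average_transport_transport_fst {u : Pos d → ℂ} (hu : ContDiff ℝ ∞ u)
    (x : Pos d) : average (transport V (transport V fun z => u z.1)) x = -posOp V u x := by
  have i0 : ∀ c : ℂ, Integrable fun v : Pos d => (velocityMaxwellian v : ℂ) * c := fun c =>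
    integrable_velocityMaxwellian_mul (C := ‖c‖) (k := 0) continuous_const (by simp)
  have i2 : ∀ i j : Fin d, Integrable fun v : Pos d =>
      (velocityMaxwellian v : ℂ) * ((v i : ℂ) * (v j : ℂ)) := fun i j =>
    integrable_velocityMaxwellian_mul (C := 1) (k := 2) (by fun_prop) fun v => by
      refine (norm_velocity_mul_le v i j).trans ?_
      rw [one_mul]
      gcongr
      linarith
  have i3 : ∀ (i j : Fin d) (c : ℂ), Integrable fun v : Pos d =>
      (velocityMaxwellian v : ℂ) * ((v i : ℂ) * (v j : ℂ) * c) := fun i j c => by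
    simpa only [← mul_assoc] using (i2 i j).mul_const c
  have i4 : ∀ j : Fin d, Integrable fun v : Pos d => (velocityMaxwellian v : ℂ) *
      ∑ i, (v i : ℂ) * (v j : ℂ) * pderiv i (pderiv j u) x := fun j => by
    simp only [Finset.mul_sum]
    exact integrable_finsetSum _ fun i _ => i3 i j _
  have e : (transport V (transport V fun z : Phase d => u z.1))
      = fun z => ∑ j, (∑ i, (z.2 i : ℂ) * (z.2 j : ℂ) * pderiv i (pderiv j u) z.1
        - ((∇ V z.1) j : ℂ) * pderiv j u z.1) := funext fun z => transport_transport_fst hu z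
  rw [e, average_sum]
  · rw [posOp_eq, ← Finset.sum_neg_distrib]
    refine Finset.sum_congr rfl fun j _ => ?_
    simp only [average, mul_sub]
    rw [integral_sub (i4 j) (i0 _), integral_mul_const, integral_complex_ofReal,
      integral_velocityMaxwellian]
    simp only [Finset.mul_sum]
    rw [integral_finsetSum _ fun i _ => i3 i j _]
    have : ∀ i, ∫ v : Pos d, (velocityMaxwellian v : ℂ) *
        ((v i : ℂ) * (v j : ℂ) * pderiv i (pderiv j u) x)
        = (if i = j then 1 else 0) * pderiv i (pderiv j u) x := fun i => by
      rw [← integral_velocity_mul i j, ← integral_mul_const]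
      simp only [mul_assoc]
    simp_rw [this, ite_mul, one_mul, zero_mul]
    rw [Finset.sum_ite_eq' Finset.univ j]
    simp
  · intro j _
    simp only [mul_sub]
    exact (i4 j).sub (i0 _)

/-! ### The elliptic estimate for `X² u` -/

theorem isTempered_transport_fst {u : Pos d → ℂ} (hu : IsTest u) :
    IsTempered (transport V fun z => u z.1) := by
  have e : (transport V fun z : Phase d => u z.1)
      = fun z => ∑ j, (z.2 j : ℂ) * pderiv j u z.1 := funext fun z => transport_fst hu.smooth z
  rw [e]
  exact IsTempered.sum _ fun j _ => (IsTempered.velocity j).mul (hu.pderiv j).tempered_fst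

theorem isTempered_quadratic_fst {u : Pos d → ℂ} (hu : IsTest u) (i j : Fin d) :
    IsTempered fun z : Phase d =>
      ((z.2 i : ℂ) * (z.2 j : ℂ) - if i = j then 1 else 0) * pderiv i (pderiv j u) z.1 :=
  (((IsTempered.velocity i).mul (IsTempered.velocity j)).sub (IsTempered.const _)).mul
    ((hu.pderiv j).pderiv i).tempered_fst

theorem isTempered_transport_transport_fst (hV : IsConfining V) {u : Pos d → ℂ} (hu : IsTest u) :
    IsTempered (transport V (transport V fun z => u z.1)) := by
  rw [funext fun z => transport_transport_fst' (V := V) hu.smooth z]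
  exact (IsTempered.sum _ fun j _ => IsTempered.sum _ fun i _ =>
    isTempered_quadratic_fst hu i j).sub (hu.posOp hV).tempered_fst

theorem norm_sq_le_of_quadratic_bound (hV : IsConfining V) {e : B2 V} {a : Phase d → ℂ}
    {b : Pos d → ℂ} (he : Represents V e a) (hb : IsTest b)
    (hle : ∀ z, ‖a z‖ ≤ (1 + ‖z.2‖) ^ 2 * ‖b z.1‖) :
    ‖e‖ ^ 2 ≤ (∫ v : Pos d, (1 + ‖v‖) ^ 4 * velocityMaxwellian v)
      * ∫ x, spatialMaxwellian V x * ‖b x‖ ^ 2 := by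
  have hi := (hb.integrable_norm_sq hV).mul_prod
    (integrable_one_add_norm_pow_mul_velocityMaxwellian (d := d) 4)
  rw [he.norm_sq hV, mul_comm, ← integral_prod_mul (μ := volume) (ν := volume)
    (fun x => spatialMaxwellian V x * ‖b x‖ ^ 2) fun v : Pos d => (1 + ‖v‖) ^ 4 * velocityMaxwellian v]
  refine integral_mono (he.integrable_normSq hV) hi fun z => ?_
  have hM := maxwellian_nonneg V z
  calc maxwellian V z * ‖a z‖ ^ 2 ≤ maxwellian V z * ((1 + ‖z.2‖) ^ 2 * ‖b z.1‖) ^ 2 := by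
        gcongr; exact hle z
    _ = _ := by simp only [maxwellian]; ring

theorem norm_sq_eq_of_fst (hV : IsConfining V) {e : B2 V} {b : Pos d → ℂ} (hb : IsTest b)
    (he : Represents V e fun z => b z.1) : ‖e‖ ^ 2 = ∫ x, spatialMaxwellian V x * ‖b x‖ ^ 2 := by
  rw [← re_inner_self_eq, he.inner_eq' hV he, integral_conj_fst_mul hV hb hb.tempered_fst]
  simp_rw [average_fst]
  exact integral_norm_sq_eq b

/-- The constant in the bound of `X² u` by `(1 + L) u`. -/
def ellipticConst (d : ℕ) (C₂ : ℝ) : ℝ :=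
  d * (d * Real.sqrt ((∫ v : Pos d, (1 + ‖v‖) ^ 4 * velocityMaxwellian v) * (1 + C₂ * d))) + 1

theorem ellipticConst_nonneg (d : ℕ) (C₂ : ℝ) : 0 ≤ ellipticConst d C₂ := by
  unfold ellipticConst; positivity

theorem norm_transport_transport_le (hV : IsConfining V) {C₂ : ℝ}
    (hC : ∀ x, ‖iteratedFDeriv ℝ 2 V x‖ ≤ C₂) {u : Pos d → ℂ} (hu : IsTest u) {e l x : B2 V}
    (he : Represents V e fun z => u z.1) (hl : Represents V l fun z => posOp V u z.1)
    (hx : Represents V x (transport V (transport V fun z => u z.1))) :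
    ‖x‖ ≤ ellipticConst d C₂ * ‖e + l‖ := by
  have hC0 : 0 ≤ C₂ := (norm_nonneg _).trans (hC 0)
  set m := ∫ v : Pos d, (1 + ‖v‖) ^ 4 * velocityMaxwellian v with hm
  have hm0 : 0 ≤ m := integral_nonneg fun v => by have := velocityMaxwellian_pos v; positivity
  choose q hq using fun i j => (isTempered_quadratic_fst hu i j).exists_represents hV
  have hinner : (inner ℂ e l).re = ∑ j, ∫ x, spatialMaxwellian V x * ‖pderiv j u x‖ ^ 2 := by
    rw [he.inner_eq' hV hl, integral_conj_fst_mul hV hu (hu.posOp hV).tempered_fst,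
      sum_integral_norm_pderiv_sq hV hu]
    simp_rw [average_fst]
  have hin0 : 0 ≤ (inner ℂ e l).re := by
    rw [hinner]
    exact Finset.sum_nonneg fun j _ => integral_nonneg fun x =>
      mul_nonneg (spatialMaxwellian_pos hV x).le (sq_nonneg _)
  have hadd : ‖e + l‖ ^ 2 = ‖e‖ ^ 2 + 2 * (inner ℂ e l).re + ‖l‖ ^ 2 := @norm_add_sq ℂ _ _ _ _ e l
  have hH2 : ∀ i j, ∫ x, spatialMaxwellian V x * ‖pderiv i (pderiv j u) x‖ ^ 2
      ≤ (1 + C₂ * d) * ‖e + l‖ ^ 2 := fun i j => by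
    have h1 := sum_integral_norm_pderiv_pderiv_sq_le hV hC hu
    rw [← hinner, ← norm_sq_eq_of_fst hV (hu.posOp hV) hl] at h1
    have h0 : ∀ i j, 0 ≤ ∫ x, spatialMaxwellian V x * ‖pderiv i (pderiv j u) x‖ ^ 2 := fun i j =>
      integral_nonneg fun x => mul_nonneg (spatialMaxwellian_pos hV x).le (sq_nonneg _)
    have h2 := (Finset.single_le_sum (f := fun i => ∫ x, spatialMaxwellian V x *
      ‖pderiv i (pderiv j u) x‖ ^ 2) (fun i _ => h0 i j) (Finset.mem_univ i)).trans
      (Finset.single_le_sum (f := fun j => ∑ i, ∫ x, spatialMaxwellian V x *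
      ‖pderiv i (pderiv j u) x‖ ^ 2) (fun j _ => Finset.sum_nonneg fun i _ => h0 i j)
      (Finset.mem_univ j))
    have h3 : 0 ≤ C₂ * d := by positivity
    have h4 : C₂ * d * (inner ℂ e l).re ≤ C₂ * d * ‖e + l‖ ^ 2 := by
      gcongr
      nlinarith [sq_nonneg ‖e‖, sq_nonneg ‖l‖]
    nlinarith [sq_nonneg ‖e‖]
  have hqn : ∀ i j, ‖q i j‖ ≤ Real.sqrt (m * (1 + C₂ * d)) * ‖e + l‖ := fun i j => by
    refine abs_le_of_sq_le_sq' ?_ (by positivity) |>.2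
    rw [mul_pow, Real.sq_sqrt (by positivity)]
    refine (norm_sq_le_of_quadratic_bound hV (hq i j) ((hu.pderiv j).pderiv i) fun z => ?_).trans ?_
    · rw [norm_mul]
      gcongr
      have h1 : ‖(if i = j then 1 else 0 : ℂ)‖ ≤ 1 := by split <;> simp
      refine (norm_sub_le _ _).trans ((add_le_add (norm_velocity_mul_le z.2 i j) h1).trans ?_)
      nlinarith [norm_nonneg z.2]
    · rw [mul_assoc]
      exact mul_le_mul_of_nonneg_left (hH2 i j) hm0
  have hsum : Represents V (∑ j, ∑ i, q i j - l) (transport V (transport V fun z => u z.1)) := by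
    have hrep : ∀ (s : Finset (Fin d)) (g : Fin d → B2 V) (a : Fin d → Phase d → ℂ),
        (∀ i, Represents V (g i) (a i)) →
        Represents V (∑ i ∈ s, g i) fun z => ∑ i ∈ s, a i z := by
      classical
      intro s g a h
      induction s using Finset.induction_on with
      | empty => simpa using Represents.zero
      | insert i s hi ih => simpa only [Finset.sum_insert hi] using (h i).add ih
    exact ((hrep _ _ _ fun j => hrep _ _ _ fun i => hq i j).sub hl).congr fun z =>
      (transport_transport_fst' hu.smooth z).symm
  have hle : ‖l‖ ≤ ‖e + l‖ := by
    refine abs_le_of_sq_le_sq' ?_ (norm_nonneg _) |>.2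
    nlinarith [sq_nonneg ‖e‖]
  rw [hx.eq hsum]
  refine (norm_sub_le _ _).trans ?_
  have hs : ‖∑ j, ∑ i, q i j‖ ≤ ∑ _j : Fin d, ∑ _i : Fin d, Real.sqrt (m * (1 + C₂ * d)) * ‖e + l‖ :=
    (norm_sum_le _ _).trans (Finset.sum_le_sum fun j _ => (norm_sum_le _ _).trans
      (Finset.sum_le_sum fun i _ => hqn i j))
  simp only [Finset.sum_const, Finset.card_univ, Fintype.card_fin, nsmul_eq_mul] at hs
  rw [ellipticConst, add_mul, one_mul]
  refine add_le_add (hs.trans (le_of_eq ?_)) hle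
  ring

end RelaxationBoltzmann

end

open MeasureTheory Filter Topology
open scoped ContDiff Gradient NNReal

noncomputable section

namespace RelaxationBoltzmann

variable {d : ℕ} {V : Pos d → ℝ}

/-! ### The macroscopic graph -/

theorem transport_add {a b : Phase d → ℂ} (ha : ContDiff ℝ ∞ a) (hb : ContDiff ℝ ∞ b)
    (z : Phase d) : transport V (fun z => a z + b z) z = transport V a z + transport V b z :=
  fderiv_add_apply' (ha.differentiableAt' z) (hb.differentiableAt' z) _

theorem transport_const_mul {a : Phase d → ℂ} (ha : ContDiff ℝ ∞ a) (c : ℂ) (z : Phase d) :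
    transport V (fun z => c * a z) z = c * transport V a z :=
  fderiv_const_mul_apply' (ha.differentiableAt' z) c _

/-- The graph of `u ↦ (X u, L u, X² u)` on the test functions of the position. -/
def macroGraph (hV : IsConfining V) : Submodule ℂ (B2 V × B2 V × B2 V × B2 V) where
  carrier := {y | ∃ u : Pos d → ℂ, IsTest u ∧ Represents V y.1 (fun z => u z.1) ∧
    Represents V y.2.1 (transport V fun z => u z.1) ∧
    Represents V y.2.2.1 (ellipticOp V fun z => u z.1) ∧
    Represents V y.2.2.2 (transport V (transport V fun z => u z.1))}
  add_mem' := by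
    rintro y y' ⟨u, hu, h1, h2, h3, h4⟩ ⟨w, hw, g1, g2, g3, g4⟩
    have su := contDiff_comp_fst hu.smooth
    have sw := contDiff_comp_fst hw.smooth
    refine ⟨_, hu.add hw, h1.add g1, (h2.add g2).congr fun z => (transport_add su sw z).symm,
      (h3.add g3).congr fun z => (ellipticOp_add su sw z).symm, (h4.add g4).congr fun z => ?_⟩
    rw [← transport_add (contDiff_transport hV su) (contDiff_transport hV sw)]
    exact congrArg (fun a => transport V a z) (funext fun z => (transport_add su sw z).symm)
  zero_mem' := by
    refine ⟨_, IsTest.zero, Represents.zero, Represents.zero.congr fun z => ?_,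
      Represents.zero.congr fun z => ?_, Represents.zero.congr fun z => ?_⟩
    · simp [transport]
    · simp [ellipticOp]
    · have : (transport V fun z : Phase d => (fun _ : Pos d => (0 : ℂ)) z.1) = fun _ => 0 := by
        funext z; simp [transport]
      rw [this]; simp [transport]
  smul_mem' := by
    rintro c y ⟨u, hu, h1, h2, h3, h4⟩
    have su := contDiff_comp_fst hu.smooth
    refine ⟨_, hu.const_mul c, h1.smul c, (h2.smul c).congr fun z => (transport_const_mul su c z).symm,
      (h3.smul c).congr fun z => (ellipticOp_const_mul su c z).symm, (h4.smul c).congr fun z => ?_⟩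
    rw [← transport_const_mul (contDiff_transport hV su)]
    exact congrArg (fun a => transport V a z) (funext fun z => (transport_const_mul su c z).symm)

theorem exists_mem_macroGraph (hV : IsConfining V) {u : Pos d → ℂ} (hu : IsTest u) :
    ∃ y ∈ macroGraph hV, Represents V y.1 (fun z => u z.1) ∧
      Represents V y.2.2.1 fun z => posOp V u z.1 := by
  obtain ⟨e, he⟩ := hu.tempered_fst.exists_represents hV
  obtain ⟨x, hx⟩ := (isTempered_transport_fst (V := V) hu).exists_represents hV
  obtain ⟨l, hl⟩ := (hu.posOp hV).tempered_fst.exists_represents hV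
  obtain ⟨w, hw⟩ := (isTempered_transport_transport_fst hV hu).exists_represents hV
  exact ⟨(e, x, l, w), ⟨u, hu, he, hx, hl.congr fun z => (ellipticOp_fst hu.smooth z).symm, hw⟩,
    he, hl⟩

theorem isMacroscopic_of_mem_macroGraph (hV : IsConfining V) {γ α C₂ : ℝ} (hγ : 0 < γ)
    (hα : HasSpectralGap γ V α) (hC : ∀ x, ‖iteratedFDeriv ℝ 2 V x‖ ≤ C₂)
    {y : B2 V × B2 V × B2 V × B2 V} (hy : y ∈ macroGraph hV) :
    IsMacroscopic (transportGraph V) (macroSpace V) (maxwellianB2 hV) (ellipticConst d C₂) (α / γ)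
      y := by
  obtain ⟨u, hu, h1, h2, h3, h4⟩ := hy
  obtain ⟨e, x, l, w⟩ := y
  simp only at h1 h2 h3 h4
  have su := contDiff_comp_fst hu.smooth
  have h3' : Represents V l fun z => posOp V u z.1 := h3.congr fun z => ellipticOp_fst hu.smooth z
  have hX := isSkewAdjointGraph_transportGraph hV
  have hex : (e, x) ∈ transportGraph V := mem_transportGraph hV su h1 h2
  have hxw : (x, w) ∈ transportGraph V := mem_transportGraph hV (contDiff_transport hV su) h2 h4
  have hel : (e, l) ∈ ellipticGraph V := mem_ellipticGraph_fst hV hu h1 h3'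
  have hl : l ∈ macroSpace V := mem_macroSpace (hu.posOp hV) h3'
  have hPx : (macroSpace V).starProjection x = 0 := by
    have hav : average (transport V fun z => u z.1) = fun _ => 0 :=
      funext fun x => average_transport_fst hu.smooth x
    refine starProjection_macroSpace hV (isTempered_transport_fst hu) (by rw [hav]; exact IsTest.zero)
      h2 ?_
    rw [hav]; exact Represents.zero
  have hPw : (macroSpace V).starProjection w = -l := by
    have hav : average (transport V (transport V fun z => u z.1)) = fun x => -1 * posOp V u x :=
      funext fun x => by rw [average_transport_transport_fst hu.smooth, neg_one_mul]
    refine starProjection_macroSpace hV (isTempered_transport_transport_fst hV hu)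
      (by rw [hav]; exact (hu.posOp hV).const_mul _) h4 ?_
    rw [hav]
    exact h3'.neg.congr fun z => (neg_one_mul _).symm
  have hinner : inner ℂ (maxwellianB2 hV) l = 0 := by
    have := ellipticGraph_symm hV (maxwellianB2_mem_ellipticGraph hV) hel
    simpa using this.symm
  refine ⟨hex, hxw, mem_macroSpace hu h1, hl, hPx, hPw,
    norm_transport_transport_le hV hC hu h1 h3' h4, hinner, ?_⟩
  set m := maxwellianB2 hV with hm
  set c : ℂ := inner ℂ m e with hc
  have hmm : inner ℂ m m = (1 : ℂ) := by
    rw [inner_self_eq_norm_sq_to_K, norm_maxwellianB2]; simp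
  have hmem : (e - c • m, l) ∈ ellipticGraph V := by
    have := sub_mem hel ((ellipticGraph V).smul_mem c (maxwellianB2_mem_ellipticGraph hV))
    simpa using this
  have hp := hα.poincare hV hγ hmem (by
    simp only [inner_sub_right, inner_smul_right, ← hm, hmm, mul_one, ← hc, sub_self])
  have e1 : ‖e - c • m‖ ^ 2 = ‖e‖ ^ 2 - ‖c‖ ^ 2 := by
    rw [← re_inner_self_eq, ← re_inner_self_eq e]
    simp only [inner_sub_right, inner_sub_left, inner_smul_right, inner_smul_left, hmm, ← hc, mul_one]
    have hce : inner ℂ e m = starRingEnd ℂ c := by rw [hc, inner_conj_symm]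
    have hcc : c * starRingEnd ℂ c = ((‖c‖ ^ 2 : ℝ) : ℂ) := by
      rw [Complex.mul_conj, Complex.normSq_eq_norm_sq]
    rw [hce]
    simp only [Complex.sub_re]
    rw [mul_comm (starRingEnd ℂ c), hcc, Complex.ofReal_re]
    simp
  have e2 : (inner ℂ (e - c • m) l).re = ‖x‖ ^ 2 := by
    rw [inner_sub_left, inner_smul_left, hinner, mul_zero, sub_zero]
    have h5 := hX.skew _ hex _ hxw
    simp only at h5
    rw [← inner_starProjection_left_eq (mem_macroSpace hu h1), hPw, inner_neg_right] at h5
    rw [neg_injective h5, re_inner_self_eq]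
  simp only at hp
  rw [e1, e2] at hp
  exact hp

/-! ### Solutions in the sense of distributions -/

theorem integrable_B2 (hV : IsConfining V) (g : B2 V) : Integrable g (volume : Measure (Phase d)) := by
  simpa using (represents_maxwellianB2 hV).integrable_conj_mul hV g

theorem Represents.inner_conj_eq (hV : IsConfining V) {φ : Phase d → ℂ} {e : B2 V}
    (he : Represents V e fun z => starRingEnd ℂ (φ z)) (g : B2 V) :
    inner ℂ e g = ∫ z, g z * φ z := by
  rw [he.inner_eq hV]
  simp only [Complex.conj_conj, mul_comm]

theorem IsTest.integrable_B2_mul (hV : IsConfining V) {φ : Phase d → ℂ} (hφ : IsTest φ) (g : B2 V) :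
    Integrable fun z => g z * φ z := by
  obtain ⟨C, hC⟩ := hφ.continuous.bounded_above_of_compact_support hφ.compact
  exact (integrable_B2 hV g).mul_bdd hφ.continuous.aestronglyMeasurable (Eventually.of_forall hC)

theorem average_conj (φ : Phase d → ℂ) (x : Pos d) :
    average (fun z => starRingEnd ℂ (φ z)) x = starRingEnd ℂ (average φ x) := by
  simp only [average]
  rw [← integral_conj]
  simp

theorem integral_gain_mul (hV : IsConfining V) {φ : Phase d → ℂ} (hφ : IsTest φ) (g : B2 V) :
    Integrable (fun z : Phase d => (∫ v, g (z.1, v)) * velocityMaxwellian z.2 * φ z) ∧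
    ∫ z : Phase d, (∫ v, g (z.1, v)) * velocityMaxwellian z.2 * φ z
      = ∫ z : Phase d, g z * average φ z.1 := by
  have hg := integrable_B2 hV g
  rw [Measure.volume_eq_prod] at hg
  obtain ⟨C, hC⟩ := hφ.continuous.bounded_above_of_compact_support hφ.compact
  obtain ⟨C', hC'⟩ := hφ.average.continuous.bounded_above_of_compact_support hφ.average.compact
  have h1 : Integrable (fun z : Phase d => (∫ v, g (z.1, v)) * (velocityMaxwellian z.2 : ℂ) * φ z)
      ((volume : Measure (Pos d)).prod volume) := by
    have hμ : Integrable fun v : Pos d => (velocityMaxwellian v : ℂ) := by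
      simpa using integrable_velocityMaxwellian_mul (d := d) (a := fun _ => 1) (C := 1) (k := 0)
        continuous_const (by simp)
    exact (hg.integral_prod_left.mul_prod hμ).mul_bdd hφ.continuous.aestronglyMeasurable
      (Eventually.of_forall hC)
  have h2 : Integrable (fun z : Phase d => g z * average φ z.1)
      ((volume : Measure (Pos d)).prod volume) :=
    hg.mul_bdd (hφ.average.continuous.comp continuous_fst).aestronglyMeasurable
      (Eventually.of_forall fun z => hC' z.1)
  rw [Measure.volume_eq_prod]
  refine ⟨h1, ?_⟩
  rw [integral_prod _ h1, integral_prod _ h2]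
  refine integral_congr_ae (Eventually.of_forall fun x => ?_)
  simp only [mul_assoc]
  rw [integral_const_mul, integral_mul_const, average]

/-- The collision operator, as a bounded operator of `B²`. -/
def collisionOp (γ : ℝ) (V : Pos d → ℝ) : B2 V →L[ℂ] B2 V :=
  (γ : ℂ) • ((macroSpace V).starProjection - 1)

theorem collisionOp_apply (γ : ℝ) (x : B2 V) :
    collisionOp γ V x = (γ : ℂ) • ((macroSpace V).starProjection x - x) := rfl

theorem integral_collision_mul (hV : IsConfining V) (γ : ℝ) {φ : Phase d → ℂ} (hφ : IsTest φ)
    {e : B2 V} (he : Represents V e fun z => starRingEnd ℂ (φ z)) (g : B2 V) :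
    Integrable (fun z => collision γ g z * φ z) ∧
    ∫ z, collision γ g z * φ z = inner ℂ e (collisionOp γ V g) := by
  obtain ⟨h1, h2⟩ := integral_gain_mul hV hφ g
  have h3 := hφ.integrable_B2_mul hV g
  have e1 : (fun z => collision γ g z * φ z) = fun z : Phase d =>
      (γ : ℂ) * ((∫ v, g (z.1, v)) * velocityMaxwellian z.2 * φ z - g z * φ z) := by
    funext z; simp only [collision]; ring
  rw [e1]
  refine ⟨(h1.sub h3).const_mul _, ?_⟩
  rw [integral_const_mul, integral_sub h1 h3, h2, ← he.inner_conj_eq hV]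
  obtain ⟨k, hk⟩ := hφ.average.conj.tempered_fst.exists_represents hV
  have hP : (macroSpace V).starProjection e = k := by
    have hav : average (fun z => starRingEnd ℂ (φ z)) = fun x => starRingEnd ℂ (average φ x) :=
      funext fun x => average_conj φ x
    refine starProjection_macroSpace hV hφ.conj.tempered (by rw [hav]; exact hφ.average.conj) he ?_
    rw [hav]; exact hk
  have h4 := hk.inner_conj_eq hV (φ := fun z => average φ z.1) g
  rw [← h4, ← hP, Submodule.inner_starProjection_left_eq_right, collisionOp_apply,
    inner_smul_right, inner_sub_right]

theorem weak_equation_iff (hV : IsConfining V) (γ : ℝ) {f : ℝ≥0 → B2 V} (hf : Continuous f)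
    (f₀ : B2 V) {φ : Phase d → ℂ} (hφ : IsTest φ) {e e' : B2 V}
    (he : Represents V e fun z => starRingEnd ℂ (φ z))
    (he' : Represents V e' (transport V fun z => starRingEnd ℂ (φ z))) (t : ℝ≥0) :
    (∫ z, f t z * φ z = (∫ z, f₀ z * φ z) +
      ∫ s in (0 : ℝ)..t, ∫ z, (f s.toNNReal z * fderiv ℝ φ z (z.2, -∇ V z.1) +
        collision γ (f s.toNNReal) z * φ z)) ↔
    inner ℂ e (f t - f₀ - collisionOp γ V (∫ s in (0 : ℝ)..t, f s.toNNReal))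
      = inner ℂ e' (∫ s in (0 : ℝ)..t, f s.toNNReal) := by
  have he'' : Represents V e' fun z => starRingEnd ℂ (transport V φ z) :=
    he'.congr fun z => transport_conj φ z
  have h1 : ∀ g : B2 V, ∫ z, (g z * fderiv ℝ φ z (z.2, -∇ V z.1) + collision γ g z * φ z)
      = inner ℂ e' g + inner ℂ e (collisionOp γ V g) := fun g => by
    obtain ⟨h2, h3⟩ := integral_collision_mul hV γ hφ he g
    rw [← h3, he''.inner_conj_eq hV, ← integral_add ((hφ.transport hV).integrable_B2_mul hV g) h2]
    rfl
  have hc : Continuous fun s : ℝ => f s.toNNReal := hf.comp continuous_real_toNNReal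
  have h2 : ∀ T : B2 V →L[ℂ] ℂ, ∫ s in (0 : ℝ)..t, T (f s.toNNReal)
      = T (∫ s in (0 : ℝ)..t, f s.toNNReal) := fun T =>
    T.intervalIntegral_comp_comm (hc.intervalIntegrable _ _)
  have h3 := h2 (innerSL ℂ e' + (innerSL ℂ e).comp (collisionOp γ V))
  simp only [add_apply, innerSL_apply_apply, ContinuousLinearMap.comp_apply] at h3
  simp_rw [h1]
  rw [h3, ← he.inner_conj_eq hV, ← he.inner_conj_eq hV, inner_sub_right, inner_sub_right]
  constructor <;> intro h <;> linear_combination h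

theorem isSolution_iff_isMildSolution (hV : IsConfining V) (γ : ℝ) {f₀ : B2 V} {f : ℝ≥0 → B2 V} :
    IsSolution γ V f₀ f ↔ IsMildSolution (transportGraph V) (collisionOp γ V) f₀ f := by
  constructor
  · intro h
    refine ⟨h.continuous, h.initial, fun p hp t => ?_⟩
    refine closure_minimal (s := (transportCore V : Set (B2 V × B2 V)))
      (t := {p | inner ℂ p.1 (f t - f₀ - collisionOp γ V (∫ s in (0 : ℝ)..t, f s.toNNReal))
        = inner ℂ p.2 (∫ s in (0 : ℝ)..t, f s.toNNReal)}) ?_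
      (isClosed_eq (by fun_prop) (by fun_prop)) hp
    rintro p ⟨φ, hφ, h1, h2⟩
    refine (weak_equation_iff hV γ h.continuous f₀ hφ.conj (e := p.1) (e' := p.2) ?_ ?_ t).1
      (h.equation _ hφ.conj.smooth hφ.conj.compact t)
    · simpa using h1
    · simpa using h2
  · intro h
    refine ⟨h.continuous, h.initial, fun φ hs hc t => ?_⟩
    have hφ : IsTest φ := ⟨hs, hc⟩
    obtain ⟨e, he⟩ := hφ.conj.tempered.exists_represents hV
    obtain ⟨e', he'⟩ := (hφ.conj.transport hV).tempered.exists_represents hV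
    exact (weak_equation_iff hV γ h.continuous f₀ hφ he he' t).2
      (h.equation (e, e') (subset_closure ⟨_, hφ.conj, he, he'⟩) t)

/-! ### Return to equilibrium -/

theorem re_inner_collisionOp_nonpos {γ : ℝ} (hγ : 0 < γ) (x : B2 V) :
    (inner ℂ x (collisionOp γ V x)).re ≤ 0 := by
  have h1 : inner ℂ x ((macroSpace V).starProjection x)
      = inner ℂ ((macroSpace V).starProjection x) ((macroSpace V).starProjection x) := by
    rw [Submodule.inner_starProjection_left_eq_right, Submodule.starProjection_eq_self_iff.2
      (Submodule.starProjection_apply_mem _ _)]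
  have h2 := (macroSpace V).norm_starProjection_apply_le x
  rw [collisionOp_apply, inner_smul_right, inner_sub_right, h1,
    Complex.re_ofReal_mul, Complex.sub_re, re_inner_self_eq, re_inner_self_eq]
  have := norm_nonneg ((macroSpace V).starProjection x)
  exact mul_nonpos_of_nonneg_of_nonpos hγ.le (by nlinarith)

theorem collisionOp_maxwellianB2 (hV : IsConfining V) (γ : ℝ) :
    collisionOp γ V (maxwellianB2 hV) = 0 := by
  rw [collisionOp_apply,
    Submodule.starProjection_eq_self_iff.2 (maxwellianB2_mem_macroSpace hV), sub_self, smul_zero]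

theorem isMildSolution_maxwellianB2 (hV : IsConfining V) (γ : ℝ) :
    IsMildSolution (transportGraph V) (collisionOp γ V) (maxwellianB2 hV)
      fun _ => maxwellianB2 hV := by
  refine ⟨continuous_const, rfl, fun p hp t => ?_⟩
  have h1 := (isSkewAdjointGraph_transportGraph hV).skew _ hp _ (maxwellianB2_mem_transportGraph hV)
  simp only [inner_zero_right] at h1
  rw [intervalIntegral.integral_const, ← Complex.coe_smul, map_smul, collisionOp_maxwellianB2,
    smul_zero, sub_self, sub_zero, inner_zero_right, inner_smul_right, neg_eq_zero.1 h1.symm,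
    mul_zero]

theorem inner_maxwellianB2_eq_zero (hV : IsConfining V) {γ : ℝ} {g₀ : B2 V} {g : ℝ≥0 → B2 V}
    (hg : IsMildSolution (transportGraph V) (collisionOp γ V) g₀ g)
    (h0 : inner ℂ (maxwellianB2 hV) g₀ = 0) (t : ℝ≥0) : inner ℂ (maxwellianB2 hV) (g t) = 0 := by
  have h1 := hg.equation _ (maxwellianB2_mem_transportGraph hV) t
  have h2 : ∀ x, inner ℂ (maxwellianB2 hV) (collisionOp γ V x) = 0 := fun x => by
    rw [collisionOp_apply, inner_smul_right, inner_sub_right,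
      inner_starProjection_left_eq (maxwellianB2_mem_macroSpace hV), sub_self, mul_zero]
  simp only [inner_sub_right, inner_zero_left, h0, h2, sub_zero] at h1
  exact h1

theorem eq_zero_of_subsingleton [Subsingleton (Phase d)] (hV : IsConfining V) {g : B2 V}
    (hg : inner ℂ (maxwellianB2 hV) g = 0) : g = 0 := by
  have hM : (maxwellian V 0 : ℂ) ≠ 0 := by exact_mod_cast (maxwellian_pos hV 0).ne'
  set c : ℂ := (maxwellian V 0 : ℂ)⁻¹ * g 0 with hc
  have h1 : Represents V g fun _ => c := Eventually.of_forall fun z => by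
    rw [Subsingleton.elim z 0, hc]
    exact (mul_inv_cancel_left₀ hM _).symm
  have h2 : g = c • maxwellianB2 hV :=
    h1.eq (by simpa using (represents_maxwellianB2 hV).smul c)
  rw [h2, inner_smul_right, inner_self_eq_norm_sq_to_K, norm_maxwellianB2] at hg
  have : c = 0 := by simpa using hg
  rw [h2, this, zero_smul]

theorem norm_le_of_isMildSolution (hV : IsConfining V) {γ α C₂ δ₀ : ℝ} (hγ : 0 < γ)
    (hα : HasSpectralGap γ V α) (hC : ∀ x, ‖iteratedFDeriv ℝ 2 V x‖ ≤ C₂) (hδ₀ : 0 < δ₀)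
    (hδ₀' : δ₀ ≤ 1 / 2) (hδ : δ₀ * (1 + 3 / 2 * (ellipticConst d C₂ + γ) ^ 2) ≤ γ)
    {g₀ : B2 V} {g : ℝ≥0 → B2 V}
    (hg : IsMildSolution (transportGraph V) (collisionOp γ V) g₀ g)
    (h0 : inner ℂ (maxwellianB2 hV) g₀ = 0) (t : ℝ≥0) :
    ‖g t‖ ≤ 3 * ‖g₀‖ * Real.exp (-(δ₀ * (α / γ) ^ 2 / 18 * t)) := by
  have hgt := inner_maxwellianB2_eq_zero hV hg h0
  rcases Nat.eq_zero_or_pos d with rfl | hd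
  · rw [eq_zero_of_subsingleton hV (hgt t), norm_zero]
    positivity
  refine hypocoercive_decay (isSkewAdjointGraph_transportGraph hV) (G := macroGraph hV)
    (fun y hy => isMacroscopic_of_mem_macroGraph hV hγ hα hC hy) (fun h hh => ?_) (fun h hh => ?_)
    (maxwellianB2_mem_macroSpace hV) (ellipticConst_nonneg d C₂) hγ (div_pos hα.1 hγ)
    ((div_le_one hγ).2 (hα.le hV hγ ⟨0, hd⟩)) hδ₀ hδ₀' hδ hg hgt t
  · refine closure_mono ?_ (show h ∈ closure (macroTestSpace V : Set (B2 V)) from hh)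
    rintro e ⟨u, hu, he⟩
    obtain ⟨y, hy, h1, -⟩ := exists_mem_macroGraph hV hu
    exact ⟨y, hy, h1.eq he⟩
  · refine closure_mono ?_ (macroSpace_subset_closure_one_add_posOp hV hγ hα hh)
    rintro e ⟨u, hu, he⟩
    obtain ⟨y, hy, h1, h2⟩ := exists_mem_macroGraph hV hu
    exact ⟨y, hy, (h1.add h2).eq he⟩

end RelaxationBoltzmann

end

theorem theorem1p1 (d : ℕ) (γ : ℝ) (hγ : 0 < γ) (C₂ C₃ : ℝ) :
    ∃ A : ℝ, 0 < A ∧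
      ∀ (V : RelaxationBoltzmann.Pos d → ℝ) (hV : RelaxationBoltzmann.IsConfining V),
        (∀ x, ‖iteratedFDeriv ℝ 2 V x‖ ≤ C₂) → (∀ x, ‖iteratedFDeriv ℝ 3 V x‖ ≤ C₃) →
        ∀ α : ℝ, RelaxationBoltzmann.HasSpectralGap γ V α →
          ∀ f₀ : RelaxationBoltzmann.B2 V, MeasureTheory.Integrable f₀ → ∫ z, f₀ z = 1 →
            (∃! f : ℝ≥0 → RelaxationBoltzmann.B2 V, RelaxationBoltzmann.IsSolution γ V f₀ f) ∧
            ∀ f : ℝ≥0 → RelaxationBoltzmann.B2 V, RelaxationBoltzmann.IsSolution γ V f₀ f →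
              ∀ t : ℝ≥0,
                ‖f t - RelaxationBoltzmann.maxwellianB2 hV‖ ≤
                  3 * ‖f₀ - RelaxationBoltzmann.maxwellianB2 hV‖ * Real.exp (-(α ^ 2 * t / A)) := by
  open RelaxationBoltzmann in
  have hK : 0 < 1 + 3 / 2 * (ellipticConst d C₂ + γ) ^ 2 := by positivity
  set δ₀ : ℝ := min (1 / 2) (γ / (1 + 3 / 2 * (ellipticConst d C₂ + γ) ^ 2)) with hδ₀
  have hδ₀0 : 0 < δ₀ := lt_min (by norm_num) (div_pos hγ hK)
  have hδ : δ₀ * (1 + 3 / 2 * (ellipticConst d C₂ + γ) ^ 2) ≤ γ :=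
    (le_div_iff₀ hK).1 (min_le_right _ _)
  refine ⟨18 * γ ^ 2 / δ₀, by positivity, fun V hV hC _ α hα f₀ _ hf₀ => ⟨?_, fun f hf t => ?_⟩⟩
  · simp_rw [isSolution_iff_isMildSolution hV]
    have hX := isSkewAdjointGraph_transportGraph hV
    obtain ⟨f, hf⟩ := hX.exists_isMildSolution (re_inner_collisionOp_nonpos hγ) f₀
    exact ⟨f, hf, fun g hg => IsMildSolution.unique hX (re_inner_collisionOp_nonpos hγ) hg hf⟩
  · have hg := ((isSolution_iff_isMildSolution hV γ).1 hf).sub (isMildSolution_maxwellianB2 hV γ)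
    have h0 : inner ℂ (maxwellianB2 hV) (f₀ - maxwellianB2 hV) = 0 := by
      rw [inner_sub_right, inner_self_eq_norm_sq_to_K, norm_maxwellianB2,
        (represents_maxwellianB2 hV).inner_eq hV]
      simp [hf₀]
    have key := norm_le_of_isMildSolution hV hγ hα hC hδ₀0 (min_le_left _ _) hδ hg h0 t
    refine key.trans (le_of_eq ?_)
    congr 3
    field_simp
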